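/- Let $V:\mathbb{R}\to\mathbb{R}$ be smooth and exponentially decaying, $|V(x)|\le M e^{-c|x|}$ for some $M$ and some $c>0$, and let $H=-\partial_{xx}+V$ on $L^2(\mathbb{R};\mathbb{C})$ with its standard domain $H^2(\mathbb{R})$. Suppose that $H$ has no eigenvalues and no resonance at $0$; the latter means that $V$ is generic, i.e. $\int V(x)\psi_\pm(x)\,dx\ne 0$, where $\psi_\pm$ are the zero-energy Jost functions, the solutions of $-\psi_\pm''+V\psi_\pm=0$ with $\psi_\pm(x)\to1$ as $x\to\pm\infty$. Write $\langle x\rangle=(1+|x|^2)^{1/2}$ and $R(z)=(H-z)^{-1}$. Let $\phi_1,\phi_2:\mathbb{R}\to[0,\infty)$ be smooth functions with $\phi_1+\phi_2=1$, $\phi_1(\lambda)=1$ for $|\lambda|\le1$ and $\phi_1(\lambda)=0$ for $|\lambda|\ge2$, and let $\alpha>1$. For $\beta\in\{\alpha,\alpha+1\}$ and either choice of sign, the limit \[ \langle x\rangle^{-\beta}R(\tau\pm i0)\langle x\rangle^{-\beta}:=\lim_{\varepsilon\to0^+}\langle x\rangle^{-\beta}R(\tau\pm i\varepsilon)\langle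 x\rangle^{-\beta} \] exists in the operator norm of bounded operators on $L^\infty(\mathbb{R};\mathbb{C})$ for every $\tau\in\mathbb{R}$; for $\tau<0$ the point $\tau$ is in the resolvent set and the limit is $\langle x\rangle^{-\beta}R(\tau)\langle x\rangle^{-\beta}$. Moreover, there is a constant $C$ (depending on $V$, $\alpha$, $\phi_1$, $\phi_2$) such that, for both signs: (i) $\displaystyle\sup_{\tau\in\mathbb{R}}\big\|\langle x\rangle^{-\alpha}R(\tau\pm i0)\langle x\rangle^{-\alpha}\big\|_{L^\infty_x\to L^\infty_x}\le C$; (ii) $\tau\mapsto\langle x\rangle^{-\alpha-1}R(\tau\pm i0)\langle x\rangle^{-\alpha-1}$ is differentiable in operator norm at every $\tau\neq0$, and \[ \sup_{\tau\ne0}\big\|\langle x\rangle^{-\alpha-1}\phi_1(\tau)\,\tau\,\partial_\tau R(\tau\pm i0)\langle x\rangle^{-\alpha-1}\big\|_{L^\infty_x\to L^\infty_x}\le C; \] (iii) $\displaystyle\sup_{\tau\ne0}\big\|\langle x\rangle^{-\alpha-1}\phi_2(\tau)\,\partial_\tau R(\tau\pm i0)\langle x\rangle^{-\alpha-1}\big\|_{L^\infty_x\to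 L^\infty_x}\le C$. -/

import Mathlib

open MeasureTheory Filter Topology
open scoped ENNReal ContDiff

namespace Schrodinger

/-- The complex Hilbert space `L²(ℝ)`. -/
abbrev L2 : Type := Lp ℂ 2 (volume : Measure ℝ)

/-- The complex Banach space `L^∞(ℝ)`. -/
abbrev Linfty : Type := Lp ℂ ∞ (volume : Measure ℝ)

/-- The Japanese bracket `⟨x⟩ = (1 + |x|²)^{1/2}`. -/
noncomputable def bracket (x : ℝ) : ℝ := Real.sqrt (1 + |x| ^ 2)

/-- `V` decays exponentially: `|V(x)| ≤ M e^{-c|x|}` for some `M` and some `c > 0`. -/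
def DecaysExponentially (V : ℝ → ℝ) : Prop :=
  ∃ M c : ℝ, 0 < c ∧ ∀ x, |V x| ≤ M * Real.exp (-(c * |x|))

/-- `u` belongs to the domain of the operator `H = -∂ₓₓ + V` on `L²(ℝ)`, and `H u = h`.

The domain consists of the `u ∈ L²` that have a continuously differentiable representative `v`
whose derivative `w` is locally absolutely continuous, and for which `-v'' + V v ∈ L²`; the last
condition says that `w' = V v - h` almost everywhere, written here in integrated form. For bounded
continuous `V` this domain is the Sobolev space `H²(ℝ)`, on which `H` is self-adjoint. -/
def IsImage (V : ℝ → ℝ) (u h : L2) : Prop :=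
  ∃ v w : ℝ → ℂ, u =ᵐ[volume] v ∧ (∀ x, HasDerivAt v (w x) x) ∧
    ∀ x, w x = w 0 + ∫ t in (0 : ℝ)..x, ((V t : ℂ) * v t - h t)

/-- `μ` is an eigenvalue of `H = -∂ₓₓ + V` on `L²(ℝ)`. -/
def IsEigenvalue (V : ℝ → ℝ) (μ : ℂ) : Prop :=
  ∃ u : L2, u ≠ 0 ∧ IsImage V u (μ • u)

/-- `z` belongs to the resolvent set of `H`, and the bounded operator `R` on `L²(ℝ)` is the
resolvent `R(z) = (H - z)⁻¹`: for all `u` and `g`, one has `u ∈ dom H` and `(H - z) u = g`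
if and only if `u = R g`. -/
def IsResolvent (V : ℝ → ℝ) (z : ℂ) (R : L2 →L[ℂ] L2) : Prop :=
  ∀ u g : L2, IsImage V u (g + z • u) ↔ u = R g

/-- `ψ` is a classical solution of `-ψ'' + V ψ = k² ψ` on `ℝ`. -/
def SolvesAtEnergy (V : ℝ → ℝ) (k : ℝ) (ψ : ℝ → ℂ) : Prop :=
  ∃ ψ' : ℝ → ℂ, (∀ x, HasDerivAt ψ (ψ' x) x) ∧
    ∀ x, HasDerivAt ψ' (((V x : ℂ) - (k : ℂ) ^ 2) * ψ x) x

/-- `ψ` is the Jost function `ψ₊(·, k)`: it solves `H ψ = k² ψ`, and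
`m₊(x, k) = e^{-ikx} ψ(x) → 1` as `x → +∞`. -/
def IsJostPlus (V : ℝ → ℝ) (k : ℝ) (ψ : ℝ → ℂ) : Prop :=
  SolvesAtEnergy V k ψ ∧
    Tendsto (fun x : ℝ => Complex.exp (-(Complex.I * k * x)) * ψ x) atTop (𝓝 1)

/-- `ψ` is the Jost function `ψ₋(·, k)`: it solves `H ψ = k² ψ`, and
`m₋(x, k) = e^{ikx} ψ(x) → 1` as `x → -∞`. -/
def IsJostMinus (V : ℝ → ℝ) (k : ℝ) (ψ : ℝ → ℂ) : Prop :=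
  SolvesAtEnergy V k ψ ∧
    Tendsto (fun x : ℝ => Complex.exp (Complex.I * k * x) * ψ x) atBot (𝓝 1)

/-- `V` is generic, i.e. `H` has no resonance (at the threshold `0`): `∫ V(x) m_±(x, 0) dx ≠ 0`.
At `k = 0` one has `m_± = ψ_±`. -/
def IsGeneric (V : ℝ → ℝ) : Prop :=
  (∀ ψ, IsJostPlus V 0 ψ → ∫ x, (V x : ℂ) * ψ x ≠ 0) ∧
    ∀ ψ, IsJostMinus V 0 ψ → ∫ x, (V x : ℂ) * ψ x ≠ 0

/-- `z` is in the resolvent set of `H`, and the bounded operator `A` on `L^∞(ℝ)` is the weighted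
resolvent `⟨x⟩^{-β} R(z) ⟨x⟩^{-β}`: for every `f ∈ L^∞` the function `g = ⟨x⟩^{-β} f` is in `L²`,
and `A f = ⟨x⟩^{-β} R(z) g`. -/
def IsWeightedResolvent (V : ℝ → ℝ) (β : ℝ) (z : ℂ) (A : Linfty →L[ℂ] Linfty) : Prop :=
  ∃ R : L2 →L[ℂ] L2, IsResolvent V z R ∧
    ∀ f : Linfty, ∃ g : L2,
      (g =ᵐ[volume] fun x => ((bracket x ^ (-β) : ℝ) : ℂ) * f x) ∧
      (A f =ᵐ[volume] fun x => ((bracket x ^ (-β) : ℝ) : ℂ) * (R g) x)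

/-- For `s = 1` or `s = -1`: the bounded operator `A` on `L^∞(ℝ)` is the weighted boundary value
`⟨x⟩^{-β} R(τ ± i0) ⟨x⟩^{-β}` of the resolvent, i.e. the limit in operator norm of
`⟨x⟩^{-β} R(τ ± iε) ⟨x⟩^{-β}` as `ε → 0⁺`. -/
def IsWeightedBoundaryResolvent (V : ℝ → ℝ) (β s τ : ℝ) (A : Linfty →L[ℂ] Linfty) : Prop :=
  ∃ T : ℝ → (Linfty →L[ℂ] Linfty),
    (∀ ε : ℝ, 0 < ε → IsWeightedResolvent V β ((τ : ℂ) + (s : ℂ) * (ε : ℂ) * Complex.I) (T ε)) ∧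
    Tendsto T (𝓝[>] 0) (𝓝 A)

/-- The low/high frequency cutoffs: smooth nonnegative functions with `φ₁ + φ₂ = 1`,
`φ₁ = 1` on `|λ| ≤ 1` and `φ₁ = 0` on `|λ| ≥ 2`. -/
def IsCutoffPair (φ₁ φ₂ : ℝ → ℝ) : Prop :=
  ContDiff ℝ ∞ φ₁ ∧ ContDiff ℝ ∞ φ₂ ∧ (∀ t, 0 ≤ φ₁ t) ∧ (∀ t, 0 ≤ φ₂ t) ∧
    (∀ t, φ₁ t + φ₂ t = 1) ∧ (∀ t, |t| ≤ 1 → φ₁ t = 1) ∧ ∀ t, 2 ≤ |t| → φ₁ t = 0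

end Schrodinger

/-! Put `τ = k²` with `Im k ≥ 0`. For `Im k > 0` the resolvent `R(k²)` is the integral operator with
kernel `G(x, y) = -ψ₊(max x y) ψ₋(min x y) / W(k)`, where `W` is the Wronskian of the Jost solutions
(`isImage_of_green`). Exponential decay of `V` makes `m± = e^{∓ikx} ψ±` holomorphic in a strip below
the real axis as well. In the closed upper half-plane `W` has no zero (`wronskian_ne_zero`): one
with `Im k > 0` would give an eigenfunction, one at real `k ≠ 0` contradicts conservation of flux,
one at `k = 0` contradicts genericity. Since `W` behaves like `2ik` for large `k`, compactness gives
`|W| ≥ c(1 + |k|)` in a thinner strip.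

For fixed `x, y` all exponential losses are bounded when `Im k > -δ / (1 + |x| + |y|)`; there `|G| ≤
C(1 + |x|)` and `|k| |G| ≤ C` (`exists_greenKernel`). Derivatives in `k` then come from Cauchy's
estimate on discs of radius comparable to `1 / (1 + |x| + |y|)`, with no separate analysis of
`∂ₖψ±`. The decisive bound is `|k| |∂ₖG| ≤ C(1 + |x| + |y|)`, uniform down to the threshold
(`norm_mul_norm_deriv_green_le`).

On `L^∞` an operator norm is bounded by integrating the kernel in `y`: the left weight absorbs
growth in `x`, and the right weight must stay integrable. This costs `α > 1` for `G` and `α + 1` for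
`∂ₖG`. Norm continuity and differentiability use the same scheme with a small Hölder exponent that
fits into the room left by `α > 1` (`exists_weighted_operator`,
`weighted_operator_hasDerivWithinAt`).

Finally `∂_τ = (2k)⁻¹ ∂ₖ`, so `|τ| ‖∂_τ R‖ = |k| ‖∂ₖR‖ / 2` in the weighted norm is bounded for all
`τ ≠ 0`. This one bound gives (ii) and (iii), because `φ₁ ≤ 1` and `φ₂ ≤ |τ|`. -/

namespace Schrodinger

/-! ### Holomorphic dependence of integrals on a parameter -/

/-- For holomorphic integrands a bound on the integrand alone suffices: Cauchy's estimate on discs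
of fixed radius turns it into an integrable bound on the derivative in `k`. -/
theorem differentiableOn_integral_of_bounded {X : Type*} [MeasurableSpace X] {μ : Measure X}
    {Ω : Set ℂ} (hΩ : IsOpen Ω) {F : ℂ → X → ℂ} {bound : X → ℝ}
    (hmeas : ∀ k ∈ Ω, AEStronglyMeasurable (F k) μ)
    (hdiff : ∀ᵐ t ∂μ, DifferentiableOn ℂ (fun k => F k t) Ω)
    (hbound : ∀ᵐ t ∂μ, ∀ k ∈ Ω, ‖F k t‖ ≤ bound t) (hint : Integrable bound μ) :
    DifferentiableOn ℂ (fun k => ∫ t, F k t ∂μ) Ω := by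
  intro k₀ hk₀
  obtain ⟨R, hR, hball⟩ := Metric.isOpen_iff.1 hΩ k₀ hk₀
  -- Closed discs of radius `r` about points of the ball of radius `r` at `k₀` must stay inside the
  -- ball of radius `R`.
  set r := R / 4 with hr
  have hr0 : 0 < r := by positivity
  have hsub : Metric.ball k₀ r ⊆ Ω := (Metric.ball_subset_ball (by linarith)).trans hball
  have hint0 : ∀ k ∈ Ω, Integrable (F k) μ := fun k hk =>
    hint.mono' (hmeas k hk) (hbound.mono fun t ht => ht k hk)
  have hder : ∀ᵐ t ∂μ, ∀ k ∈ Metric.ball k₀ r,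
      HasDerivAt (fun k => F k t) (deriv (fun k => F k t) k) k := by
    filter_upwards [hdiff] with t ht k hk
    exact (ht.differentiableAt (hΩ.mem_nhds (hsub hk))).hasDerivAt
  refine DifferentiableAt.differentiableWithinAt ?_
  refine (hasDerivAt_integral_of_dominated_loc_of_deriv_le (F' := fun k t => deriv (fun k => F k t) k)
    (bound := fun t => bound t / r) (s := Metric.ball k₀ r)
    (Metric.ball_mem_nhds _ hr0) ?_ (hint0 k₀ hk₀) ?_ ?_ (hint.div_const r)
    hder).2.differentiableAt
  · filter_upwards [hΩ.mem_nhds hk₀] with k hk using hmeas k hk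
  -- The derivative is measurable in `t` as a pointwise limit of slopes along a sequence; increments
  -- of at most `r / 2` keep the sequence in the ball.
  · have hu : Tendsto (fun n : ℕ => k₀ + ((r / 2 / ((n : ℝ) + 1) : ℝ) : ℂ)) atTop (𝓝[≠] k₀) := by
      refine tendsto_nhdsWithin_iff.2 ⟨?_, Eventually.of_forall fun n => ?_⟩
      · have h1 : Tendsto (fun n : ℕ => (r / 2 / ((n : ℝ) + 1) : ℝ)) atTop (𝓝 0) :=
          Tendsto.div_atTop tendsto_const_nhds
            (tendsto_atTop_add_const_right _ _ tendsto_natCast_atTop_atTop)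
        have h2 := (Complex.continuous_ofReal.tendsto 0).comp h1
        simpa using h2.const_add k₀
      · have : (r / 2 / ((n : ℝ) + 1) : ℝ) ≠ 0 := by positivity
        simpa only [Set.mem_compl_iff, Set.mem_singleton_iff, add_eq_left, Complex.ofReal_eq_zero] using this
    refine aestronglyMeasurable_of_tendsto_ae atTop
      (f := fun (n : ℕ) t => slope (fun k => F k t) k₀ (k₀ + ((r / 2 / ((n : ℝ) + 1) : ℝ) : ℂ)))
      (fun n => ?_) ?_
    · have hmem : k₀ + ((r / 2 / ((n : ℝ) + 1) : ℝ) : ℂ) ∈ Ω := by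
        refine hsub ?_
        rw [Metric.mem_ball, dist_eq_norm, add_sub_cancel_left, Complex.norm_real, Real.norm_eq_abs,
          abs_of_pos (by positivity)]
        have : r / 2 / ((n : ℝ) + 1) ≤ r / 2 := div_le_self (by positivity) (by linarith [n.cast_nonneg (α := ℝ)])
        linarith
      simp only [slope_def_module]
      exact AEStronglyMeasurable.const_smul ((hmeas _ hmem).sub (hmeas _ hk₀)) ((k₀ + ((r / 2 / ((n : ℝ) + 1) : ℝ) : ℂ) - k₀)⁻¹)
    · filter_upwards [hder] with t ht
      exact ((hasDerivAt_iff_tendsto_slope.1 (ht k₀ (Metric.mem_ball_self hr0))).comp hu)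
  · filter_upwards [hdiff, hbound] with t ht hb k hk
    have hsub' : Metric.closedBall k r ⊆ Ω := by
      intro z hz
      refine hball ?_
      rw [Metric.mem_ball] at *
      rw [Metric.mem_closedBall] at hz
      linarith [dist_triangle z k k₀]
    refine Complex.norm_deriv_le_of_forall_mem_sphere_norm_le hr0 ?_
      fun z hz => hb z (hsub' (Metric.sphere_subset_closedBall hz))
    exact (ht.mono hsub').diffContOnCl_ball subset_rfl

/-! ### Weight functions -/

/-- `1 - x / √(1+x²)`, a decreasing weight which is `O(x⁻²)` at `+∞` and bounded by `2`. -/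
noncomputable def tailWeight (x : ℝ) : ℝ := 1 - x / Real.sqrt (1 + x ^ 2)

/-- `√(1+x²) - x`, the integral of `tailWeight` over `(x, ∞)`. -/
noncomputable def growthWeight (x : ℝ) : ℝ := Real.sqrt (1 + x ^ 2) - x

theorem sqrt_one_add_sq_pos (x : ℝ) : 0 < Real.sqrt (1 + x ^ 2) := Real.sqrt_pos.2 (by positivity)

theorem abs_lt_sqrt_one_add_sq (x : ℝ) : |x| < Real.sqrt (1 + x ^ 2) := by
  rw [← Real.sqrt_sq_eq_abs]; exact Real.sqrt_lt_sqrt (sq_nonneg x) (by linarith)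

theorem growthWeight_pos (x : ℝ) : 0 < growthWeight x := by
  have := abs_lt_sqrt_one_add_sq x
  have := le_abs_self x
  unfold growthWeight; linarith

theorem sqrt_one_add_sq_le (x : ℝ) : Real.sqrt (1 + x ^ 2) ≤ 1 + |x| := by
  refine Real.sqrt_le_iff.2 ⟨by positivity, ?_⟩
  nlinarith [sq_abs x, abs_nonneg x]

theorem growthWeight_le (x : ℝ) : growthWeight x ≤ 1 + 2 * max 0 (-x) := by
  unfold growthWeight
  have h := sqrt_one_add_sq_le x
  rcases le_total 0 x with hx | hx
  · rw [abs_of_nonneg hx] at h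
    rw [max_eq_left (by linarith)]; linarith
  · rw [abs_of_nonpos hx] at h
    rw [max_eq_right (by linarith)]; linarith

theorem tailWeight_pos (x : ℝ) : 0 < tailWeight x := by
  have h1 := abs_lt_sqrt_one_add_sq x
  have h2 := le_abs_self x
  have h3 := sqrt_one_add_sq_pos x
  unfold tailWeight
  rw [sub_pos, div_lt_one h3]; linarith

theorem tailWeight_le_two (x : ℝ) : tailWeight x ≤ 2 := by
  have h1 := abs_lt_sqrt_one_add_sq x
  have h2 := neg_abs_le x
  have h3 := sqrt_one_add_sq_pos x
  unfold tailWeight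
  have : -1 ≤ x / Real.sqrt (1 + x ^ 2) := by rw [le_div_iff₀ h3]; linarith
  linarith

theorem hasDerivAt_sqrt_one_add_sq (x : ℝ) :
    HasDerivAt (fun x : ℝ => Real.sqrt (1 + x ^ 2)) (x / Real.sqrt (1 + x ^ 2)) x := by
  have h : HasDerivAt (fun x : ℝ => 1 + x ^ 2) (2 * x) x := by
    simpa using (hasDerivAt_pow 2 x).const_add 1
  convert h.sqrt (by positivity) using 1
  field_simp

theorem hasDerivAt_growthWeight (x : ℝ) : HasDerivAt growthWeight (-tailWeight x) x := by
  have h := (hasDerivAt_sqrt_one_add_sq x).sub (hasDerivAt_id x)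
  have e : -tailWeight x = x / Real.sqrt (1 + x ^ 2) - 1 := by unfold tailWeight; ring
  rw [e]; exact h

theorem growthWeight_eq_inv (x : ℝ) : growthWeight x = (Real.sqrt (1 + x ^ 2) + x)⁻¹ := by
  have h1 := abs_lt_sqrt_one_add_sq x
  have h2 := neg_abs_le x
  have h3 : Real.sqrt (1 + x ^ 2) ^ 2 = 1 + x ^ 2 := Real.sq_sqrt (by positivity)
  unfold growthWeight
  refine eq_inv_of_mul_eq_one_left ?_
  nlinarith

theorem tendsto_growthWeight : Tendsto growthWeight atTop (𝓝 0) := by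
  have : growthWeight = fun x => (Real.sqrt (1 + x ^ 2) + x)⁻¹ := funext growthWeight_eq_inv
  rw [this]
  exact (tendsto_atTop_mono (fun x => by
    have := sqrt_one_add_sq_pos x
    simp only [id]; linarith) tendsto_id).inv_tendsto_atTop

theorem integrableOn_tailWeight (x : ℝ) : IntegrableOn tailWeight (Set.Ioi x) := by
  have := integrableOn_Ioi_deriv_of_nonpos' (fun y _ => hasDerivAt_growthWeight y)
    (fun y (_ : y ∈ Set.Ioi x) => by linarith [tailWeight_pos y]) tendsto_growthWeight
  simpa using this.neg

theorem integral_tailWeight (x : ℝ) : ∫ s in Set.Ioi x, tailWeight s = growthWeight x := by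
  have := integral_Ioi_of_hasDerivAt_of_nonpos' (fun y _ => hasDerivAt_growthWeight y)
    (fun y (_ : y ∈ Set.Ioi x) => by linarith [tailWeight_pos y]) tendsto_growthWeight
  rw [integral_neg] at this
  linarith

theorem tailWeight_antitone : Antitone tailWeight := by
  intro x y hxy
  have hx := sqrt_one_add_sq_pos x
  have hy := sqrt_one_add_sq_pos y
  unfold tailWeight
  have hsx : Real.sqrt (1 + x ^ 2) ^ 2 = 1 + x ^ 2 := Real.sq_sqrt (by positivity)
  have hsy : Real.sqrt (1 + y ^ 2) ^ 2 = 1 + y ^ 2 := Real.sq_sqrt (by positivity)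
  have : x / Real.sqrt (1 + x ^ 2) ≤ y / Real.sqrt (1 + y ^ 2) := by
    rw [div_le_div_iff₀ hx hy]
    by_contra! hlt
    have hfac : (x * Real.sqrt (1 + y ^ 2)) ^ 2 - (y * Real.sqrt (1 + x ^ 2)) ^ 2 = x ^ 2 - y ^ 2 := by
      rw [mul_pow, mul_pow, hsx, hsy]; ring
    rcases le_total 0 y with h | h
    · have h0 : 0 ≤ y * Real.sqrt (1 + x ^ 2) := by positivity
      have : 0 < x := by
        by_contra! hx0
        nlinarith [mul_nonneg (neg_nonneg.2 hx0) hy.le]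
      nlinarith
    · have h0 : x * Real.sqrt (1 + y ^ 2) ≤ 0 :=
        mul_nonpos_of_nonpos_of_nonneg (hxy.trans h) hy.le
      nlinarith
  linarith

/-- Lets one factor `(1 + t²)⁻¹` of the decay of `V` be traded for `tailWeight x`, so that the slope
of `m₊` is integrable towards `+∞`. It rests on `(√(1+t²) - t)(√(1+t²) + t) = 1` and `√(1+t²) + t ≤
2√(1+t²)`. -/
theorem inv_one_add_sq_le_tailWeight {x t : ℝ} (hxt : x ≤ t) : (1 + t ^ 2)⁻¹ ≤ 2 * tailWeight x := by
  refine le_trans ?_ (mul_le_mul_of_nonneg_left (tailWeight_antitone hxt) two_pos.le)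
  have hs := sqrt_one_add_sq_pos t
  have hsq : Real.sqrt (1 + t ^ 2) ^ 2 = 1 + t ^ 2 := Real.sq_sqrt (by positivity)
  have h1 := abs_lt_sqrt_one_add_sq t
  have h2 := le_abs_self t
  have h3 := neg_abs_le t
  unfold tailWeight
  rw [inv_le_iff_one_le_mul₀ (by positivity)]
  have : 2 * (1 - t / Real.sqrt (1 + t ^ 2)) * (1 + t ^ 2)
      = 2 * (Real.sqrt (1 + t ^ 2) - t) * Real.sqrt (1 + t ^ 2) := by
    rw [← hsq]; field_simp
    simp only [hsq]
  rw [this]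
  have : (Real.sqrt (1 + t ^ 2) - t) * (Real.sqrt (1 + t ^ 2) + t) = 1 := by nlinarith
  nlinarith

/-- The decreasing weight `exp (-l arctan x)`. -/
noncomputable def arctanWeight (l x : ℝ) : ℝ := Real.exp (-(l * Real.arctan x))

theorem arctanWeight_pos (l x : ℝ) : 0 < arctanWeight l x := Real.exp_pos _

theorem arctanWeight_antitone {l : ℝ} (hl : 0 ≤ l) : Antitone (arctanWeight l) := fun x y hxy => by
  unfold arctanWeight
  have := mul_le_mul_of_nonneg_left (Real.arctan_mono hxy) hl
  exact Real.exp_le_exp.2 (by linarith)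

theorem arctanWeight_le {l : ℝ} (hl : 0 ≤ l) (x : ℝ) : arctanWeight l x ≤ Real.exp (2 * l) := by
  unfold arctanWeight
  refine Real.exp_le_exp.2 ?_
  have h1 := Real.neg_pi_div_two_lt_arctan x
  have h2 := Real.pi_le_four
  nlinarith

theorem le_arctanWeight {l : ℝ} (hl : 0 ≤ l) (x : ℝ) : 1 ≤ Real.exp (2 * l) * arctanWeight l x := by
  unfold arctanWeight
  rw [← Real.exp_add]
  refine Real.one_le_exp ?_
  have h1 := Real.arctan_lt_pi_div_two x
  have h2 := Real.pi_le_four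
  nlinarith

theorem hasDerivAt_arctanWeight (l x : ℝ) :
    HasDerivAt (arctanWeight l) (-(l * ((1 + x ^ 2)⁻¹ * arctanWeight l x))) x := by
  have h := ((Real.hasDerivAt_arctan x).const_mul l).neg.exp
  have e : -(l * ((1 + x ^ 2)⁻¹ * arctanWeight l x)) =
      Real.exp (-(l * Real.arctan x)) * -(l * (1 / (1 + x ^ 2))) := by
    unfold arctanWeight; ring
  rw [e]; exact h

theorem tendsto_arctanWeight (l : ℝ) :
    Tendsto (arctanWeight l) atTop (𝓝 (Real.exp (-(l * (Real.pi / 2))))) := by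
  unfold arctanWeight
  exact (Real.continuous_exp.tendsto _).comp
    (((Real.tendsto_arctan_atTop.mono_right nhdsWithin_le_nhds).const_mul l).neg)

theorem integrableOn_mul_arctanWeight {l : ℝ} (hl : 0 < l) (x : ℝ) :
    IntegrableOn (fun t => (1 + t ^ 2)⁻¹ * arctanWeight l t) (Set.Ioi x) := by
  have := integrableOn_Ioi_deriv_of_nonpos' (fun y _ => hasDerivAt_arctanWeight l y)
    (fun y (_ : y ∈ Set.Ioi x) => by
      have := arctanWeight_pos l y
      exact neg_nonpos.2 (by positivity)) (tendsto_arctanWeight l)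
  have h2 := this.neg.const_mul l⁻¹
  refine h2.congr (Eventually.of_forall fun t => ?_)
  simp only [Pi.neg_apply, neg_neg]
  field_simp

/-- The weight reproduces itself with a gain `1 / l`, because its derivative is `-l (1 + t²)⁻¹`
times itself. For large `l` the Volterra map becomes a contraction, which replaces the usual `1 /
n!` estimate. -/
theorem integral_mul_arctanWeight_le {l : ℝ} (hl : 0 < l) (x : ℝ) :
    ∫ t in Set.Ioi x, (1 + t ^ 2)⁻¹ * arctanWeight l t ≤ arctanWeight l x / l := by
  have := integral_Ioi_of_hasDerivAt_of_nonpos' (fun y _ => hasDerivAt_arctanWeight l y)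
    (fun y (_ : y ∈ Set.Ioi x) => by
      have := arctanWeight_pos l y
      exact neg_nonpos.2 (by positivity)) (tendsto_arctanWeight l)
  rw [integral_neg, integral_const_mul] at this
  rw [le_div_iff₀ hl]
  have := Real.exp_pos (-(l * (Real.pi / 2)))
  linarith

/-! ### Tail integrals -/

theorem hasDerivAt_integral_Ioi {f : ℝ → ℂ} (hf : Continuous f)
    (hint : ∀ x, IntegrableOn f (Set.Ioi x)) (x : ℝ) :
    HasDerivAt (fun x => ∫ t in Set.Ioi x, f t) (-f x) x := by
  have h : (fun x => ∫ t in Set.Ioi x, f t) = fun x => (∫ t in Set.Ioi 0, f t) - ∫ t in (0:ℝ)..x, f t := by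
    funext y
    rw [← intervalIntegral.integral_Ioi_sub_Ioi' (hint 0) (hint y)]; ring
  rw [h]
  exact (intervalIntegral.integral_hasDerivAt_right (hf.intervalIntegrable _ _)
    (hf.stronglyMeasurableAtFilter _ _) hf.continuousAt).const_sub _

theorem continuous_integral_Ioi {f : ℝ → ℂ} (hint : ∀ x, IntegrableOn f (Set.Ioi x)) :
    Continuous (fun x => ∫ t in Set.Ioi x, f t) := by
  have h : (fun x => ∫ t in Set.Ioi x, f t) = fun x => (∫ t in Set.Ioi 0, f t) - ∫ t in (0:ℝ)..x, f t := by
    funext y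
    rw [← intervalIntegral.integral_Ioi_sub_Ioi' (hint 0) (hint y)]; ring
  rw [h]
  refine continuous_const.sub (intervalIntegral.continuous_primitive (fun a b => ?_) 0)
  rw [intervalIntegrable_iff]
  exact (hint (min a b)).mono_set Set.Ioc_subset_Ioi_self

end Schrodinger

namespace Schrodinger

/-! ### Volterra iteration for the Jost functions -/

/-- Weighted decay of a continuous potential, as needed for the Volterra iteration in the
strip `Im k > -η`. -/
structure DecayBound (V : ℝ → ℝ) (η M : ℝ) : Prop where
  cont : Continuous V
  eta_pos : 0 < η
  nonneg : 0 ≤ M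
  bound : ∀ t, |V t| * ((1 + growthWeight t) * Real.exp (4 * η * |t|)) ≤ M * ((1 + t ^ 2)⁻¹ ^ 2)

/-- The half-plane `Im k > -η`. -/
def upperStrip (η : ℝ) : Set ℂ := {k | -η < k.im}

theorem isOpen_upperStrip (η : ℝ) : IsOpen (upperStrip η) :=
  isOpen_lt continuous_const Complex.continuous_im

/-- The loss `e^{2 σ x₋}` with `σ = (Im k)₋`. -/
noncomputable def lossWeight (k : ℂ) (x : ℝ) : ℝ :=
  Real.exp (2 * max 0 (-k.im) * max 0 (-x))

theorem lossWeight_pos (k : ℂ) (x : ℝ) : 0 < lossWeight k x := Real.exp_pos _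

theorem lossWeight_antitone (k : ℂ) : Antitone (lossWeight k) := fun x y hxy => by
  unfold lossWeight
  have : max 0 (-y) ≤ max 0 (-x) := max_le_max le_rfl (by linarith)
  exact Real.exp_le_exp.2 (mul_le_mul_of_nonneg_left this (by positivity))

theorem max_neg_im_lt {η : ℝ} (hη : 0 < η) {k : ℂ} (hk : k ∈ upperStrip η) :
    max 0 (-k.im) < η := max_lt hη (by simp only [upperStrip, Set.mem_ofPred_eq] at hk; linarith)

theorem lossWeight_le {η : ℝ} (hη : 0 < η) {k : ℂ} (hk : k ∈ upperStrip η) (x : ℝ) :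
    lossWeight k x ≤ Real.exp (2 * η * |x|) := by
  unfold lossWeight
  have h1 := max_neg_im_lt hη hk
  have h2 : max 0 (-x) ≤ |x| := max_le (abs_nonneg x) (neg_le_abs x)
  refine Real.exp_le_exp.2 ?_
  exact mul_le_mul (by linarith) h2 (by positivity) (by positivity)

theorem norm_exp_two_I_mul (k : ℂ) (y : ℝ) :
    ‖Complex.exp (2 * Complex.I * k * y)‖ = Real.exp (-(2 * k.im * y)) := by
  rw [Complex.norm_exp]
  congr 1
  simp [Complex.mul_re, Complex.mul_im]

/-- With `σ = (Im k)₋ < η` the exponential is at most `e^{2σ(t-x)}`, and `t - x ≤ |t| + x₋` splits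
it: the `x` part is the loss weight, the `t` part is paid by the decay of `V`. -/
theorem norm_exp_two_I_mul_le {η : ℝ} (hη : 0 < η) {k : ℂ} (hk : k ∈ upperStrip η) {x t : ℝ}
    (hxt : x ≤ t) :
    ‖Complex.exp (2 * Complex.I * k * ((t - x : ℝ) : ℂ))‖
      ≤ lossWeight k x * Real.exp (2 * η * |t|) := by
  rw [norm_exp_two_I_mul, lossWeight, ← Real.exp_add]
  refine Real.exp_le_exp.2 ?_
  have h1 := max_neg_im_lt hη hk
  have h0 : 0 ≤ max 0 (-k.im) := le_max_left _ _
  have h2 : -k.im ≤ max 0 (-k.im) := le_max_right _ _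
  have h3 : t - x ≤ |t| + max 0 (-x) := by
    have := le_abs_self t
    have := le_max_right 0 (-x)
    linarith
  have h4 : -k.im * (t - x) ≤ max 0 (-k.im) * (t - x) :=
    mul_le_mul_of_nonneg_right h2 (by linarith)
  have h5 := mul_le_mul_of_nonneg_left h3 h0
  have h6 : max 0 (-k.im) * |t| ≤ η * |t| := mul_le_mul_of_nonneg_right h1.le (abs_nonneg t)
  nlinarith

/-- The bound propagated by the Volterra iteration. -/
def JostBound (l : ℝ) (k : ℂ) (a : ℝ) (m : ℝ → ℂ) : Prop :=
  ∀ t, ‖m t‖ ≤ a * ((1 + growthWeight t) * lossWeight k t * arctanWeight l t)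

/-- The slope `m'` produced by `m` in the equation `m'' + 2ik m' = V m`. -/
noncomputable def jostSlope (V : ℝ → ℝ) (k : ℂ) (m : ℝ → ℂ) (x : ℝ) : ℂ :=
  -∫ t in Set.Ioi x, Complex.exp (2 * Complex.I * k * ((t - x : ℝ) : ℂ)) * ((V t : ℂ) * m t)

/-! ### One Volterra step: bounds, differential equation, holomorphy in `k` -/

section

variable {V : ℝ → ℝ} {η M : ℝ}

/-- The factors in `DecayBound` are spent as follows: one `e^{2η|t|}` on the oscillatory kernel, one
on the loss weight of `m t`, `1 + growthWeight t` on the growth of `m`, one `(1 + t²)⁻¹` on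
`tailWeight x`, and the other is kept for the integration in `t`. -/
theorem norm_jost_integrand_le (hV : DecayBound V η M) {k : ℂ} (hk : k ∈ upperStrip η) {l a : ℝ}
    (ha : 0 ≤ a) {m : ℝ → ℂ} (hm : JostBound l k a m) {x t : ℝ} (hxt : x ≤ t) :
    ‖Complex.exp (2 * Complex.I * k * ((t - x : ℝ) : ℂ)) * ((V t : ℂ) * m t)‖
      ≤ a * M * lossWeight k x * (2 * tailWeight x) * ((1 + t ^ 2)⁻¹ * arctanWeight l t) := by
  have hE := arctanWeight_pos l t
  have hg := growthWeight_pos t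
  have hlx := lossWeight_pos k x
  have h1 := norm_exp_two_I_mul_le hV.eta_pos hk hxt
  have h2 := lossWeight_le hV.eta_pos hk t
  have h3 := inv_one_add_sq_le_tailWeight hxt
  have hexp : Real.exp (2 * η * |t|) * Real.exp (2 * η * |t|) = Real.exp (4 * η * |t|) := by
    rw [← Real.exp_add]; ring_nf
  have hinv : 0 < (1 + t ^ 2)⁻¹ := by positivity
  rw [norm_mul, norm_mul, Complex.norm_real, Real.norm_eq_abs]
  calc _ ≤ (lossWeight k x * Real.exp (2 * η * |t|)) *
        (|V t| * (a * ((1 + growthWeight t) * Real.exp (2 * η * |t|) * arctanWeight l t))) := by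
        gcongr
        exact (hm t).trans (by gcongr)
    _ = a * lossWeight k x * arctanWeight l t *
        (|V t| * ((1 + growthWeight t) * Real.exp (4 * η * |t|))) := by rw [← hexp]; ring
    _ ≤ a * lossWeight k x * arctanWeight l t * (M * ((1 + t ^ 2)⁻¹ ^ 2)) :=
        mul_le_mul_of_nonneg_left (hV.bound t) (by positivity)
    _ = a * M * lossWeight k x * (1 + t ^ 2)⁻¹ * ((1 + t ^ 2)⁻¹ * arctanWeight l t) := by ring
    _ ≤ _ := by
        have := hV.nonneg
        gcongr

theorem integrableOn_jost_integrand (hV : DecayBound V η M) {k : ℂ} (hk : k ∈ upperStrip η)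
    {l a : ℝ} (hl : 0 < l) (ha : 0 ≤ a) {m : ℝ → ℂ} (hc : Continuous m) (hm : JostBound l k a m)
    (x : ℝ) :
    IntegrableOn (fun t : ℝ => Complex.exp (2 * Complex.I * k * ((t - x : ℝ) : ℂ)) *
      ((V t : ℂ) * m t)) (Set.Ioi x) := by
  refine Integrable.mono' ((integrableOn_mul_arctanWeight hl x).const_mul
    (a * M * lossWeight k x * (2 * tailWeight x))) ?_ ?_
  · have := hV.cont
    exact (by fun_prop : Continuous _).aestronglyMeasurable
  · filter_upwards [ae_restrict_mem measurableSet_Ioi] with t ht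
    exact norm_jost_integrand_le hV hk ha hm (le_of_lt ht)

theorem norm_jostSlope_le (hV : DecayBound V η M) {k : ℂ} (hk : k ∈ upperStrip η)
    {l a : ℝ} (hl : 0 < l) (ha : 0 ≤ a) {m : ℝ → ℂ} (hm : JostBound l k a m)
    (x : ℝ) :
    ‖jostSlope V k m x‖ ≤ a * (2 * M / l) * (tailWeight x * lossWeight k x * arctanWeight l x) := by
  unfold jostSlope
  rw [norm_neg]
  have hx := tailWeight_pos x
  have hlx := lossWeight_pos k x
  have := hV.nonneg
  calc _ ≤ ∫ t in Set.Ioi x, a * M * lossWeight k x * (2 * tailWeight x) *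
        ((1 + t ^ 2)⁻¹ * arctanWeight l t) := by
        refine norm_integral_le_of_norm_le ((integrableOn_mul_arctanWeight hl x).const_mul _) ?_
        filter_upwards [ae_restrict_mem measurableSet_Ioi] with t ht
        exact norm_jost_integrand_le hV hk ha hm (le_of_lt ht)
    _ ≤ a * M * lossWeight k x * (2 * tailWeight x) * (arctanWeight l x / l) := by
        rw [integral_const_mul]
        exact mul_le_mul_of_nonneg_left (integral_mul_arctanWeight_le hl x) (by positivity)
    _ = _ := by ring

theorem exp_sub_split (k : ℂ) (x t : ℝ) :
    Complex.exp (2 * Complex.I * k * ((t - x : ℝ) : ℂ)) =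
      Complex.exp (-(2 * Complex.I * k) * x) * Complex.exp (2 * Complex.I * k * t) := by
  rw [← Complex.exp_add]; congr 1; push_cast; ring

/-- Separates `x` from `t`, so that the slope can be differentiated by the product rule instead of
under the integral sign. -/
theorem jostSlope_eq (V : ℝ → ℝ) (k : ℂ) (m : ℝ → ℂ) (x : ℝ) :
    jostSlope V k m x = -(Complex.exp (-(2 * Complex.I * k) * x) *
      ∫ t in Set.Ioi x, Complex.exp (2 * Complex.I * k * t) * ((V t : ℂ) * m t)) := by
  unfold jostSlope
  rw [← integral_const_mul]
  simp_rw [exp_sub_split, mul_assoc]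

theorem hasDerivAt_jostSlope (hV : DecayBound V η M) {k : ℂ} (hk : k ∈ upperStrip η)
    {l a : ℝ} (hl : 0 < l) (ha : 0 ≤ a) {m : ℝ → ℂ} (hc : Continuous m) (hm : JostBound l k a m)
    (x : ℝ) :
    HasDerivAt (jostSlope V k m) ((V x : ℂ) * m x - 2 * Complex.I * k * jostSlope V k m x) x := by
  have hcont := hV.cont
  have hint : ∀ x : ℝ, IntegrableOn (fun t : ℝ => Complex.exp (2 * Complex.I * k * t) *
      ((V t : ℂ) * m t)) (Set.Ioi x) := fun y => by
    have := (integrableOn_jost_integrand hV hk hl ha hc hm y).const_mul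
      (Complex.exp (2 * Complex.I * k * y))
    refine this.congr (Eventually.of_forall fun t => ?_)
    simp only [exp_sub_split, ← mul_assoc, ← Complex.exp_add]
    congr 3; ring
  have h1 := hasDerivAt_integral_Ioi (f := fun t : ℝ => Complex.exp (2 * Complex.I * k * t) *
      ((V t : ℂ) * m t)) (by fun_prop) hint x
  have h2 : HasDerivAt (fun x : ℝ => Complex.exp (-(2 * Complex.I * k) * x))
      (Complex.exp (-(2 * Complex.I * k) * x) * (-(2 * Complex.I * k) * 1)) x :=
    ((Complex.ofRealCLM.hasDerivAt (x := x)).const_mul (-(2 * Complex.I * k))).cexp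
  have h3 := (h2.mul h1).neg
  have hfun : jostSlope V k m = -((fun x : ℝ => Complex.exp (-(2 * Complex.I * k) * x)) *
      fun x : ℝ => ∫ t in Set.Ioi x, Complex.exp (2 * Complex.I * k * t) * ((V t : ℂ) * m t)) := by
    funext y; exact jostSlope_eq V k m y
  rw [jostSlope_eq V k m x, hfun]
  refine h3.congr_deriv ?_
  have hee : Complex.exp (-(2 * Complex.I * k) * x) * Complex.exp (2 * Complex.I * k * x) = 1 := by
    rw [← Complex.exp_add, neg_mul, neg_add_cancel, Complex.exp_zero]
  linear_combination ((V x : ℂ) * m x) * hee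

/-- The loss and arctan weights decrease, so they leave the integral with their values at `x`; only
`tailWeight` is integrated. -/
theorem norm_integral_slope_le {k : ℂ} {l b : ℝ} (hl : 0 ≤ l) (hb : 0 ≤ b)
    {p : ℝ → ℂ} (hp : ∀ s, ‖p s‖ ≤ b * (tailWeight s * lossWeight k s * arctanWeight l s)) (x : ℝ) :
    ‖∫ s in Set.Ioi x, p s‖ ≤ b * (growthWeight x * lossWeight k x * arctanWeight l x) := by
  calc _ ≤ ∫ s in Set.Ioi x, b * lossWeight k x * arctanWeight l x * tailWeight s := by
        refine norm_integral_le_of_norm_le ((integrableOn_tailWeight x).const_mul _) ?_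
        filter_upwards [ae_restrict_mem measurableSet_Ioi] with s hs
        have h1 := lossWeight_antitone k (le_of_lt hs : x ≤ s)
        have h2 := arctanWeight_antitone hl (le_of_lt hs : x ≤ s)
        have h3 := tailWeight_pos s
        have h4 := lossWeight_pos k s
        have h5 := arctanWeight_pos l s
        have h6 := lossWeight_pos k x
        calc _ ≤ b * (tailWeight s * lossWeight k s * arctanWeight l s) := hp s
          _ ≤ b * (tailWeight s * lossWeight k x * arctanWeight l x) := by gcongr
          _ = _ := by ring
    _ = _ := by rw [integral_const_mul, integral_tailWeight]; ring

theorem integrableOn_slope {k : ℂ} {l b : ℝ} (hl : 0 ≤ l) (hb : 0 ≤ b)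
    {p : ℝ → ℂ} (hc : Continuous p)
    (hp : ∀ s, ‖p s‖ ≤ b * (tailWeight s * lossWeight k s * arctanWeight l s)) (x : ℝ) :
    IntegrableOn p (Set.Ioi x) := by
  refine Integrable.mono' ((integrableOn_tailWeight x).const_mul
    (b * lossWeight k x * arctanWeight l x)) hc.aestronglyMeasurable ?_
  filter_upwards [ae_restrict_mem measurableSet_Ioi] with s hs
  have h1 := lossWeight_antitone k (le_of_lt hs : x ≤ s)
  have h2 := arctanWeight_antitone hl (le_of_lt hs : x ≤ s)
  have h3 := tailWeight_pos s
  have h4 := lossWeight_pos k s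
  have h5 := arctanWeight_pos l s
  have h6 := lossWeight_pos k x
  calc _ ≤ b * (tailWeight s * lossWeight k s * arctanWeight l s) := hp s
    _ ≤ b * (tailWeight s * lossWeight k x * arctanWeight l x) := by gcongr
    _ = _ := by ring

theorem differentiableOn_jostSlope (hV : DecayBound V η M) {l a : ℝ} (hl : 0 < l) (ha : 0 ≤ a)
    {m : ℂ → ℝ → ℂ} (hc : ∀ k ∈ upperStrip η, Continuous (m k))
    (hm : ∀ k ∈ upperStrip η, JostBound l k a (m k))
    (hd : ∀ t, DifferentiableOn ℂ (fun k => m k t) (upperStrip η)) (x : ℝ) :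
    DifferentiableOn ℂ (fun k => jostSlope V k (m k) x) (upperStrip η) := by
  unfold jostSlope
  refine DifferentiableOn.neg ?_
  refine differentiableOn_integral_of_bounded (isOpen_upperStrip η)
    (bound := fun t => a * M * Real.exp (2 * η * |x|) * (2 * tailWeight x) *
      ((1 + t ^ 2)⁻¹ * arctanWeight l t)) ?_ ?_ ?_ ?_
  · intro k hk
    exact (integrableOn_jost_integrand hV hk hl ha (hc k hk) (hm k hk) x).aestronglyMeasurable
  · refine Eventually.of_forall fun t => ?_
    have := hd t
    fun_prop
  · filter_upwards [ae_restrict_mem measurableSet_Ioi] with t ht k hk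
    refine (norm_jost_integrand_le hV hk ha (hm k hk) (le_of_lt ht)).trans ?_
    have h1 := lossWeight_le hV.eta_pos hk x
    have h2 := hV.nonneg
    have h3 := tailWeight_pos x
    have h4 := arctanWeight_pos l t
    gcongr
  · exact (integrableOn_mul_arctanWeight hl x).const_mul _

/-- The Neumann series terms for `m₊(·, k)`. -/
noncomputable def jostIter (V : ℝ → ℝ) (k : ℂ) : ℕ → ℝ → ℂ
  | 0 => fun _ => 1
  | n + 1 => fun x => -∫ s in Set.Ioi x, jostSlope V k (jostIter V k n) s

/-- With `l = 4M + 1` each step costs the factor `2M / l ≤ 1/2`, uniformly in the strip. The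
constant `e^{2l}` starts the induction, since `1 ≤ e^{2l} arctanWeight l t`. Passing through the
slope avoids the kernel `(e^{2ik(t-x)} - 1) / (2ik)`, so `k = 0` needs no special treatment. -/
theorem jostIter_spec (hV : DecayBound V η M) {k : ℂ} (hk : k ∈ upperStrip η) (n : ℕ) :
    Continuous (jostIter V k n) ∧
      JostBound (4 * M + 1) k (Real.exp (2 * (4 * M + 1)) * (1 / 2) ^ n) (jostIter V k n) := by
  have hM := hV.nonneg
  have hl : 0 < 4 * M + 1 := by linarith
  induction n with
  | zero =>
    refine ⟨continuous_const, fun t => ?_⟩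
    have h1 := le_arctanWeight hl.le t
    have h2 : 1 ≤ lossWeight k t := Real.one_le_exp (by positivity)
    have h3 := growthWeight_pos t
    simp only [jostIter, norm_one, pow_zero, mul_one]
    have h4 : 1 ≤ (1 + growthWeight t) * lossWeight k t := one_le_mul_of_one_le_of_one_le (by linarith) h2
    calc (1 : ℝ) ≤ ((1 + growthWeight t) * lossWeight k t) *
          (Real.exp (2 * (4 * M + 1)) * arctanWeight (4 * M + 1) t) :=
          one_le_mul_of_one_le_of_one_le h4 h1
      _ = _ := by ring
  | succ n ih =>
    obtain ⟨hc, hb⟩ := ih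
    have ha : 0 ≤ Real.exp (2 * (4 * M + 1)) * (1 / 2) ^ n := by positivity
    have hs := norm_jostSlope_le hV hk hl ha hb
    have hsc : Continuous (jostSlope V k (jostIter V k n)) :=
      continuous_iff_continuousAt.2 fun x => (hasDerivAt_jostSlope hV hk hl ha hc hb x).continuousAt
    have hb0 : 0 ≤ Real.exp (2 * (4 * M + 1)) * (1 / 2) ^ n * (2 * M / (4 * M + 1)) := by positivity
    refine ⟨(continuous_integral_Ioi (integrableOn_slope hl.le hb0 hsc hs)).neg, fun x => ?_⟩
    simp only [jostIter, norm_neg]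
    refine (norm_integral_slope_le hl.le hb0 hs x).trans ?_
    have h1 : 2 * M / (4 * M + 1) ≤ 1 / 2 := by rw [div_le_div_iff₀ hl two_pos]; linarith
    have h2 := growthWeight_pos x
    have h3 := lossWeight_pos k x
    have h4 := arctanWeight_pos (4 * M + 1) x
    calc _ ≤ Real.exp (2 * (4 * M + 1)) * (1 / 2) ^ n * (1 / 2) *
          ((1 + growthWeight x) * lossWeight k x * arctanWeight (4 * M + 1) x) := by
          gcongr
          linarith
      _ = _ := by rw [pow_succ]; ring

theorem differentiableOn_jostIter (hV : DecayBound V η M) (n : ℕ) (x : ℝ) :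
    DifferentiableOn ℂ (fun k => jostIter V k n x) (upperStrip η) := by
  have hM := hV.nonneg
  have hl : 0 < 4 * M + 1 := by linarith
  induction n generalizing x with
  | zero => exact differentiableOn_const _
  | succ n ih =>
    have ha : 0 ≤ Real.exp (2 * (4 * M + 1)) * (1 / 2) ^ n := by positivity
    have hb0 : 0 ≤ Real.exp (2 * (4 * M + 1)) * (1 / 2) ^ n * (2 * M / (4 * M + 1)) := by positivity
    have hd := differentiableOn_jostSlope hV hl ha (m := fun k => jostIter V k n)
      (fun k hk => (jostIter_spec hV hk n).1) (fun k hk => (jostIter_spec hV hk n).2) ih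
    simp only [jostIter]
    refine DifferentiableOn.neg ?_
    refine differentiableOn_integral_of_bounded (isOpen_upperStrip η)
      (bound := fun s => Real.exp (2 * (4 * M + 1)) * (1 / 2) ^ n * (2 * M / (4 * M + 1)) *
        (Real.exp (2 * η * |x|) * Real.exp (2 * (4 * M + 1))) * tailWeight s) ?_ ?_ ?_ ?_
    · intro k hk
      exact (continuous_iff_continuousAt.2 fun x => (hasDerivAt_jostSlope hV hk hl ha
        (jostIter_spec hV hk n).1 (jostIter_spec hV hk n).2 x).continuousAt).aestronglyMeasurable
    · exact Eventually.of_forall hd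
    · filter_upwards [ae_restrict_mem measurableSet_Ioi] with s hs k hk
      refine (norm_jostSlope_le hV hk hl ha (jostIter_spec hV hk n).2 s).trans ?_
      have h1 := (lossWeight_antitone k (le_of_lt hs : x ≤ s)).trans (lossWeight_le hV.eta_pos hk x)
      have h2 := arctanWeight_le hl.le s
      have h3 := tailWeight_pos s
      have h4 := arctanWeight_pos (4 * M + 1) s
      rw [mul_assoc _ (Real.exp _ * Real.exp _)]
      refine mul_le_mul_of_nonneg_left ?_ hb0
      calc tailWeight s * lossWeight k s * arctanWeight (4 * M + 1) s
          ≤ tailWeight s * Real.exp (2 * η * |x|) * Real.exp (2 * (4 * M + 1)) := by gcongr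
        _ = _ := by ring
    · exact (integrableOn_tailWeight x).const_mul _

/-- `m₊(x, k) = e^{-ikx} ψ₊(x, k)`. -/
noncomputable def jostM (V : ℝ → ℝ) (k : ℂ) (x : ℝ) : ℂ := ∑' n, jostIter V k n x

/-- `∂ₓ m₊(x, k)`. -/
noncomputable def jostP (V : ℝ → ℝ) (k : ℂ) : ℝ → ℂ := jostSlope V k (jostM V k)

/-! ### Convergence of the Neumann series and the equation for `m₊` -/

theorem summable_jost_bound (c d : ℝ) : Summable fun n : ℕ => c * (1 / 2 : ℝ) ^ n * d :=
  (summable_geometric_two.mul_left c).mul_right d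

theorem summable_jostIter (hV : DecayBound V η M) {k : ℂ} (hk : k ∈ upperStrip η) (x : ℝ) :
    Summable fun n => jostIter V k n x :=
  Summable.of_norm_bounded (summable_jost_bound _ _) fun n => (jostIter_spec hV hk n).2 x

theorem jostBound_jostM (hV : DecayBound V η M) {k : ℂ} (hk : k ∈ upperStrip η) :
    JostBound (4 * M + 1) k (2 * Real.exp (2 * (4 * M + 1))) (jostM V k) := fun x => by
  refine tsum_of_norm_bounded ?_ fun n => (jostIter_spec hV hk n).2 x
  have := (hasSum_geometric_two.mul_left (Real.exp (2 * (4 * M + 1)))).mul_right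
    ((1 + growthWeight x) * lossWeight k x * arctanWeight (4 * M + 1) x)
  rw [mul_comm 2 (Real.exp _)]
  exact this

theorem continuous_jostM (hV : DecayBound V η M) {k : ℂ} (hk : k ∈ upperStrip η) :
    Continuous (jostM V k) := by
  have hM := hV.nonneg
  have hl : 0 < 4 * M + 1 := by linarith
  refine continuous_iff_continuousAt.2 fun x => ?_
  -- The bounds on the terms grow towards `-∞`, so the M-test is applied on a half-line around `x`.
  have : ContinuousOn (jostM V k) (Set.Ioi (x - 1)) := by
    refine continuousOn_tsum (fun n => (jostIter_spec hV hk n).1.continuousOn)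
      (summable_jost_bound (Real.exp (2 * (4 * M + 1))) ((1 + (1 + 2 * max 0 (-(x - 1)))) *
        lossWeight k (x - 1) * arctanWeight (4 * M + 1) (x - 1))) fun n t ht => ?_
    refine ((jostIter_spec hV hk n).2 t).trans (mul_le_mul_of_nonneg_left ?_ (by positivity))
    have ht' : x - 1 ≤ t := le_of_lt ht
    have h1 := lossWeight_antitone k ht'
    have h2 := arctanWeight_antitone hl.le ht'
    have h3 := growthWeight_le t
    have h4 : max 0 (-t) ≤ max 0 (-(x - 1)) := max_le_max le_rfl (by linarith)
    have h5 := growthWeight_pos t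
    have h6 := lossWeight_pos k t
    have h7 := arctanWeight_pos (4 * M + 1) t
    have h8 := lossWeight_pos k (x - 1)
    gcongr
    linarith
  exact this.continuousAt (Ioi_mem_nhds (by linarith))

theorem differentiableOn_jostM (hV : DecayBound V η M) (x : ℝ) :
    DifferentiableOn ℂ (fun k => jostM V k x) (upperStrip η) := by
  have hM := hV.nonneg
  have hl : 0 < 4 * M + 1 := by linarith
  refine Complex.differentiableOn_tsum_of_summable_norm (u := fun n => Real.exp (2 * (4 * M + 1)) *
      (1 / 2) ^ n * ((1 + growthWeight x) * Real.exp (2 * η * |x|) * arctanWeight (4 * M + 1) x))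
    (summable_jost_bound _ _) (fun n => differentiableOn_jostIter hV n x) (isOpen_upperStrip η)
    fun n k hk => ?_
  refine ((jostIter_spec hV hk n).2 x).trans ?_
  have h1 := lossWeight_le hV.eta_pos hk x
  have h5 := growthWeight_pos x
  have h7 := arctanWeight_pos (4 * M + 1) x
  gcongr

theorem differentiableOn_jostP (hV : DecayBound V η M) (x : ℝ) :
    DifferentiableOn ℂ (fun k => jostP V k x) (upperStrip η) :=
  differentiableOn_jostSlope hV (by linarith [hV.nonneg] : 0 < 4 * M + 1) (by positivity)
    (fun _ hk => continuous_jostM hV hk) (fun _ hk => jostBound_jostM hV hk)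
    (differentiableOn_jostM hV) x

theorem hasDerivAt_jostP (hV : DecayBound V η M) {k : ℂ} (hk : k ∈ upperStrip η) (x : ℝ) :
    HasDerivAt (jostP V k) ((V x : ℂ) * jostM V k x - 2 * Complex.I * k * jostP V k x) x :=
  hasDerivAt_jostSlope hV hk (by linarith [hV.nonneg] : 0 < 4 * M + 1) (by positivity)
    (continuous_jostM hV hk) (jostBound_jostM hV hk) x

theorem continuous_jostP (hV : DecayBound V η M) {k : ℂ} (hk : k ∈ upperStrip η) :
    Continuous (jostP V k) :=
  continuous_iff_continuousAt.2 fun x => (hasDerivAt_jostP hV hk x).continuousAt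

theorem norm_jostP_le' (hV : DecayBound V η M) {k : ℂ} (hk : k ∈ upperStrip η) (x : ℝ) :
    ‖jostP V k x‖ ≤ 2 * Real.exp (2 * (4 * M + 1)) * (2 * M / (4 * M + 1)) *
      (tailWeight x * lossWeight k x * arctanWeight (4 * M + 1) x) :=
  norm_jostSlope_le hV hk (by linarith [hV.nonneg] : 0 < 4 * M + 1) (by positivity)
    (jostBound_jostM hV hk) x

theorem integrableOn_jostP (hV : DecayBound V η M) {k : ℂ} (hk : k ∈ upperStrip η) (x : ℝ) :
    IntegrableOn (jostP V k) (Set.Ioi x) := by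
  have := hV.nonneg
  exact integrableOn_slope (by linarith : 0 ≤ 4 * M + 1) (by positivity) (continuous_jostP hV hk)
    (norm_jostP_le' hV hk) x

theorem hasSum_jostSlope_jostIter (hV : DecayBound V η M) {k : ℂ} (hk : k ∈ upperStrip η)
    (x : ℝ) : HasSum (fun n => jostSlope V k (jostIter V k n) x) (jostP V k x) := by
  have hM := hV.nonneg
  have hl : 0 < 4 * M + 1 := by linarith
  unfold jostP jostSlope
  refine HasSum.neg ?_
  have hint := fun n => integrableOn_jost_integrand hV hk hl (by positivity)
    (jostIter_spec hV hk n).1 (jostIter_spec hV hk n).2 x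
  have h := hasSum_integral_of_summable_integral_norm hint ?_
  · convert h using 1
    refine integral_congr_ae (Eventually.of_forall fun t => ?_)
    simp only [jostM]
    rw [tsum_mul_left, tsum_mul_left]
  · refine Summable.of_nonneg_of_le (fun n => integral_nonneg fun _ => norm_nonneg _)
      (fun n => ?_) (summable_jost_bound (Real.exp (2 * (4 * M + 1))) (M * lossWeight k x *
        (2 * tailWeight x) * ∫ t in Set.Ioi x, (1 + t ^ 2)⁻¹ * arctanWeight (4 * M + 1) t))
    rw [← mul_assoc, ← integral_const_mul]
    refine integral_mono_ae (hint n).norm ((integrableOn_mul_arctanWeight hl x).const_mul _) ?_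
    filter_upwards [ae_restrict_mem measurableSet_Ioi] with t ht
    refine (norm_jost_integrand_le hV hk (by positivity) (jostIter_spec hV hk n).2
      (le_of_lt ht)).trans (le_of_eq ?_)
    ring

/-- Term-by-term integration of the Neumann series. This integral equation makes `jostP` the
derivative of `jostM` and fixes the limit `1` at `+∞`. -/
theorem jostM_eq (hV : DecayBound V η M) {k : ℂ} (hk : k ∈ upperStrip η) (x : ℝ) :
    jostM V k x = 1 - ∫ s in Set.Ioi x, jostP V k s := by
  have hM := hV.nonneg
  have hl : 0 < 4 * M + 1 := by linarith
  have hb0 : ∀ n : ℕ, 0 ≤ Real.exp (2 * (4 * M + 1)) * (1 / 2) ^ n * (2 * M / (4 * M + 1)) := fun n => by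
    positivity
  have hs := fun n => norm_jostSlope_le hV hk hl (by positivity) (jostIter_spec hV hk n).2
  have hsc : ∀ n, Continuous (jostSlope V k (jostIter V k n)) := fun n =>
    continuous_iff_continuousAt.2 fun x => (hasDerivAt_jostSlope hV hk hl (by positivity)
      (jostIter_spec hV hk n).1 (jostIter_spec hV hk n).2 x).continuousAt
  have hint := fun n => integrableOn_slope hl.le (hb0 n) (hsc n) (hs n) x
  have h := hasSum_integral_of_summable_integral_norm hint ?_
  · have h2 : HasSum (fun n => jostIter V k (n + 1) x) (-∫ s in Set.Ioi x, jostP V k s) := by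
      have e : ∫ s in Set.Ioi x, jostP V k s =
          ∫ s in Set.Ioi x, ∑' n, jostSlope V k (jostIter V k n) s :=
        integral_congr_ae (Eventually.of_forall fun s =>
          (hasSum_jostSlope_jostIter hV hk s).tsum_eq.symm)
      rw [e]
      exact h.neg
    unfold jostM
    rw [(summable_jostIter hV hk x).tsum_eq_zero_add, h2.tsum_eq, sub_eq_add_neg]
    rfl
  · refine Summable.of_nonneg_of_le (fun n => integral_nonneg fun _ => norm_nonneg _)
      (fun n => ?_) (summable_jost_bound (Real.exp (2 * (4 * M + 1))) ((2 * M / (4 * M + 1)) *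
        lossWeight k x * arctanWeight (4 * M + 1) x * ∫ t in Set.Ioi x, tailWeight t))
    rw [← mul_assoc, ← integral_const_mul]
    refine integral_mono_ae (hint n).norm ((integrableOn_tailWeight x).const_mul _) ?_
    filter_upwards [ae_restrict_mem measurableSet_Ioi] with s hxs
    have h1 := lossWeight_antitone k (le_of_lt hxs : x ≤ s)
    have h2 := arctanWeight_antitone hl.le (le_of_lt hxs : x ≤ s)
    have h3 := tailWeight_pos s
    have h4 := lossWeight_pos k s
    have h5 := arctanWeight_pos (4 * M + 1) s
    have h6 := lossWeight_pos k x
    refine (hs n s).trans ?_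
    calc _ ≤ Real.exp (2 * (4 * M + 1)) * (1 / 2) ^ n * (2 * M / (4 * M + 1)) *
          (tailWeight s * lossWeight k x * arctanWeight (4 * M + 1) x) := by
          refine mul_le_mul_of_nonneg_left ?_ (hb0 n)
          gcongr
      _ = _ := by ring

theorem hasDerivAt_jostM (hV : DecayBound V η M) {k : ℂ} (hk : k ∈ upperStrip η) (x : ℝ) :
    HasDerivAt (jostM V k) (jostP V k x) x := by
  have h := (hasDerivAt_integral_Ioi (continuous_jostP hV hk)
    (integrableOn_jostP hV hk) x).const_sub (1 : ℂ)
  rw [neg_neg] at h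
  rw [funext (jostM_eq hV hk)]
  exact h

end

end Schrodinger

/-! ### Jost solutions, their Wronskian, and absence of zeros in the closed upper half-plane -/

namespace Schrodinger

section

variable {V : ℝ → ℝ} {η M : ℝ}

/-! ### Bounds on the Jost functions -/

/-- A constant bounding the Jost functions of all potentials obeying `DecayBound V η M`. -/
noncomputable def jostConst (M : ℝ) : ℝ := 4 * (4 * M + 1) * Real.exp (4 * (4 * M + 1))

theorem jostConst_pos (hM : 0 ≤ M) : 0 < jostConst M := by unfold jostConst; positivity

theorem norm_jostM_le (hV : DecayBound V η M) {k : ℂ} (hk : k ∈ upperStrip η) (x : ℝ) :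
    ‖jostM V k x‖ ≤ jostConst M * ((1 + max 0 (-x)) * lossWeight k x) := by
  have hM := hV.nonneg
  have hl : 0 ≤ 4 * M + 1 := by linarith
  have h1 := growthWeight_le x
  have h2 := arctanWeight_le hl x
  have h3 := lossWeight_pos k x
  have h4 := growthWeight_pos x
  have h5 := arctanWeight_pos (4 * M + 1) x
  calc _ ≤ 2 * Real.exp (2 * (4 * M + 1)) *
        ((1 + growthWeight x) * lossWeight k x * arctanWeight (4 * M + 1) x) :=
        jostBound_jostM hV hk x
    _ ≤ 2 * Real.exp (2 * (4 * M + 1)) *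
        ((1 + (1 + 2 * max 0 (-x))) * lossWeight k x * Real.exp (2 * (4 * M + 1))) := by gcongr
    _ = 4 * Real.exp (4 * (4 * M + 1)) * ((1 + max 0 (-x)) * lossWeight k x) := by
        rw [show 4 * (4 * M + 1) = 2 * (4 * M + 1) + 2 * (4 * M + 1) by ring, Real.exp_add]; ring
    _ ≤ _ := by
        have : (1 : ℝ) ≤ 4 * M + 1 := by linarith
        have h0 : 0 ≤ max 0 (-x) := le_max_left _ _
        refine mul_le_mul_of_nonneg_right ?_ (by positivity)
        unfold jostConst
        refine mul_le_mul_of_nonneg_right ?_ (by positivity)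
        linarith

theorem slope_const_le (hM : 0 ≤ M) :
    2 * Real.exp (2 * (4 * M + 1)) * (2 * M / (4 * M + 1)) * Real.exp (2 * (4 * M + 1))
      ≤ jostConst M := by
  have h1 : 2 * M / (4 * M + 1) ≤ 4 * M + 1 := by
    rw [div_le_iff₀ (by linarith)]; nlinarith
  calc _ = 2 * (2 * M / (4 * M + 1)) * Real.exp (4 * (4 * M + 1)) := by
        rw [show 4 * (4 * M + 1) = 2 * (4 * M + 1) + 2 * (4 * M + 1) by ring, Real.exp_add]; ring
    _ ≤ _ := by
        unfold jostConst
        refine mul_le_mul_of_nonneg_right ?_ (by positivity)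
        linarith

theorem norm_jostP_le (hV : DecayBound V η M) {k : ℂ} (hk : k ∈ upperStrip η) (x : ℝ) :
    ‖jostP V k x‖ ≤ jostConst M * (tailWeight x * lossWeight k x) := by
  have hM := hV.nonneg
  have hl : 0 ≤ 4 * M + 1 := by linarith
  have h2 := arctanWeight_le hl x
  have h3 := lossWeight_pos k x
  have h4 := tailWeight_pos x
  have h5 := arctanWeight_pos (4 * M + 1) x
  calc _ ≤ 2 * Real.exp (2 * (4 * M + 1)) * (2 * M / (4 * M + 1)) *
        (tailWeight x * lossWeight k x * Real.exp (2 * (4 * M + 1))) :=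
        (norm_jostP_le' hV hk x).trans (by gcongr)
    _ = 2 * Real.exp (2 * (4 * M + 1)) * (2 * M / (4 * M + 1)) * Real.exp (2 * (4 * M + 1)) *
        (tailWeight x * lossWeight k x) := by ring
    _ ≤ _ := mul_le_mul_of_nonneg_right (slope_const_le hM) (by positivity)

theorem norm_jostM_sub_one_le (hV : DecayBound V η M) {k : ℂ} (hk : k ∈ upperStrip η) (x : ℝ) :
    ‖jostM V k x - 1‖ ≤ jostConst M * (growthWeight x * lossWeight k x) := by
  have hM := hV.nonneg
  have hl : 0 ≤ 4 * M + 1 := by linarith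
  have h2 := arctanWeight_le hl x
  have h3 := lossWeight_pos k x
  have h4 := growthWeight_pos x
  have h5 := arctanWeight_pos (4 * M + 1) x
  have e : jostM V k x - 1 = -∫ s in Set.Ioi x, jostP V k s := by rw [jostM_eq hV hk x]; ring
  rw [e, norm_neg]
  calc _ ≤ 2 * Real.exp (2 * (4 * M + 1)) * (2 * M / (4 * M + 1)) *
        (growthWeight x * lossWeight k x * arctanWeight (4 * M + 1) x) :=
        norm_integral_slope_le hl (by positivity) (norm_jostP_le' hV hk) x
    _ ≤ 2 * Real.exp (2 * (4 * M + 1)) * (2 * M / (4 * M + 1)) *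
        (growthWeight x * lossWeight k x * Real.exp (2 * (4 * M + 1))) := by gcongr
    _ = 2 * Real.exp (2 * (4 * M + 1)) * (2 * M / (4 * M + 1)) * Real.exp (2 * (4 * M + 1)) *
        (growthWeight x * lossWeight k x) := by ring
    _ ≤ _ := mul_le_mul_of_nonneg_right (slope_const_le hM) (by positivity)

theorem tailWeight_le_growthWeight (x : ℝ) : tailWeight x ≤ growthWeight x := by
  have h1 := sqrt_one_add_sq_pos x
  have h2 : 1 ≤ Real.sqrt (1 + x ^ 2) := Real.one_le_sqrt.2 (by nlinarith)
  have e : tailWeight x = growthWeight x / Real.sqrt (1 + x ^ 2) := by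
    unfold tailWeight growthWeight; field_simp
  rw [e]
  exact div_le_self (growthWeight_pos x).le h2

theorem lossWeight_of_nonneg (k : ℂ) {x : ℝ} (hx : 0 ≤ x) : lossWeight k x = 1 := by
  unfold lossWeight; rw [max_eq_left (by linarith : -x ≤ 0)]; simp

theorem tendsto_jostM (hV : DecayBound V η M) {k : ℂ} (hk : k ∈ upperStrip η) :
    Tendsto (jostM V k) atTop (𝓝 1) := by
  rw [tendsto_iff_norm_sub_tendsto_zero]
  refine squeeze_zero' (Eventually.of_forall fun _ => norm_nonneg _)
    (g := fun x => jostConst M * growthWeight x) ?_ (by simpa using tendsto_growthWeight.const_mul (jostConst M))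
  filter_upwards [eventually_ge_atTop 0] with x hx
  simpa [lossWeight_of_nonneg k hx] using norm_jostM_sub_one_le hV hk x

theorem tendsto_jostP (hV : DecayBound V η M) {k : ℂ} (hk : k ∈ upperStrip η) :
    Tendsto (jostP V k) atTop (𝓝 0) := by
  rw [tendsto_zero_iff_norm_tendsto_zero]
  refine squeeze_zero' (Eventually.of_forall fun _ => norm_nonneg _)
    (g := fun x => jostConst M * growthWeight x) ?_ (by simpa using tendsto_growthWeight.const_mul (jostConst M))
  filter_upwards [eventually_ge_atTop 0] with x hx
  have h := norm_jostP_le hV hk x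
  rw [lossWeight_of_nonneg k hx, mul_one] at h
  exact h.trans (mul_le_mul_of_nonneg_left (tailWeight_le_growthWeight x) (jostConst_pos hV.nonneg).le)

theorem norm_mul_jostM_le (hV : DecayBound V η M) {k : ℂ} (hk : k ∈ upperStrip η) (t : ℝ) :
    ‖(V t : ℂ) * jostM V k t‖ ≤ jostConst M * M * (1 + t ^ 2)⁻¹ := by
  have hM := hV.nonneg
  have hl : 0 ≤ 4 * M + 1 := by linarith
  have h1 := growthWeight_pos t
  have h2 := arctanWeight_le hl t
  have h3 := lossWeight_le hV.eta_pos hk t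
  have h5 := arctanWeight_pos (4 * M + 1) t
  have h6 := lossWeight_pos k t
  have h7 : (1 + t ^ 2)⁻¹ ≤ 1 := inv_le_one_of_one_le₀ (by nlinarith)
  have h8 : 0 < (1 + t ^ 2)⁻¹ := by positivity
  have h9 : Real.exp (2 * η * |t|) ≤ Real.exp (4 * η * |t|) := by
    have := hV.eta_pos
    exact Real.exp_le_exp.2 (mul_le_mul_of_nonneg_right (by linarith) (abs_nonneg t))
  rw [norm_mul, Complex.norm_real, Real.norm_eq_abs]
  calc _ ≤ |V t| * (2 * Real.exp (2 * (4 * M + 1)) *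
        ((1 + growthWeight t) * Real.exp (4 * η * |t|) * Real.exp (2 * (4 * M + 1)))) := by
        refine mul_le_mul_of_nonneg_left ((jostBound_jostM hV hk t).trans ?_) (abs_nonneg _)
        gcongr
        exact h3.trans h9
    _ = 2 * Real.exp (4 * (4 * M + 1)) * (|V t| * ((1 + growthWeight t) * Real.exp (4 * η * |t|))) := by
        rw [show 4 * (4 * M + 1) = 2 * (4 * M + 1) + 2 * (4 * M + 1) by ring, Real.exp_add]; ring
    _ ≤ 2 * Real.exp (4 * (4 * M + 1)) * (M * ((1 + t ^ 2)⁻¹ ^ 2)) :=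
        mul_le_mul_of_nonneg_left (hV.bound t) (by positivity)
    _ ≤ jostConst M * (M * (1 + t ^ 2)⁻¹) := by
        have : (1 + t ^ 2)⁻¹ ^ 2 ≤ (1 + t ^ 2)⁻¹ := by nlinarith
        unfold jostConst
        gcongr
        linarith
    _ = _ := by ring

theorem integrable_mul_jostM (hV : DecayBound V η M) {k : ℂ} (hk : k ∈ upperStrip η) :
    Integrable fun t => (V t : ℂ) * jostM V k t := by
  refine Integrable.mono' (integrable_inv_one_add_sq.const_mul (jostConst M * M)) ?_
    (Eventually.of_forall (norm_mul_jostM_le hV hk))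
  have := hV.cont
  have := continuous_jostM hV hk
  exact (by fun_prop : Continuous _).aestronglyMeasurable

/-- Integration of `P' = V m - 2ik P` over `(x, ∞)`. Since the right side is bounded, this yields `m
= 1 + O(1/|k|)`, the source of all high-energy estimates. -/
theorem two_I_mul_one_sub_jostM (hV : DecayBound V η M) {k : ℂ} (hk : k ∈ upperStrip η) (x : ℝ) :
    2 * Complex.I * k * (1 - jostM V k x) =
      jostP V k x + ∫ t in Set.Ioi x, (V t : ℂ) * jostM V k t := by
  have hi1 := (integrable_mul_jostM hV hk).integrableOn (s := Set.Ioi x)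
  have hi2 := (integrableOn_jostP hV hk x).const_mul (2 * Complex.I * k)
  have h := integral_Ioi_of_hasDerivAt_of_tendsto' (fun y _ => hasDerivAt_jostP hV hk y)
    (hi1.sub hi2) (tendsto_jostP hV hk)
  rw [integral_sub hi1 hi2, integral_const_mul] at h
  rw [jostM_eq hV hk x]
  linear_combination -h

theorem norm_mul_jostM_sub_one_le (hV : DecayBound V η M) {k : ℂ} (hk : k ∈ upperStrip η) (x : ℝ) :
    ‖k‖ * ‖jostM V k x - 1‖ ≤ jostConst M * (1 + 2 * M) * lossWeight k x := by
  have hM := hV.nonneg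
  have hC := jostConst_pos hM
  have h1 : ‖∫ t in Set.Ioi x, (V t : ℂ) * jostM V k t‖ ≤ jostConst M * M * 4 := by
    calc _ ≤ ∫ t in Set.Ioi x, jostConst M * M * (1 + t ^ 2)⁻¹ :=
          norm_integral_le_of_norm_le ((integrable_inv_one_add_sq.const_mul _).integrableOn)
            (Eventually.of_forall (norm_mul_jostM_le hV hk))
      _ ≤ ∫ t : ℝ, jostConst M * M * (1 + t ^ 2)⁻¹ :=
          setIntegral_le_integral (integrable_inv_one_add_sq.const_mul _)
            (Eventually.of_forall fun t => by positivity)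
      _ = jostConst M * M * Real.pi := by rw [integral_const_mul, integral_univ_inv_one_add_sq]
      _ ≤ _ := by gcongr; exact Real.pi_le_four
  have h2 := norm_jostP_le hV hk x
  have h3 : 1 ≤ lossWeight k x := Real.one_le_exp (by positivity)
  have h4 := tailWeight_le_two x
  have e : ‖2 * Complex.I * k * (1 - jostM V k x)‖ = 2 * (‖k‖ * ‖jostM V k x - 1‖) := by
    rw [norm_mul, norm_mul, norm_mul, norm_sub_rev]
    simp; ring
  rw [two_I_mul_one_sub_jostM hV hk x] at e
  have h5 : 2 * (‖k‖ * ‖jostM V k x - 1‖) ≤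
      jostConst M * (2 * lossWeight k x) + jostConst M * M * 4 * lossWeight k x := by
    rw [← e]
    refine (norm_add_le _ _).trans (add_le_add (h2.trans ?_) (h1.trans ?_))
    · have := lossWeight_pos k x
      gcongr
    · exact le_mul_of_one_le_right (by positivity) h3
  linarith

/-! ### Jost solutions -/

/-- The Jost solution `ψ₊(x, k) = e^{ikx} m₊(x, k)`. -/
noncomputable def psiPlus (V : ℝ → ℝ) (k : ℂ) (x : ℝ) : ℂ :=
  Complex.exp (Complex.I * k * x) * jostM V k x

/-- The derivative of `psiPlus`. -/
noncomputable def psiPlus' (V : ℝ → ℝ) (k : ℂ) (x : ℝ) : ℂ :=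
  Complex.exp (Complex.I * k * x) * (Complex.I * k * jostM V k x + jostP V k x)

/-- The Jost solution `ψ₋(x, k)`, obtained from `ψ₊` for the reflected potential. -/
noncomputable def psiMinus (V : ℝ → ℝ) (k : ℂ) (x : ℝ) : ℂ := psiPlus (fun x => V (-x)) k (-x)

/-- The derivative of `psiMinus`. -/
noncomputable def psiMinus' (V : ℝ → ℝ) (k : ℂ) (x : ℝ) : ℂ := -psiPlus' (fun x => V (-x)) k (-x)

theorem hasDerivAt_exp_I_mul (k : ℂ) (x : ℝ) :
    HasDerivAt (fun x : ℝ => Complex.exp (Complex.I * k * x))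
      (Complex.exp (Complex.I * k * x) * (Complex.I * k)) x := by
  have := ((Complex.ofRealCLM.hasDerivAt (x := x)).const_mul (Complex.I * k)).cexp
  simpa using this

theorem hasDerivAt_psiPlus (hV : DecayBound V η M) {k : ℂ} (hk : k ∈ upperStrip η) (x : ℝ) :
    HasDerivAt (psiPlus V k) (psiPlus' V k x) x := by
  refine ((hasDerivAt_exp_I_mul k x).mul (hasDerivAt_jostM hV hk x)).congr_deriv ?_
  unfold psiPlus'; ring

theorem hasDerivAt_psiPlus' (hV : DecayBound V η M) {k : ℂ} (hk : k ∈ upperStrip η) (x : ℝ) :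
    HasDerivAt (psiPlus' V k) (((V x : ℂ) - k ^ 2) * psiPlus V k x) x := by
  refine ((hasDerivAt_exp_I_mul k x).mul (((hasDerivAt_jostM hV hk x).const_mul
    (Complex.I * k)).add (hasDerivAt_jostP hV hk x))).congr_deriv ?_
  unfold psiPlus
  simp only [Pi.add_apply]
  linear_combination (Complex.exp (Complex.I * k * x) * k ^ 2 * jostM V k x) * Complex.I_sq

theorem hasDerivAt_psiMinus (hV : DecayBound (fun x => V (-x)) η M) {k : ℂ}
    (hk : k ∈ upperStrip η) (x : ℝ) : HasDerivAt (psiMinus V k) (psiMinus' V k x) x := by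
  have := (hasDerivAt_psiPlus hV hk (-x)).scomp x (hasDerivAt_neg x)
  simpa [psiMinus', psiMinus, Function.comp_def] using! this

theorem hasDerivAt_psiMinus' (hV : DecayBound (fun x => V (-x)) η M) {k : ℂ}
    (hk : k ∈ upperStrip η) (x : ℝ) :
    HasDerivAt (psiMinus' V k) (((V x : ℂ) - k ^ 2) * psiMinus V k x) x := by
  have := ((hasDerivAt_psiPlus' hV hk (-x)).scomp x (hasDerivAt_neg x)).neg
  simp only [neg_neg, neg_smul, one_smul] at this
  exact this

theorem abs_potential_le (hV : DecayBound V η M) (t : ℝ) : |V t| ≤ M := by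
  have h1 := hV.bound t
  have hη := hV.eta_pos
  have h2 : 1 ≤ (1 + growthWeight t) * Real.exp (4 * η * |t|) :=
    one_le_mul_of_one_le_of_one_le (by linarith [growthWeight_pos t]) (Real.one_le_exp (by positivity))
  have h7 : (1 + t ^ 2)⁻¹ ^ 2 ≤ 1 :=
    pow_le_one₀ (by positivity) (inv_le_one_of_one_le₀ (by nlinarith))
  calc |V t| ≤ |V t| * ((1 + growthWeight t) * Real.exp (4 * η * |t|)) :=
        le_mul_of_one_le_right (abs_nonneg _) h2
    _ ≤ M * ((1 + t ^ 2)⁻¹ ^ 2) := h1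
    _ ≤ M := mul_le_of_le_one_right hV.nonneg h7

/-- Solutions of `y'' = (V - z) y` with bounded `V` are determined by their Cauchy data. -/
theorem eq_zero_of_solves (hb : ∃ M, ∀ t, |V t| ≤ M) (z : ℂ) {y y' : ℝ → ℂ}
    (h1 : ∀ x, HasDerivAt y (y' x) x) (h2 : ∀ x, HasDerivAt y' (((V x : ℂ) - z) * y x) x)
    {x₀ : ℝ} (hy : y x₀ = 0) (hy' : y' x₀ = 0) : y = 0 := by
  obtain ⟨M, hM⟩ := hb
  have hM0 : 0 ≤ M := (abs_nonneg _).trans (hM 0)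
  have key : (fun x => (y x, y' x)) = fun _ => ((0, 0) : ℂ × ℂ) := by
    -- For the first-order system in the maximum norm, the two components have Lipschitz constants
    -- `1` and `M + ‖z‖`; their sum bounds both.
    refine ODE_solution_unique_univ (K := Real.toNNReal (M + ‖z‖ + 1))
      (v := fun t w => (w.2, ((V t : ℂ) - z) * w.1)) (s := fun _ => Set.univ) (t₀ := x₀)
      (fun t => ?_) (fun t => ⟨(h1 t).prodMk (h2 t), trivial⟩) (fun t => ⟨?_, trivial⟩) ?_
    · refine LipschitzOnWith.of_dist_le_mul fun a _ b _ => ?_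
      have hV : ‖(V t : ℂ) - z‖ ≤ M + ‖z‖ := by
        refine (norm_sub_le _ _).trans (add_le_add ?_ le_rfl)
        rw [Complex.norm_real]; exact hM t
      rw [Real.coe_toNNReal _ (by positivity), dist_eq_norm, dist_eq_norm, Prod.norm_def]
      have ha : ‖a.1 - b.1‖ ≤ ‖a - b‖ := norm_fst_le (a - b)
      have hb : ‖a.2 - b.2‖ ≤ ‖a - b‖ := norm_snd_le (a - b)
      refine max_le ?_ ?_
      · refine hb.trans (le_mul_of_one_le_left (norm_nonneg _) ?_)
        linarith [norm_nonneg z]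
      · change ‖((V t : ℂ) - z) * a.1 - ((V t : ℂ) - z) * b.1‖ ≤ _
        rw [← mul_sub, norm_mul]
        exact mul_le_mul (by linarith) ha (norm_nonneg _) (by positivity)
    · exact (hasDerivAt_const t ((0, 0) : ℂ × ℂ)).congr_deriv (Prod.ext (by simp) (by simp))
    · simp [hy, hy']
  funext x
  exact congrArg Prod.fst (congrFun key x)

theorem psiPlus_ne_zero (hV : DecayBound V η M) {k : ℂ} (hk : k ∈ upperStrip η) :
    psiPlus V k ≠ 0 := fun h => by
  have h1 : jostM V k = 0 := by
    funext x
    have := congrFun h x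
    simpa [psiPlus, Complex.exp_ne_zero] using this
  have h2 := tendsto_jostM hV hk
  rw [h1] at h2
  exact zero_ne_one (tendsto_nhds_unique tendsto_const_nhds h2)

theorem psiMinus_ne_zero (hV : DecayBound (fun x => V (-x)) η M) {k : ℂ} (hk : k ∈ upperStrip η) :
    psiMinus V k ≠ 0 := fun h => psiPlus_ne_zero hV hk (by
  funext x
  have := congrFun h (-x)
  simpa [psiMinus] using this)

/-- The Wronskian of the two Jost solutions. -/
noncomputable def wronskian (V : ℝ → ℝ) (k : ℂ) : ℂ :=
  psiPlus' V k 0 * psiMinus V k 0 - psiPlus V k 0 * psiMinus' V k 0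

theorem wronskian_const {y₁ y₁' y₂ y₂' : ℝ → ℂ} {q : ℝ → ℂ}
    (h1 : ∀ x, HasDerivAt y₁ (y₁' x) x) (h1' : ∀ x, HasDerivAt y₁' (q x * y₁ x) x)
    (h2 : ∀ x, HasDerivAt y₂ (y₂' x) x) (h2' : ∀ x, HasDerivAt y₂' (q x * y₂ x) x) (x : ℝ) :
    y₁' x * y₂ x - y₁ x * y₂' x = y₁' 0 * y₂ 0 - y₁ 0 * y₂' 0 := by
  have h : ∀ x, HasDerivAt (fun x => y₁' x * y₂ x - y₁ x * y₂' x) 0 x := fun x => by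
    refine (((h1' x).mul (h2 x)).sub ((h1 x).mul (h2' x))).congr_deriv ?_
    ring
  exact is_const_of_deriv_eq_zero (fun x => (h x).differentiableAt) (fun x => (h x).deriv) x 0

theorem wronskian_eq (hV : DecayBound V η M) (hV' : DecayBound (fun x => V (-x)) η M) {k : ℂ}
    (hk : k ∈ upperStrip η) (x : ℝ) :
    psiPlus' V k x * psiMinus V k x - psiPlus V k x * psiMinus' V k x = wronskian V k :=
  wronskian_const (hasDerivAt_psiPlus hV hk) (hasDerivAt_psiPlus' hV hk)
    (hasDerivAt_psiMinus hV' hk) (hasDerivAt_psiMinus' hV' hk) x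

/-- The Cauchy data at `0` are parallel, and those of `ψ₊` do not vanish; uniqueness for the
equation carries proportionality to all `x`. The factor is nonzero because `ψ₋ ≠ 0`. -/
theorem exists_proportional_of_wronskian_eq_zero (hV : DecayBound V η M)
    (hV' : DecayBound (fun x => V (-x)) η M) {k : ℂ} (hk : k ∈ upperStrip η)
    (hW : wronskian V k = 0) :
    ∃ c : ℂ, c ≠ 0 ∧ (∀ x, psiMinus V k x = c * psiPlus V k x) ∧
      ∀ x, psiMinus' V k x = c * psiPlus' V k x := by
  have hb : ∃ M, ∀ t, |V t| ≤ M := ⟨M, abs_potential_le hV⟩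
  have hp : ¬ (psiPlus V k 0 = 0 ∧ psiPlus' V k 0 = 0) := fun h =>
    psiPlus_ne_zero hV hk (eq_zero_of_solves hb _ (hasDerivAt_psiPlus hV hk)
      (hasDerivAt_psiPlus' hV hk) h.1 h.2)
  obtain ⟨c, hc1, hc2⟩ : ∃ c, psiMinus V k 0 = c * psiPlus V k 0 ∧
      psiMinus' V k 0 = c * psiPlus' V k 0 := by
    unfold wronskian at hW
    by_cases h0 : psiPlus V k 0 = 0
    · have h1 : psiPlus' V k 0 ≠ 0 := fun h => hp ⟨h0, h⟩
      refine ⟨psiMinus' V k 0 / psiPlus' V k 0, ?_, by field_simp⟩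
      rw [h0, zero_mul, sub_zero] at hW
      rw [h0, mul_zero]
      exact (mul_eq_zero.1 hW).resolve_left h1
    · refine ⟨psiMinus V k 0 / psiPlus V k 0, by field_simp, ?_⟩
      field_simp
      linear_combination -hW
  have hz : (fun x => psiMinus V k x - c * psiPlus V k x) = 0 := by
    refine eq_zero_of_solves (y' := fun x => psiMinus' V k x - c * psiPlus' V k x) hb (k ^ 2)
      (fun x => (hasDerivAt_psiMinus hV' hk x).sub ((hasDerivAt_psiPlus hV hk x).const_mul c))
      (fun x => ?_) (x₀ := 0) (by simp [hc1]) (by simp [hc2])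
    refine ((hasDerivAt_psiMinus' hV' hk x).sub
      ((hasDerivAt_psiPlus' hV hk x).const_mul c)).congr_deriv ?_
    ring
  have h1 : ∀ x, psiMinus V k x = c * psiPlus V k x := fun x => sub_eq_zero.1 (congrFun hz x)
  refine ⟨c, fun h => ?_, h1, fun x => ?_⟩
  · exact psiMinus_ne_zero hV' hk (by funext x; simp [h1, h])
  · have ha := hasDerivAt_psiMinus hV' hk x
    rw [funext h1] at ha
    exact ha.unique ((hasDerivAt_psiPlus hV hk x).const_mul c)

/-! ### The Wronskian does not vanish in the closed upper half-plane -/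

theorem norm_psiPlus (V : ℝ → ℝ) (k : ℂ) (x : ℝ) :
    ‖psiPlus V k x‖ = Real.exp (-(k.im * x)) * ‖jostM V k x‖ := by
  unfold psiPlus
  rw [norm_mul, Complex.norm_exp]
  congr 2
  simp [Complex.mul_re, Complex.mul_im]

theorem norm_psiPlus_le_of_nonneg (hV : DecayBound V η M) {k : ℂ} (hk : k ∈ upperStrip η) {x : ℝ}
    (hx : 0 ≤ x) : ‖psiPlus V k x‖ ≤ jostConst M * Real.exp (-(k.im * x)) := by
  have h := norm_jostM_le hV hk x
  rw [lossWeight_of_nonneg k hx, max_eq_left (by linarith : -x ≤ 0), add_zero, mul_one, mul_one] at h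
  rw [norm_psiPlus, mul_comm]
  exact mul_le_mul_of_nonneg_right h (Real.exp_pos _).le

theorem integrable_exp_neg_mul_abs {κ : ℝ} (hκ : 0 < κ) :
    Integrable fun x : ℝ => Real.exp (-(κ * |x|)) := by
  have h1 : IntegrableOn (fun x : ℝ => Real.exp (-(κ * |x|))) (Set.Ioi 0) := by
    refine (exp_neg_integrableOn_Ioi 0 hκ).congr_fun (fun x hx => ?_) measurableSet_Ioi
    simp only [abs_of_pos (Set.mem_Ioi.1 hx), neg_mul]
  have h2 : IntegrableOn (fun x : ℝ => Real.exp (-(κ * |x|))) (Set.Iio 0) := by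
    have := (show IntegrableOn (fun x : ℝ => Real.exp (-(κ * |x|))) (Set.Ioi (-0)) by
      simpa using h1).comp_neg_Iio
    simpa using this
  have h3 := (integrableOn_Ici_iff_integrableOn_Ioi (f := fun x : ℝ => Real.exp (-(κ * |x|)))
    (b := 0) (μ := volume)).2 h1
  rw [← integrableOn_univ, ← Set.Iio_union_Ici (a := (0 : ℝ)), integrableOn_union]
  exact ⟨h2, h3⟩

theorem isEigenvalue_of_solution {z : ℂ} {y y' : ℝ → ℂ} (hV : Continuous V)
    (h1 : ∀ x, HasDerivAt y (y' x) x) (h2 : ∀ x, HasDerivAt y' (((V x : ℂ) - z) * y x) x)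
    (hy : MemLp y 2 volume) (hne : y ≠ 0) : IsEigenvalue V z := by
  have hyc : Continuous y := continuous_iff_continuousAt.2 fun x => (h1 x).continuousAt
  refine ⟨hy.toLp y, fun h => hne ?_, y, y', hy.coeFn_toLp, h1, fun x => ?_⟩
  · have h3 : y =ᵐ[volume] (0 : ℝ → ℂ) := by
      have h4 := hy.coeFn_toLp
      rw [h] at h4
      exact h4.symm.trans (Lp.coeFn_zero _ _ _)
    exact (hyc.ae_eq_iff_eq volume continuous_zero).1 h3
  · have h3 : ∫ t in (0:ℝ)..x, ((V t : ℂ) * y t - (z • hy.toLp y : L2) t) =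
        ∫ t in (0:ℝ)..x, ((V t : ℂ) - z) * y t := by
      refine intervalIntegral.integral_congr_ae ?_
      filter_upwards [Lp.coeFn_smul z (hy.toLp y), hy.coeFn_toLp] with t ha hb _
      rw [ha, Pi.smul_apply, hb, smul_eq_mul]; ring
    rw [h3, intervalIntegral.integral_eq_sub_of_hasDerivAt (fun t _ => h2 t)
      (by have : Continuous fun t => ((V t : ℂ) - z) * y t := by fun_prop
          exact this.intervalIntegrable _ _)]
    ring

theorem mem_upperStrip_of_nonneg {η : ℝ} (hη : 0 < η) {k : ℂ} (hk : 0 ≤ k.im) :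
    k ∈ upperStrip η := by
  change -η < k.im
  linarith

theorem memLp_two_of_norm_le_exp {κ C : ℝ} (hκ : 0 < κ) {y : ℝ → ℂ}
    (hy : AEStronglyMeasurable y volume)
    (hb : ∀ x, ‖y x‖ ≤ C * Real.exp (-(κ * |x|))) : MemLp y 2 volume := by
  rw [memLp_two_iff_integrable_sq_norm hy]
  refine Integrable.mono' ((integrable_exp_neg_mul_abs (by linarith : 0 < 2 * κ)).const_mul (C ^ 2))
    (hy.norm.pow 2) (Eventually.of_forall fun x => ?_)
  rw [Real.norm_of_nonneg (by positivity)]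
  calc ‖y x‖ ^ 2 ≤ (C * Real.exp (-(κ * |x|))) ^ 2 := pow_le_pow_left₀ (norm_nonneg _) (hb x) 2
    _ = _ := by rw [mul_pow, ← Real.exp_nat_mul]; push_cast; ring_nf

/-- `ψ₊` decays exponentially at `+∞` and `ψ₋` at `-∞`. If they are proportional, `ψ₊` is an `L²`
eigenfunction for `k²`; this number may be non-real, a case which the hypothesis on eigenvalues
covers. -/
theorem wronskian_ne_zero_of_im_pos (hV : DecayBound V η M)
    (hV' : DecayBound (fun x => V (-x)) η M) (heig : ∀ μ : ℂ, ¬ IsEigenvalue V μ) {k : ℂ}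
    (hk : 0 < k.im) : wronskian V k ≠ 0 := fun hW => by
  have hks := mem_upperStrip_of_nonneg hV.eta_pos hk.le
  obtain ⟨c, hc, h1, -⟩ := exists_proportional_of_wronskian_eq_zero hV hV' hks hW
  have hcont : Continuous (psiPlus V k) :=
    continuous_iff_continuousAt.2 fun x => (hasDerivAt_psiPlus hV hks x).continuousAt
  have hC := jostConst_pos hV.nonneg
  refine heig (k ^ 2) (isEigenvalue_of_solution hV.cont (hasDerivAt_psiPlus hV hks)
    (hasDerivAt_psiPlus' hV hks) (memLp_two_of_norm_le_exp hk (C := jostConst M * (1 + ‖c⁻¹‖))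
      hcont.aestronglyMeasurable fun x => ?_) (psiPlus_ne_zero hV hks))
  rcases le_total 0 x with hx | hx
  · refine (norm_psiPlus_le_of_nonneg hV hks hx).trans ?_
    rw [abs_of_nonneg hx]
    gcongr
    exact le_mul_of_one_le_right hC.le (by linarith [norm_nonneg c⁻¹])
  · have e : psiPlus V k x = c⁻¹ * psiPlus (fun x => V (-x)) k (-x) := by
      have := h1 x
      rw [psiMinus] at this
      rw [this]; field_simp
    rw [e, norm_mul, abs_of_nonpos hx]
    have h2 := norm_psiPlus_le_of_nonneg hV' hks (by linarith : 0 ≤ -x)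
    calc _ ≤ ‖c⁻¹‖ * (jostConst M * Real.exp (-(k.im * -x))) := by gcongr
      _ = (jostConst M * ‖c⁻¹‖) * Real.exp (-(k.im * -x)) := by ring
      _ ≤ _ := by gcongr; linarith

/-- Conservation of flux: `V` and `k²` are real, so the conjugate of `ψ₊` solves the same equation
and the Wronskian of the two is constant. Its value is read off at `+∞`, where `m₊ → 1` and `∂ₓm₊ →
0`. -/
theorem conj_wronskian_psiPlus (hV : DecayBound V η M) {k : ℝ} (x : ℝ) :
    psiPlus' V k x * starRingEnd ℂ (psiPlus V k x) - psiPlus V k x * starRingEnd ℂ (psiPlus' V k x)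
      = 2 * Complex.I * k := by
  have hk : (k : ℂ) ∈ upperStrip η := mem_upperStrip_of_nonneg hV.eta_pos (by simp)
  have hconst := fun x => wronskian_const (y₂ := fun x => starRingEnd ℂ (psiPlus V k x))
    (y₂' := fun x => starRingEnd ℂ (psiPlus' V k x))
    (hasDerivAt_psiPlus hV hk) (hasDerivAt_psiPlus' hV hk)
    (fun x => (hasDerivAt_psiPlus hV hk x).star)
    (fun x => ((hasDerivAt_psiPlus' hV hk x).star).congr_deriv (by simp)) x
  have hlim : Tendsto (fun x => psiPlus' V k x * starRingEnd ℂ (psiPlus V k x) -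
      psiPlus V k x * starRingEnd ℂ (psiPlus' V k x)) atTop (𝓝 (2 * Complex.I * k)) := by
    have he : ∀ x : ℝ, Complex.exp (Complex.I * k * x) *
        starRingEnd ℂ (Complex.exp (Complex.I * k * x)) = 1 := fun x => by
      rw [← Complex.exp_conj, ← Complex.exp_add]
      simp
    have e : ∀ x, psiPlus' V k x * starRingEnd ℂ (psiPlus V k x) -
      psiPlus V k x * starRingEnd ℂ (psiPlus' V k x) =
      (Complex.I * k * jostM V k x + jostP V k x) * starRingEnd ℂ (jostM V k x) -
      jostM V k x * starRingEnd ℂ (Complex.I * k * jostM V k x + jostP V k x) := fun x => by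
      unfold psiPlus' psiPlus
      simp only [map_mul, map_add]
      linear_combination ((Complex.I * k * jostM V k x + jostP V k x) * starRingEnd ℂ (jostM V k x) -
        jostM V k x * (starRingEnd ℂ Complex.I * starRingEnd ℂ (k : ℂ) * starRingEnd ℂ (jostM V k x) +
          starRingEnd ℂ (jostP V k x))) * he x
    simp_rw [e]
    have hm := tendsto_jostM hV hk
    have hp := tendsto_jostP hV hk
    have hc : Tendsto (starRingEnd ℂ) (𝓝 1) (𝓝 1) := by
      simpa using (Complex.continuous_conj.tendsto 1)
    have hq := (hm.const_mul (Complex.I * k)).add hp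
    have := (hq.mul (hc.comp hm)).sub (hm.mul ((Complex.continuous_conj.tendsto _).comp hq))
    have e2 : 2 * Complex.I * k = (Complex.I * k * 1 + 0) * 1 -
        1 * starRingEnd ℂ (Complex.I * k * 1 + 0) := by
      simp only [mul_one, one_mul, add_zero, map_mul, Complex.conj_I, Complex.conj_ofReal]; ring
    rw [e2]
    exact this
  have h0 : Tendsto (fun x => psiPlus' V k x * starRingEnd ℂ (psiPlus V k x) -
      psiPlus V k x * starRingEnd ℂ (psiPlus' V k x)) atTop
      (𝓝 (psiPlus' V k x * starRingEnd ℂ (psiPlus V k x) -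
      psiPlus V k x * starRingEnd ℂ (psiPlus' V k x))) := by
    refine tendsto_const_nhds.congr fun y => ?_
    rw [hconst x, hconst y]
  exact tendsto_nhds_unique h0 hlim

/-- Reflection reverses the flux: `ψ₊` carries `2ik` and `ψ₋` carries `-2ik`. If `ψ₋ = c ψ₊`, then
`|c|² = -1`. -/
theorem wronskian_ne_zero_of_real (hV : DecayBound V η M)
    (hV' : DecayBound (fun x => V (-x)) η M) {k : ℝ} (hk : k ≠ 0) : wronskian V k ≠ 0 := fun hW => by
  have hks : (k : ℂ) ∈ upperStrip η := mem_upperStrip_of_nonneg hV.eta_pos (by simp)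
  obtain ⟨c, -, h1, h2⟩ := exists_proportional_of_wronskian_eq_zero hV hV' hks hW
  have ha := conj_wronskian_psiPlus hV (k := k) 0
  have hb := conj_wronskian_psiPlus hV' (k := k) (-0)
  have e1 := h1 0
  have e2 := h2 0
  rw [psiMinus] at e1
  rw [psiMinus', neg_eq_iff_eq_neg] at e2
  rw [e1, e2] at hb
  simp only [map_neg, map_mul] at hb
  have hcc : c * starRingEnd ℂ c = ((‖c‖ ^ 2 : ℝ) : ℂ) := by
    rw [Complex.mul_conj, Complex.normSq_eq_norm_sq]
  have h3 : (2 * Complex.I * k) * (1 + ((‖c‖ ^ 2 : ℝ) : ℂ)) = 0 := by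
    rw [← hcc]
    linear_combination -hb - (c * starRingEnd ℂ c) * ha
  have h4 : (1 + ((‖c‖ ^ 2 : ℝ) : ℂ)) ≠ 0 := by
    have : (0 : ℝ) < 1 + ‖c‖ ^ 2 := by positivity
    exact_mod_cast this.ne'
  simp [hk] at h3
  exact h4 (by exact_mod_cast h3)

theorem isJostPlus_psiPlus_zero (hV : DecayBound V η M) : IsJostPlus V 0 (psiPlus V 0) := by
  have hks : (0 : ℂ) ∈ upperStrip η := mem_upperStrip_of_nonneg hV.eta_pos (by simp)
  refine ⟨⟨psiPlus' V 0, hasDerivAt_psiPlus hV hks, fun x => ?_⟩, ?_⟩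
  · simpa using hasDerivAt_psiPlus' hV hks x
  · simpa [psiPlus] using tendsto_jostM hV hks

/-- At zero energy `ψ₊'(x) = -∫ₓ^∞ V ψ₊` tends to `-∫ V ψ₊` as `x → -∞`, while `ψ₋'` tends to `0`
there. Proportionality would force `∫ V ψ₊ = 0`. -/
theorem wronskian_zero_ne_zero (hV : DecayBound V η M)
    (hV' : DecayBound (fun x => V (-x)) η M) (hgen : IsGeneric V) : wronskian V 0 ≠ 0 := fun hW => by
  have hks : (0 : ℂ) ∈ upperStrip η := mem_upperStrip_of_nonneg hV.eta_pos (by simp)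
  obtain ⟨c, hc, -, h2⟩ := exists_proportional_of_wronskian_eq_zero hV hV' hks hW
  have hne := hgen.1 _ (isJostPlus_psiPlus_zero hV)
  have e : ∀ x, psiMinus' V 0 x = -jostP (fun x => V (-x)) 0 (-x) := fun x => by
    simp [psiMinus', psiPlus']
  have e2 : ∀ x, psiPlus' V 0 x = -∫ t in Set.Ioi x, (V t : ℂ) * psiPlus V 0 t := fun x => by
    simp [psiPlus', psiPlus, jostP, jostSlope]
  have hint : Integrable fun t => (V t : ℂ) * psiPlus V 0 t := by
    simpa [psiPlus] using integrable_mul_jostM hV hks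
  have l1 : Tendsto (psiMinus' V 0) atBot (𝓝 0) := by
    rw [funext e]
    simpa using ((tendsto_jostP hV' hks).comp tendsto_neg_atBot_atTop).neg
  have l2 : Tendsto (psiMinus' V 0) atBot (𝓝 (c * -∫ t, (V t : ℂ) * psiPlus V 0 t)) := by
    rw [funext h2]
    refine Tendsto.const_mul c ?_
    rw [funext e2]
    exact ((aecover_Ioi tendsto_id).integral_tendsto_of_countably_generated hint).neg
  have := tendsto_nhds_unique l1 l2
  simp [hc] at this
  exact hne this

theorem wronskian_ne_zero (hV : DecayBound V η M) (hV' : DecayBound (fun x => V (-x)) η M)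
    (hgen : IsGeneric V) (heig : ∀ μ : ℂ, ¬ IsEigenvalue V μ) {k : ℂ} (hk : 0 ≤ k.im) :
    wronskian V k ≠ 0 := by
  rcases hk.lt_or_eq with h | h
  · exact wronskian_ne_zero_of_im_pos hV hV' heig h
  · obtain ⟨r, rfl⟩ : ∃ r : ℝ, k = r := ⟨k.re, by apply Complex.ext <;> simp [← h]⟩
    rcases eq_or_ne r 0 with rfl | hr
    · simpa using wronskian_zero_ne_zero hV hV' hgen
    · exact wronskian_ne_zero_of_real hV hV' hr

end

end Schrodinger

namespace Schrodinger

/-! ### The Green function -/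

/-- The properties of the Green function, as a function of the spectral parameter `k` in the closed
upper half-plane, from which the weighted estimates follow. -/
structure GreenKernel (G : ℂ → ℝ → ℝ → ℂ) (δ C : ℝ) : Prop where
  delta_pos : 0 < δ
  const_nonneg : 0 ≤ C
  diff : ∀ x y, DifferentiableOn ℂ (fun k => G k x y) (upperStrip (δ / (1 + |x| + |y|)))
  bound : ∀ x y, ∀ k ∈ upperStrip (δ / (1 + |x| + |y|)), ‖G k x y‖ ≤ C * (1 + |x|)
  bound_mul : ∀ x y, ∀ k ∈ upperStrip (δ / (1 + |x| + |y|)), ‖k‖ * ‖G k x y‖ ≤ C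
  cont : ∀ k : ℂ, 0 ≤ k.im → Continuous (Function.uncurry (G k))

/-- The Green function of `H - k²`. -/
noncomputable def green (V : ℝ → ℝ) (k : ℂ) (x y : ℝ) : ℂ :=
  -(psiPlus V k (max x y) * psiMinus V k (min x y)) / wronskian V k

/-! ### Lower bound for the Wronskian and estimates of the Green function -/

section

variable {V : ℝ → ℝ} {η M : ℝ}

theorem wronskian_formula (V : ℝ → ℝ) (k : ℂ) :
    wronskian V k = 2 * Complex.I * k * (jostM V k 0 * jostM (fun x => V (-x)) k 0) +
      (jostP V k 0 * jostM (fun x => V (-x)) k 0 + jostM V k 0 * jostP (fun x => V (-x)) k 0) := by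
  unfold wronskian psiMinus psiMinus' psiPlus psiPlus'
  simp
  ring

theorem differentiableOn_wronskian (hV : DecayBound V η M)
    (hV' : DecayBound (fun x => V (-x)) η M) :
    DifferentiableOn ℂ (wronskian V) (upperStrip η) := by
  rw [funext (wronskian_formula V)]
  have h1 := differentiableOn_jostM hV 0
  have h2 := differentiableOn_jostM hV' 0
  have h3 := differentiableOn_jostP hV 0
  have h4 := differentiableOn_jostP hV' 0
  fun_prop

/-- `W` is `2ik` times the product of the two `m`'s at `0`, up to an error of at most `4 (jostConst
M)²`. The factor `10` gives both `m`'s modulus at least `9/10`, hence `|W| ≥ (2 · 0.81 - 0.4)|k|`.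
-/
theorem norm_le_norm_wronskian (hV : DecayBound V η M)
    (hV' : DecayBound (fun x => V (-x)) η M) {k : ℂ} (hk : k ∈ upperStrip η)
    (hlarge : 10 * (jostConst M * (1 + 2 * M) + jostConst M ^ 2) ≤ ‖k‖) :
    ‖k‖ ≤ ‖wronskian V k‖ := by
  have hM := hV.nonneg
  have hC := jostConst_pos hM
  set K := jostConst M * (1 + 2 * M) with hK
  have hKpos : 0 ≤ K := by positivity
  have key : ∀ {U : ℝ → ℝ}, DecayBound U η M → ‖jostM U k 0‖ ≤ jostConst M ∧
      ‖jostP U k 0‖ ≤ 2 * jostConst M ∧ ‖k‖ - K ≤ ‖k‖ * ‖jostM U k 0‖ := fun {U} hU => by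
    have h1 := norm_jostM_le hU hk 0
    have h2 := norm_jostP_le hU hk 0
    have h3 := norm_mul_jostM_sub_one_le hU hk 0
    have h4 := tailWeight_le_two 0
    rw [lossWeight_of_nonneg k le_rfl] at h1 h2 h3
    have h5 : 1 ≤ ‖jostM U k 0‖ + ‖jostM U k 0 - 1‖ := by
      have := norm_sub_norm_le (1 : ℂ) (jostM U k 0)
      rw [norm_one, norm_sub_rev] at this
      linarith
    refine ⟨by simpa using h1, ?_, ?_⟩
    · nlinarith
    · nlinarith [norm_nonneg k]
  obtain ⟨a1, a2, a3⟩ := key hV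
  obtain ⟨b1, b2, b3⟩ := key hV'
  set m := ‖jostM V k 0‖
  set m' := ‖jostM (fun x => V (-x)) k 0‖
  have hm : 0 ≤ m := norm_nonneg _
  have hm' : 0 ≤ m' := norm_nonneg _
  have hpert : ‖jostP V k 0 * jostM (fun x => V (-x)) k 0 +
      jostM V k 0 * jostP (fun x => V (-x)) k 0‖ ≤ 4 * jostConst M ^ 2 := by
    refine (norm_add_le _ _).trans ?_
    rw [norm_mul, norm_mul]
    have e1 := mul_le_mul a2 b1 hm' (by positivity)
    have e2 := mul_le_mul a1 b2 (norm_nonneg _) hC.le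
    nlinarith
  have hmain : ‖2 * Complex.I * k * (jostM V k 0 * jostM (fun x => V (-x)) k 0)‖
      = 2 * ‖k‖ * (m * m') := by
    simp [m, m']
  rw [wronskian_formula]
  have htri := norm_sub_norm_le (2 * Complex.I * k * (jostM V k 0 * jostM (fun x => V (-x)) k 0))
    (-(jostP V k 0 * jostM (fun x => V (-x)) k 0 + jostM V k 0 * jostP (fun x => V (-x)) k 0))
  rw [sub_neg_eq_add, norm_neg, hmain] at htri
  have hk0 : 0 < ‖k‖ := lt_of_lt_of_le (by positivity) hlarge
  have c1 : 9 / 10 ≤ m := by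
    have : 9 / 10 * ‖k‖ ≤ m * ‖k‖ := by nlinarith [sq_nonneg (jostConst M)]
    exact le_of_mul_le_mul_right this hk0
  have c2 : 9 / 10 ≤ m' := by
    have : 9 / 10 * ‖k‖ ≤ m' * ‖k‖ := by nlinarith [sq_nonneg (jostConst M)]
    exact le_of_mul_le_mul_right this hk0
  have c3 : 81 / 100 ≤ m * m' := by nlinarith
  nlinarith

/-- Large `k` is `norm_le_norm_wronskian`. For bounded `k` the zeros form a compact set; the highest
one lies strictly below the real axis, so a thin strip is free of zeros and `|W|` has a positive
minimum on its compact part. -/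
theorem exists_wronskian_lower_bound (hV : DecayBound V η M)
    (hV' : DecayBound (fun x => V (-x)) η M) (hW : ∀ k : ℂ, 0 ≤ k.im → wronskian V k ≠ 0) :
    ∃ δ c : ℝ, 0 < δ ∧ δ < η ∧ 0 < c ∧ ∀ k : ℂ, -δ < k.im → c * (1 + ‖k‖) ≤ ‖wronskian V k‖ := by
  have hη := hV.eta_pos
  set R := 10 * (jostConst M * (1 + 2 * M) + jostConst M ^ 2) + 1 with hR
  have hR1 : 1 ≤ R := by
    have := jostConst_pos hV.nonneg
    have := hV.nonneg
    have : 0 ≤ 10 * (jostConst M * (1 + 2 * M) + jostConst M ^ 2) := by positivity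
    linarith
  have hcomp : ∀ a : ℝ, IsCompact (Metric.closedBall (0 : ℂ) R ∩ {k | -a ≤ k.im}) := fun a =>
    (isCompact_closedBall _ _).inter_right (isClosed_le continuous_const Complex.continuous_im)
  have hsub : ∀ a : ℝ, a < η → Metric.closedBall (0 : ℂ) R ∩ {k | -a ≤ k.im} ⊆ upperStrip η :=
    fun a ha k hk => by
      have : -a ≤ k.im := hk.2
      change -η < k.im
      linarith
  have hcont := (differentiableOn_wronskian hV hV').continuousOn
  obtain ⟨δ, hδ0, hδη, hδ⟩ : ∃ δ, 0 < δ ∧ δ < η ∧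
      ∀ k ∈ Metric.closedBall (0 : ℂ) R ∩ {k | -δ ≤ k.im}, wronskian V k ≠ 0 := by
    set Z := (Metric.closedBall (0 : ℂ) R ∩ {k | -(η / 2) ≤ k.im}) ∩ wronskian V ⁻¹' {0} with hZ
    have hZc : IsCompact Z := by
      refine (hcomp (η / 2)).of_isClosed_subset ?_ Set.inter_subset_left
      exact (hcont.mono (hsub _ (by linarith))).preimage_isClosed_of_isClosed (hcomp _).isClosed
        isClosed_singleton
    rcases Z.eq_empty_or_nonempty with h | h
    · refine ⟨η / 2, by linarith, by linarith, fun k hk h0 => ?_⟩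
      have : k ∈ Z := ⟨hk, h0⟩
      rw [h] at this
      exact this
    · obtain ⟨k₀, hk₀, hmax⟩ := hZc.exists_isMaxOn h Complex.continuous_im.continuousOn
      have hneg : k₀.im < 0 := by
        by_contra! hge
        exact hW k₀ hge hk₀.2
      refine ⟨min (η / 2) (-k₀.im / 2), lt_min (by linarith) (by linarith), ?_, fun k hk h0 => ?_⟩
      · exact lt_of_le_of_lt (min_le_left _ _) (by linarith)
      · have h1 : -(min (η / 2) (-k₀.im / 2)) ≤ k.im := hk.2
        have h2 := min_le_left (η / 2) (-k₀.im / 2)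
        have h3 := min_le_right (η / 2) (-k₀.im / 2)
        have hkZ : k ∈ Z := ⟨⟨hk.1, by change -(η / 2) ≤ k.im; linarith⟩, h0⟩
        have h4 : k.im ≤ k₀.im := hmax hkZ
        linarith
  have hne : (Metric.closedBall (0 : ℂ) R ∩ {k | -δ ≤ k.im}).Nonempty :=
    ⟨0, by simp; linarith, by simp [hδ0.le]⟩
  obtain ⟨k₁, hk₁, hmin⟩ := (hcomp δ).exists_isMinOn hne (hcont.mono (hsub _ hδη)).norm
  have hc0 : 0 < ‖wronskian V k₁‖ := norm_pos_iff.2 (hδ _ hk₁)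
  refine ⟨δ, min (1 / 2) (‖wronskian V k₁‖ / (1 + R)), hδ0, hδη, by positivity, fun k hk => ?_⟩
  rcases le_total ‖k‖ R with h | h
  · have h1 : ‖wronskian V k₁‖ ≤ ‖wronskian V k‖ := hmin ⟨by simpa using h, hk.le⟩
    calc _ ≤ ‖wronskian V k₁‖ / (1 + R) * (1 + R) := by
          gcongr
          exact min_le_right _ _
      _ = ‖wronskian V k₁‖ := by field_simp
      _ ≤ _ := h1
  · have h1 := norm_le_norm_wronskian hV hV' (k := k) (by change -η < k.im; linarith) (by linarith)
    calc _ ≤ 1 / 2 * (1 + ‖k‖) := by gcongr; exact min_le_left _ _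
      _ ≤ ‖k‖ := by linarith
      _ ≤ _ := h1

theorem lossWeight_le_exp {δ L : ℝ} (hδ : 0 < δ) {k : ℂ} {x : ℝ} (hL : 0 < L) (hx : |x| ≤ L)
    (hk : k ∈ upperStrip (δ / L)) : lossWeight k x ≤ Real.exp (2 * δ) := by
  refine (lossWeight_le (by positivity) hk x).trans (Real.exp_le_exp.2 ?_)
  have : δ / L * |x| ≤ δ := by
    calc δ / L * |x| ≤ δ / L * L := by gcongr
      _ = δ := by field_simp
  linarith

theorem norm_psiPlus_mul_psiMinus (V : ℝ → ℝ) (k : ℂ) (x y : ℝ) :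
    ‖psiPlus V k (max x y) * psiMinus V k (min x y)‖ = Real.exp (-(k.im * |x - y|)) *
      (‖jostM V k (max x y)‖ * ‖jostM (fun x => V (-x)) k (-min x y)‖) := by
  rw [norm_mul, psiMinus, norm_psiPlus, norm_psiPlus]
  have : Real.exp (-(k.im * |x - y|)) = Real.exp (-(k.im * max x y)) *
      Real.exp (-(k.im * -min x y)) := by
    rw [← Real.exp_add, ← max_sub_min_eq_abs']; ring_nf
  rw [this]; ring

/-- Used with `a = max x y` and `b = min x y`. `m₊` grows only at negative arguments and `m₋` only
at positive ones, so at most one factor exceeds `1`. The product therefore grows linearly in one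
variable, not in both. -/
theorem mul_max_le_one_add_abs {a b x : ℝ} (hb : b ≤ x) (ha : x ≤ a) :
    (1 + max 0 (-a)) * (1 + max 0 b) ≤ 1 + |x| := by
  rcases lt_or_ge a 0 with h | h
  · rw [max_eq_left (by linarith : b ≤ 0), max_eq_right (by linarith : 0 ≤ -a)]
    linarith [neg_le_abs x]
  · rw [max_eq_left (by linarith : -a ≤ 0)]
    rcases le_total b 0 with h' | h'
    · rw [max_eq_left h']; linarith [abs_nonneg x]
    · rw [max_eq_right h']; linarith [le_abs_self x]

/-- In a strip of width `δ / (1 + |x| + |y|)` the loss weights are at most `e^{2δ}`. For the second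
bound, one of the two Jost factors is on its good side and stays bounded, and the other satisfies
`|k| |m| ≤ |k| + O(1)`. -/
theorem norm_jostM_mul_le (hV : DecayBound V η M) (hV' : DecayBound (fun x => V (-x)) η M)
    {δ : ℝ} (hδ : 0 < δ) (hδη : δ < η) {x y : ℝ} {k : ℂ}
    (hk : k ∈ upperStrip (δ / (1 + |x| + |y|))) :
    ‖jostM V k (max x y)‖ * ‖jostM (fun x => V (-x)) k (-min x y)‖ ≤
        (jostConst M * Real.exp (2 * δ)) ^ 2 * (1 + |x|) ∧
    ‖k‖ * (‖jostM V k (max x y)‖ * ‖jostM (fun x => V (-x)) k (-min x y)‖) ≤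
        jostConst M ^ 2 * Real.exp (2 * δ) ^ 2 * (2 + 2 * M) * (1 + ‖k‖) := by
  have hM := hV.nonneg
  set C := jostConst M with hCdef
  have hC : 0 < C := jostConst_pos hM
  have hC1 : 1 ≤ C := by
    rw [hCdef, jostConst]
    exact one_le_mul_of_one_le_of_one_le (by linarith) (Real.one_le_exp (by positivity))
  set E := Real.exp (2 * δ) with hE
  have hE1 : 1 ≤ E := Real.one_le_exp (by positivity)
  have hL : 0 < 1 + |x| + |y| := by positivity
  have hkη : k ∈ upperStrip η := by
    have h1 : δ / (1 + |x| + |y|) ≤ δ :=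
      div_le_self hδ.le (by linarith [abs_nonneg x, abs_nonneg y])
    have h2 : -(δ / (1 + |x| + |y|)) < k.im := hk
    change -η < k.im
    linarith
  have habs : |max x y| ≤ 1 + |x| + |y| := by
    have := abs_max_le_max_abs_abs (a := x) (b := y)
    have := max_le_add_of_nonneg (abs_nonneg x) (abs_nonneg y)
    linarith
  have habs' : |-min x y| ≤ 1 + |x| + |y| := by
    rw [abs_neg]
    have := abs_min_le_max_abs_abs (a := x) (b := y)
    have := max_le_add_of_nonneg (abs_nonneg x) (abs_nonneg y)
    linarith
  have l1 := lossWeight_le_exp hδ hL habs hk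
  have l2 := lossWeight_le_exp hδ hL habs' hk
  have p1 := lossWeight_pos k (max x y)
  have p2 := lossWeight_pos k (-min x y)
  have b1 : ‖jostM V k (max x y)‖ ≤ C * ((1 + max 0 (-max x y)) * E) :=
    (norm_jostM_le hV hkη _).trans (by gcongr)
  have b2 : ‖jostM (fun x => V (-x)) k (-min x y)‖ ≤ C * ((1 + max 0 (min x y)) * E) := by
    refine (norm_jostM_le hV' hkη _).trans ?_
    rw [neg_neg]
    gcongr
  have key : ∀ {U : ℝ → ℝ}, DecayBound U η M → ∀ {t}, lossWeight k t ≤ E →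
      ‖k‖ * ‖jostM U k t‖ ≤ C * E * (1 + 2 * M) + ‖k‖ := fun {U} hU t ht => by
    have h3 := norm_mul_jostM_sub_one_le hU hkη t
    have h5 : ‖jostM U k t‖ ≤ ‖jostM U k t - 1‖ + 1 := by
      have := norm_add_le (jostM U k t - 1) 1
      simpa using this
    calc ‖k‖ * ‖jostM U k t‖ ≤ ‖k‖ * (‖jostM U k t - 1‖ + 1) := by gcongr
      _ = ‖k‖ * ‖jostM U k t - 1‖ + ‖k‖ := by ring
      _ ≤ C * (1 + 2 * M) * lossWeight k t + ‖k‖ := by gcongr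
      _ ≤ C * (1 + 2 * M) * E + ‖k‖ := by gcongr
      _ = _ := by ring
  have hfin : (C * E * (1 + 2 * M) + ‖k‖) * (C * E) ≤ C ^ 2 * E ^ 2 * (2 + 2 * M) * (1 + ‖k‖) := by
    have h1 : 1 ≤ C * E := one_le_mul_of_one_le_of_one_le hC1 hE1
    have h2 := norm_nonneg k
    calc _ = (C * E) * (C * E) * (1 + 2 * M) + ‖k‖ * (C * E) * 1 := by ring
      _ ≤ (C * E) * (C * E) * (1 + 2 * M) + ‖k‖ * (C * E) * (C * E) := by gcongr
      _ ≤ (C * E) * (C * E) * ((2 + 2 * M) * (1 + ‖k‖)) := by nlinarith [mul_nonneg hM h2, sq_nonneg (C * E)]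
      _ = _ := by ring
  refine ⟨?_, ?_⟩
  · calc _ ≤ (C * ((1 + max 0 (-max x y)) * E)) * (C * ((1 + max 0 (min x y)) * E)) := by gcongr
      _ = (C * E) ^ 2 * ((1 + max 0 (-max x y)) * (1 + max 0 (min x y))) := by ring
      _ ≤ _ := mul_le_mul_of_nonneg_left
        (mul_max_le_one_add_abs (min_le_left x y) (le_max_left x y)) (by positivity)
  · rcases le_total (min x y) 0 with h | h
    · rw [max_eq_left h, add_zero, one_mul] at b2
      calc _ = (‖k‖ * ‖jostM V k (max x y)‖) * ‖jostM (fun x => V (-x)) k (-min x y)‖ := by ring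
        _ ≤ (C * E * (1 + 2 * M) + ‖k‖) * (C * E) := by
          have := key hV l1
          gcongr
        _ ≤ _ := hfin
    · have h' : 0 ≤ max x y := h.trans (min_le_max)
      rw [max_eq_left (by linarith : -max x y ≤ 0), add_zero, one_mul] at b1
      calc _ = (‖k‖ * ‖jostM (fun x => V (-x)) k (-min x y)‖) * ‖jostM V k (max x y)‖ := by ring
        _ ≤ (C * E * (1 + 2 * M) + ‖k‖) * (C * E) := by
          have := key hV' l2
          gcongr
        _ ≤ _ := hfin

/-- The bounds on the Jost factors are divided by `|W| ≥ c(1 + |k|)`. The strip shrinks with `x` and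
`y` so that `e^{-Im k |x-y|}` stays bounded in it. The last estimate keeps this exponential for the
`L²` theory. -/
theorem exists_greenKernel (hV : DecayBound V η M) (hV' : DecayBound (fun x => V (-x)) η M)
    (hW : ∀ k : ℂ, 0 ≤ k.im → wronskian V k ≠ 0) :
    ∃ δ C, GreenKernel (green V) δ C ∧
      ∀ k : ℂ, 0 ≤ k.im → ∀ x y, ‖k‖ * ‖green V k x y‖ ≤ C * Real.exp (-(k.im * |x - y|)) := by
  obtain ⟨δ, c, hδ, hδη, hc, hlow⟩ := exists_wronskian_lower_bound hV hV' hW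
  have hM := hV.nonneg
  have hC := jostConst_pos hM
  set C₁ := (jostConst M * Real.exp (2 * δ)) ^ 2
  set C₂ := jostConst M ^ 2 * Real.exp (2 * δ) ^ 2 * (2 + 2 * M)
  have hC₁ : 0 ≤ C₁ := by positivity
  have hC₂ : 0 ≤ C₂ := by positivity
  have hsub : ∀ {x y : ℝ} {k : ℂ}, k ∈ upperStrip (δ / (1 + |x| + |y|)) → -δ < k.im :=
    fun {x y k} hk => by
      have h1 : δ / (1 + |x| + |y|) ≤ δ :=
        div_le_self hδ.le (by linarith [abs_nonneg x, abs_nonneg y])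
      have h2 : -(δ / (1 + |x| + |y|)) < k.im := hk
      linarith
  have hexp : ∀ {x y : ℝ} {k : ℂ}, k ∈ upperStrip (δ / (1 + |x| + |y|)) →
      Real.exp (-(k.im * |x - y|)) ≤ Real.exp δ := fun {x y k} hk => by
    refine Real.exp_le_exp.2 ?_
    have h2 : -(δ / (1 + |x| + |y|)) < k.im := hk
    have h3 : |x - y| ≤ 1 + |x| + |y| := by linarith [abs_sub x y]
    calc -(k.im * |x - y|) = -k.im * |x - y| := by ring
      _ ≤ δ / (1 + |x| + |y|) * |x - y| := by gcongr; linarith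
      _ ≤ δ / (1 + |x| + |y|) * (1 + |x| + |y|) := by gcongr
      _ = δ := by field_simp
  have hG : ∀ {x y : ℝ} {k : ℂ}, -δ < k.im → ‖green V k x y‖ ≤ Real.exp (-(k.im * |x - y|)) *
      (‖jostM V k (max x y)‖ * ‖jostM (fun x => V (-x)) k (-min x y)‖) / (c * (1 + ‖k‖)) :=
    fun {x y k} hk => by
      rw [green, norm_div, norm_neg, norm_psiPlus_mul_psiMinus]
      have := hlow k hk
      gcongr
  have hmul : ∀ {x y : ℝ} {k : ℂ}, k ∈ upperStrip (δ / (1 + |x| + |y|)) →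
      ‖k‖ * ‖green V k x y‖ ≤ C₂ / c * Real.exp (-(k.im * |x - y|)) := fun {x y k} hk => by
    have h1 := (norm_jostM_mul_le hV hV' hδ hδη hk).2
    calc _ ≤ ‖k‖ * (Real.exp (-(k.im * |x - y|)) * (‖jostM V k (max x y)‖ *
          ‖jostM (fun x => V (-x)) k (-min x y)‖) / (c * (1 + ‖k‖))) := by
          gcongr; exact hG (hsub hk)
      _ = Real.exp (-(k.im * |x - y|)) * (‖k‖ * (‖jostM V k (max x y)‖ *
          ‖jostM (fun x => V (-x)) k (-min x y)‖)) / (c * (1 + ‖k‖)) := by ring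
      _ ≤ Real.exp (-(k.im * |x - y|)) * (C₂ * (1 + ‖k‖)) / (c * (1 + ‖k‖)) := by gcongr
      _ = _ := by field_simp
  refine ⟨δ, (C₁ + C₂) / c * Real.exp δ, ⟨hδ, by positivity, fun x y k hk => ?_, fun x y k hk => ?_,
    fun x y k hk => ?_, fun k hk => ?_⟩, fun k hk x y => ?_⟩
  · have hkη : k ∈ upperStrip η := by
      have := hsub hk
      change -η < k.im
      linarith
    have hat : ∀ {f : ℂ → ℂ}, DifferentiableOn ℂ f (upperStrip η) → DifferentiableAt ℂ f k :=
      fun hf => hf.differentiableAt ((isOpen_upperStrip η).mem_nhds hkη)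
    have hW0 : wronskian V k ≠ 0 := by
      have := hlow k (hsub hk)
      refine norm_pos_iff.1 (lt_of_lt_of_le (by positivity) this)
    have d1 := hat (differentiableOn_jostM hV (max x y))
    have d2 := hat (differentiableOn_jostM hV' (-min x y))
    have d3 := hat (differentiableOn_wronskian hV hV')
    refine DifferentiableAt.differentiableWithinAt ?_
    unfold green psiMinus psiPlus
    fun_prop (disch := assumption)
  · have h1 := (norm_jostM_mul_le hV hV' hδ hδη hk).1
    have hk1 : 1 ≤ 1 + ‖k‖ := by linarith [norm_nonneg k]
    calc _ ≤ Real.exp (-(k.im * |x - y|)) * (‖jostM V k (max x y)‖ *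
          ‖jostM (fun x => V (-x)) k (-min x y)‖) / (c * (1 + ‖k‖)) := hG (hsub hk)
      _ ≤ Real.exp δ * (C₁ * (1 + |x|)) / (c * 1) := by
          have := hexp hk
          gcongr
      _ = C₁ / c * Real.exp δ * (1 + |x|) := by ring
      _ ≤ _ := by gcongr; linarith
  · calc _ ≤ C₂ / c * Real.exp (-(k.im * |x - y|)) := hmul hk
      _ ≤ C₂ / c * Real.exp δ := mul_le_mul_of_nonneg_left (hexp hk) (by positivity)
      _ ≤ _ := by gcongr; linarith
  · have hkη := mem_upperStrip_of_nonneg hV.eta_pos hk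
    have c1 : Continuous (psiPlus V k) :=
      continuous_iff_continuousAt.2 fun x => (hasDerivAt_psiPlus hV hkη x).continuousAt
    have c2 : Continuous (psiMinus V k) :=
      continuous_iff_continuousAt.2 fun x => (hasDerivAt_psiMinus hV' hkη x).continuousAt
    unfold green Function.uncurry
    fun_prop
  · have hk' : k ∈ upperStrip (δ / (1 + |x| + |y|)) := mem_upperStrip_of_nonneg (by positivity) hk
    refine (hmul hk').trans (mul_le_mul_of_nonneg_right ?_ (Real.exp_pos _).le)
    have : 1 ≤ Real.exp δ := Real.one_le_exp hδ.le
    calc C₂ / c ≤ (C₁ + C₂) / c * 1 := by rw [mul_one]; gcongr; linarith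
      _ ≤ _ := by gcongr

end

/-! ### Potentials with exponential decay -/

theorem one_add_pow_five_le {a : ℝ} (ha : 0 < a) {s : ℝ} (hs : 0 ≤ s) :
    (1 + s) ^ 5 ≤ 120 / a ^ 5 * Real.exp a * Real.exp (a * s) := by
  have h := Real.pow_div_factorial_le_exp (a * (1 + s)) (by positivity) 5
  rw [mul_assoc, ← Real.exp_add, show a + a * s = a * (1 + s) by ring]
  rw [mul_pow] at h
  norm_num [Nat.factorial] at h
  rw [div_mul_eq_mul_div, le_div_iff₀ (by positivity)]
  linarith

theorem exists_decayBound {V : ℝ → ℝ} (hc : Continuous V) (hd : DecaysExponentially V) :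
    ∃ η M, DecayBound V η M ∧ DecayBound (fun x => V (-x)) η M := by
  obtain ⟨M, c, hc0, hM⟩ := hd
  have hM0 : 0 ≤ M := by
    have := (abs_nonneg _).trans (hM 0)
    simpa using this
  set B := 120 / (c / 2) ^ 5 * Real.exp (c / 2) with hB
  have hB0 : 0 ≤ B := by positivity
  -- With `η = c / 8` the exponential weight `e^{4η|t|}` uses half of the decay. The other half
  -- absorbs `(1 + |t|)⁵`: four powers from `(1 + t²)²`, one from `growthWeight`.
  have main : ∀ {U : ℝ → ℝ}, Continuous U → (∀ x, |U x| ≤ M * Real.exp (-(c * |x|))) →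
      DecayBound U (c / 8) (2 * M * B) := fun {U} hU hb => by
    refine ⟨hU, by positivity, by positivity, fun t => ?_⟩
    have h1 := one_add_pow_five_le (half_pos hc0) (abs_nonneg t)
    have h2 : 1 + growthWeight t ≤ 2 * (1 + |t|) := by
      have := growthWeight_le t
      have : max 0 (-t) ≤ |t| := max_le (abs_nonneg t) (neg_le_abs t)
      linarith
    have h3 : 1 + t ^ 2 ≤ (1 + |t|) ^ 2 := by nlinarith [sq_abs t, abs_nonneg t]
    have hg := growthWeight_pos t
    have hexp : Real.exp (-(c * |t|)) * Real.exp (4 * (c / 8) * |t|) * Real.exp (c / 2 * |t|) = 1 := by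
      rw [← Real.exp_add, ← Real.exp_add, Real.exp_eq_one_iff]; ring
    rw [inv_pow, ← div_eq_mul_inv, le_div_iff₀ (by positivity)]
    calc |U t| * ((1 + growthWeight t) * Real.exp (4 * (c / 8) * |t|)) * (1 + t ^ 2) ^ 2
        ≤ (M * Real.exp (-(c * |t|))) * ((2 * (1 + |t|)) * Real.exp (4 * (c / 8) * |t|)) *
          ((1 + |t|) ^ 2) ^ 2 := by
          have := hb t
          gcongr
      _ = 2 * M * (Real.exp (-(c * |t|)) * Real.exp (4 * (c / 8) * |t|)) * (1 + |t|) ^ 5 := by ring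
      _ ≤ 2 * M * (Real.exp (-(c * |t|)) * Real.exp (4 * (c / 8) * |t|)) *
          (B * Real.exp (c / 2 * |t|)) := by gcongr
      _ = 2 * M * B * (Real.exp (-(c * |t|)) * Real.exp (4 * (c / 8) * |t|) *
          Real.exp (c / 2 * |t|)) := by ring
      _ = 2 * M * B := by rw [hexp, mul_one]
  refine ⟨_, _, main hc hM, main (hc.comp continuous_neg) fun x => ?_⟩
  simpa using hM (-x)

end Schrodinger

/-! ### Weighted integral operators on `L^∞` and their dependence on `k` -/

namespace Schrodinger

/-! ### Integral operators on `L^∞` -/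

/-- The operator `A` on `L^∞` is the integral operator with kernel `K`. -/
def HasKernel (A : Linfty →L[ℂ] Linfty) (K : ℝ → ℝ → ℂ) : Prop :=
  ∀ f : Linfty, A f =ᵐ[volume] fun x => ∫ y, K x y * f y

theorem ae_norm_le_norm_linfty (f : Linfty) : ∀ᵐ x, ‖f x‖ ≤ ‖f‖ := by
  have h1 : ∀ᵐ x, ‖f x‖ₑ ≤ eLpNormEssSup f volume := ae_le_eLpNormEssSup
  filter_upwards [h1] with x hx
  rw [Lp.norm_def, eLpNorm_exponent_top, ← toReal_enorm]
  refine ENNReal.toReal_mono ?_ hx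
  have := Lp.eLpNorm_ne_top f
  rwa [eLpNorm_exponent_top] at this

theorem norm_linfty_le_of_ae_bound {f : Linfty} {C : ℝ} (hC : 0 ≤ C) (h : ∀ᵐ x, ‖f x‖ ≤ C) :
    ‖f‖ ≤ C := by
  rw [Lp.norm_def, eLpNorm_exponent_top]
  refine ENNReal.toReal_le_of_le_ofReal hC (eLpNormEssSup_le_of_ae_bound h)

section

variable {K K' : ℝ → ℝ → ℂ} {p p' : ℝ → ℝ} {D D' : ℝ}

theorem integrable_kernel_mul (hK : StronglyMeasurable (Function.uncurry K))
    (hb : ∀ x y, ‖K x y‖ ≤ D * p y) (hp : Integrable p) (f : Linfty) (x : ℝ) :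
    Integrable fun y => K x y * f y := by
  refine Integrable.mono' ((hp.const_mul D).mul_const ‖f‖) ?_ ?_
  · have h1 : StronglyMeasurable (K x) := hK.of_uncurry_left
    exact h1.aestronglyMeasurable.mul (Lp.aestronglyMeasurable f)
  · filter_upwards [ae_norm_le_norm_linfty f] with y hy
    rw [norm_mul]
    exact mul_le_mul (hb x y) hy (norm_nonneg _) ((norm_nonneg _).trans (hb x y))

theorem norm_integral_kernel_le (hb : ∀ x y, ‖K x y‖ ≤ D * p y) (hp : Integrable p) (f : Linfty)
    (x : ℝ) : ‖∫ y, K x y * f y‖ ≤ D * (∫ y, p y) * ‖f‖ := by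
  calc _ ≤ ∫ y, D * p y * ‖f‖ := by
        refine norm_integral_le_of_norm_le ((hp.const_mul D).mul_const ‖f‖) ?_
        filter_upwards [ae_norm_le_norm_linfty f] with y hy
        rw [norm_mul]
        exact mul_le_mul (hb x y) hy (norm_nonneg _) ((norm_nonneg _).trans (hb x y))
    _ = _ := by rw [integral_mul_const, integral_const_mul]

theorem HasKernel.norm_le {A : Linfty →L[ℂ] Linfty} (hA : HasKernel A K)
    (hb : ∀ x y, ‖K x y‖ ≤ D * p y) (hp : Integrable p) : ‖A‖ ≤ D * ∫ y, p y := by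
  have h0 : 0 ≤ D * ∫ y, p y := by
    rw [← integral_const_mul]
    exact integral_nonneg fun y => (norm_nonneg _).trans (hb 0 y)
  refine ContinuousLinearMap.opNorm_le_bound _ h0 fun f => ?_
  refine norm_linfty_le_of_ae_bound (by positivity) ?_
  filter_upwards [hA f] with x hx
  rw [hx]
  exact norm_integral_kernel_le hb hp f x

theorem exists_hasKernel (hK : StronglyMeasurable (Function.uncurry K))
    (hb : ∀ x y, ‖K x y‖ ≤ D * p y) (hp : Integrable p) : ∃ A, HasKernel A K := by
  have hmem : ∀ f : Linfty, MemLp (fun x => ∫ y, K x y * f y) ∞ volume := fun f => by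
    refine memLp_top_of_bound ?_ _ (Eventually.of_forall (norm_integral_kernel_le hb hp f))
    have hf := Lp.stronglyMeasurable f
    have h1 : StronglyMeasurable fun q : ℝ × ℝ => K q.1 q.2 * f q.2 :=
      hK.mul (hf.comp_measurable measurable_snd)
    exact (h1.integral_prod_right (ν := volume)).aestronglyMeasurable
  let T : Linfty →ₗ[ℂ] Linfty :=
    { toFun := fun f => (hmem f).toLp _
      map_add' := fun f g => by
        rw [← MemLp.toLp_add]
        refine MemLp.toLp_congr _ _ (Eventually.of_forall fun x => ?_)
        simp only [Pi.add_apply]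
        rw [← integral_add (integrable_kernel_mul hK hb hp f x) (integrable_kernel_mul hK hb hp g x)]
        refine integral_congr_ae ?_
        filter_upwards [Lp.coeFn_add f g] with y hy
        rw [hy, Pi.add_apply, mul_add]
      map_smul' := fun c f => by
        rw [RingHom.id_apply, ← MemLp.toLp_const_smul]
        refine MemLp.toLp_congr _ _ (Eventually.of_forall fun x => ?_)
        simp only [Pi.smul_apply, smul_eq_mul]
        rw [← integral_const_mul]
        refine integral_congr_ae ?_
        filter_upwards [Lp.coeFn_smul c f] with y hy
        rw [hy, Pi.smul_apply, smul_eq_mul]; ring }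
  have h0 : 0 ≤ D * ∫ y, p y := by
    rw [← integral_const_mul]
    exact integral_nonneg fun y => (norm_nonneg _).trans (hb 0 y)
  refine ⟨T.mkContinuous (D * ∫ y, p y) fun f => ?_, fun f => (hmem f).coeFn_toLp⟩
  refine norm_linfty_le_of_ae_bound (by positivity) ?_
  filter_upwards [(hmem f).coeFn_toLp] with x hx
  change ‖((hmem f).toLp _ : Linfty) x‖ ≤ _
  rw [hx]
  exact norm_integral_kernel_le hb hp f x

theorem HasKernel.sub {A A' : Linfty →L[ℂ] Linfty} (hA : HasKernel A K) (hA' : HasKernel A' K')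
    (hK : StronglyMeasurable (Function.uncurry K)) (hb : ∀ x y, ‖K x y‖ ≤ D * p y)
    (hp : Integrable p) (hK' : StronglyMeasurable (Function.uncurry K'))
    (hb' : ∀ x y, ‖K' x y‖ ≤ D' * p' y) (hp' : Integrable p') :
    HasKernel (A - A') fun x y => K x y - K' x y := fun f => by
  filter_upwards [hA f, hA' f, Lp.coeFn_sub (A f) (A' f)] with x h1 h2 h3
  rw [_root_.sub_apply, h3, Pi.sub_apply, h1, h2, ← integral_sub
    (integrable_kernel_mul hK hb hp f x) (integrable_kernel_mul hK' hb' hp' f x)]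
  simp only [sub_mul]

theorem HasKernel.smul {A : Linfty →L[ℂ] Linfty} (hA : HasKernel A K) (c : ℂ) :
    HasKernel (c • A) fun x y => c * K x y := fun f => by
  filter_upwards [hA f, Lp.coeFn_smul c (A f)] with x h1 h2
  rw [_root_.smul_apply, h2, Pi.smul_apply, h1, smul_eq_mul, ← integral_const_mul]
  simp only [mul_assoc]

end

/-! ### Weights -/

/-- The weight `⟨x⟩^{-β}`. -/
noncomputable def weight (β x : ℝ) : ℝ := bracket x ^ (-β)

theorem one_le_bracket (x : ℝ) : 1 ≤ bracket x := by
  unfold bracket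
  exact Real.one_le_sqrt.2 (by nlinarith [sq_nonneg |x|])

theorem one_add_abs_le_bracket (x : ℝ) : 1 + |x| ≤ 2 * bracket x := by
  have h1 := one_le_bracket x
  have h2 : |x| ≤ bracket x := by
    unfold bracket
    exact Real.le_sqrt_of_sq_le (by linarith)
  linarith

theorem weight_pos (β x : ℝ) : 0 < weight β x :=
  Real.rpow_pos_of_pos (by linarith [one_le_bracket x]) _

theorem weight_le_one {β : ℝ} (hβ : 0 ≤ β) (x : ℝ) : weight β x ≤ 1 :=
  Real.rpow_le_one_of_one_le_of_nonpos (one_le_bracket x) (by linarith)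

theorem continuous_bracket : Continuous bracket := by
  unfold bracket
  fun_prop

theorem continuous_weight (β : ℝ) : Continuous (weight β) := by
  unfold weight
  exact continuous_bracket.rpow_const fun x => Or.inl (by linarith [one_le_bracket x])

theorem weight_mul_bracket_rpow (β γ x : ℝ) : weight β x * bracket x ^ γ = weight (β - γ) x := by
  unfold weight
  rw [← Real.rpow_add (by linarith [one_le_bracket x])]
  ring_nf

theorem integrable_weight {γ : ℝ} (hγ : 1 < γ) : Integrable (weight γ) := by
  have h := integrable_rpow_neg_one_add_norm_sq (E := ℝ) (μ := volume) (r := γ) (by simpa using hγ)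
  refine h.congr (Eventually.of_forall fun x => ?_)
  simp only [weight, bracket, Real.norm_eq_abs]
  rw [Real.sqrt_eq_rpow, ← Real.rpow_mul (by positivity)]
  congr 1; ring

/-- The kernel of the weighted resolvent. -/
noncomputable def weightedKernel (β : ℝ) (G : ℝ → ℝ → ℂ) (x y : ℝ) : ℂ :=
  (weight β x : ℂ) * G x y * (weight β y : ℂ)

theorem stronglyMeasurable_weightedKernel (β : ℝ) {G : ℝ → ℝ → ℂ}
    (hG : StronglyMeasurable (Function.uncurry G)) :
    StronglyMeasurable (Function.uncurry (weightedKernel β G)) := by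
  have h1 : Continuous fun q : ℝ × ℝ => (weight β q.1 : ℂ) :=
    Complex.continuous_ofReal.comp ((continuous_weight β).comp continuous_fst)
  have h2 : Continuous fun q : ℝ × ℝ => (weight β q.2 : ℂ) :=
    Complex.continuous_ofReal.comp ((continuous_weight β).comp continuous_snd)
  exact (h1.stronglyMeasurable.mul hG).mul h2.stronglyMeasurable

theorem norm_weightedKernel (β : ℝ) (G : ℝ → ℝ → ℂ) (x y : ℝ) :
    ‖weightedKernel β G x y‖ = weight β x * ‖G x y‖ * weight β y := by
  unfold weightedKernel
  rw [norm_mul, norm_mul, Complex.norm_real, Complex.norm_real, Real.norm_of_nonneg (weight_pos β x).le,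
    Real.norm_of_nonneg (weight_pos β y).le]

/-- The asymmetry comes from `L^∞`: growth in `x` need only be dominated by the left weight, while
after growth in `y` the remaining weight must still be integrable. -/
theorem norm_weightedKernel_le_of_le_mul {β a b D : ℝ} (hD : 0 ≤ D) (ha : a ≤ β) {G : ℝ → ℝ → ℂ}
    (hG : ∀ x y, ‖G x y‖ ≤ D * (bracket x ^ a * bracket y ^ b)) (x y : ℝ) :
    ‖weightedKernel β G x y‖ ≤ D * weight (β - b) y := by
  rw [norm_weightedKernel]
  have h1 := weight_pos β x
  have h2 := weight_pos β y
  have h3 := weight_pos (β - b) y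
  calc _ ≤ weight β x * (D * (bracket x ^ a * bracket y ^ b)) * weight β y := by
        gcongr; exact hG x y
    _ = D * (weight (β - a) x * weight (β - b) y) := by
        rw [← weight_mul_bracket_rpow, ← weight_mul_bracket_rpow]; ring
    _ ≤ D * (1 * weight (β - b) y) := by
        gcongr
        exact weight_le_one (by linarith) x
    _ = _ := by ring

/-! ### Cauchy estimates for the Green function -/

/-- Interpolation by `min 1 t ≤ t ^ θ`. A Lipschitz bound in `k` costs a full extra power of `1 +
|x| + |y|`, more than the weights can spare; a small power is affordable. -/
theorem le_mul_rpow_of_le {q D t θ : ℝ} (hD : 0 ≤ D) (hθ : 0 < θ) (hθ1 : θ ≤ 1) (ht : 0 ≤ t)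
    (h1 : q ≤ D) (h2 : q ≤ D * t) : q ≤ D * t ^ θ := by
  rcases le_total t 1 with h | h
  · rcases ht.eq_or_lt with rfl | h0
    · simpa [Real.zero_rpow hθ.ne'] using h2
    · refine h2.trans (mul_le_mul_of_nonneg_left ?_ hD)
      simpa using Real.rpow_le_rpow_of_exponent_ge h0 h hθ1
  · refine h1.trans (le_mul_of_one_le_right hD (Real.one_le_rpow h hθ.le))

section

variable {G : ℂ → ℝ → ℝ → ℂ} {δ C : ℝ}

theorem closedBall_subset_upperStrip {r s : ℝ} (hrs : r < s) {k : ℂ} (hk : 0 ≤ k.im) :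
    Metric.closedBall k r ⊆ upperStrip s := fun z hz => by
  rw [Metric.mem_closedBall, dist_eq_norm] at hz
  have h1 := Complex.abs_im_le_norm (z - k)
  rw [Complex.sub_im] at h1
  change -s < z.im
  linarith [neg_abs_le (z.im - k.im)]

/-- Cauchy's estimate with half the width of the strip as radius: a derivative in `k` costs one
factor `1 + |x| + |y|`. -/
theorem norm_deriv_green_le (hG : GreenKernel G δ C) (x y : ℝ) {k : ℂ} (hk : 0 ≤ k.im) :
    ‖deriv (fun k => G k x y) k‖ ≤ 2 * C / δ * (1 + |x|) * (1 + |x| + |y|) := by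
  have hδ := hG.delta_pos
  have hL : 0 < 1 + |x| + |y| := by positivity
  set r := δ / (1 + |x| + |y|) with hr
  have hr0 : 0 < r := by positivity
  have hsub := closedBall_subset_upperStrip (half_lt_self hr0) hk
  have := Complex.norm_deriv_le_of_forall_mem_sphere_norm_le (half_pos hr0)
    (((hG.diff x y).mono hsub).diffContOnCl_ball subset_rfl)
    fun z hz => hG.bound x y z (hsub (Metric.sphere_subset_closedBall hz))
  refine this.trans (le_of_eq ?_)
  rw [hr]; field_simp

/-- The factor `‖k‖` saves one power of the weight. If `‖k‖ ≥ r`, the disc of radius `r / 2` stays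
where `‖z‖ ≥ ‖k‖ / 2`, so `|G| ≤ 2C / ‖k‖` on it. If `‖k‖ ≤ r`, the factor cancels the `1 + |x| +
|y|` of `norm_deriv_green_le`. -/
theorem norm_mul_norm_deriv_green_le (hG : GreenKernel G δ C) (x y : ℝ) {k : ℂ} (hk : 0 ≤ k.im) :
    ‖k‖ * ‖deriv (fun k => G k x y) k‖ ≤ (4 * C / δ + 2 * C) * (1 + |x| + |y|) := by
  have hδ := hG.delta_pos
  have hC := hG.const_nonneg
  have hL : 0 < 1 + |x| + |y| := by positivity
  set r := δ / (1 + |x| + |y|) with hr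
  have hr0 : 0 < r := by positivity
  rcases le_total r ‖k‖ with h | h
  · have hsub := closedBall_subset_upperStrip (half_lt_self hr0) hk
    have hk0 : 0 < ‖k‖ := hr0.trans_le h
    have := Complex.norm_deriv_le_of_forall_mem_sphere_norm_le (C := 2 * C / ‖k‖) (half_pos hr0)
      (((hG.diff x y).mono hsub).diffContOnCl_ball subset_rfl)
      fun z hz => by
        have h1 := hG.bound_mul x y z (hsub (Metric.sphere_subset_closedBall hz))
        have h2 : ‖k‖ / 2 ≤ ‖z‖ := by
          rw [mem_sphere_iff_norm] at hz
          have := norm_sub_norm_le k (k - z)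
          rw [sub_sub_cancel, norm_sub_rev, hz] at this
          linarith
        rw [le_div_iff₀ hk0]
        nlinarith [norm_nonneg (G z x y)]
    calc _ ≤ ‖k‖ * (2 * C / ‖k‖ / (r / 2)) := by gcongr
      _ = 4 * C / δ * (1 + |x| + |y|) := by rw [hr]; field_simp; ring
      _ ≤ _ := by gcongr; linarith
  · calc _ ≤ r * (2 * C / δ * (1 + |x|) * (1 + |x| + |y|)) := by
          gcongr; exact norm_deriv_green_le hG x y hk
      _ = 2 * C * (1 + |x|) := by rw [hr]; field_simp
      _ ≤ 2 * C * (1 + |x| + |y|) :=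
          mul_le_mul_of_nonneg_left (by linarith [abs_nonneg y]) (by positivity)
      _ ≤ _ := by
          gcongr
          have : 0 ≤ 4 * C / δ := by positivity
          linarith

theorem differentiableAt_green (hG : GreenKernel G δ C) (x y : ℝ) {k : ℂ} (hk : 0 ≤ k.im) :
    DifferentiableAt ℂ (fun k => G k x y) k := by
  have hδ := hG.delta_pos
  exact (hG.diff x y).differentiableAt
    ((isOpen_upperStrip _).mem_nhds (mem_upperStrip_of_nonneg (by positivity) hk))

theorem convex_closedHalfPlane : Convex ℝ {k : ℂ | 0 ≤ k.im} :=
  convex_halfSpace_im_ge 0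

theorem norm_green_sub_le (hG : GreenKernel G δ C) {θ : ℝ} (hθ : 0 < θ) (hθ1 : θ ≤ 1) (x y : ℝ)
    {k k₀ : ℂ} (hk : 0 ≤ k.im) (hk₀ : 0 ≤ k₀.im) :
    ‖G k x y - G k₀ x y‖ ≤ (2 * C + 2 * C / δ) * (1 + |x|) * ((1 + |x| + |y|) * ‖k - k₀‖) ^ θ := by
  have hδ := hG.delta_pos
  have hC := hG.const_nonneg
  have h0 : 0 ≤ 2 * C / δ := by positivity
  refine le_mul_rpow_of_le (by positivity) hθ hθ1 (by positivity) ?_ ?_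
  · have h1 := hG.bound x y k (mem_upperStrip_of_nonneg (by positivity) hk)
    have h2 := hG.bound x y k₀ (mem_upperStrip_of_nonneg (by positivity) hk₀)
    have h3 := norm_sub_le (G k x y) (G k₀ x y)
    have h4 : 0 ≤ 2 * C / δ * (1 + |x|) := by positivity
    linarith
  · have := convex_closedHalfPlane.norm_image_sub_le_of_norm_deriv_le
      (fun z hz => differentiableAt_green hG x y hz)
      (fun z hz => norm_deriv_green_le hG x y hz) hk₀ hk
    refine this.trans ?_
    rw [← mul_assoc]
    gcongr
    linarith

/-- Cauchy's estimate of second order. The radius is chosen so that the disc stays both in the strip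
and in `‖z‖ ≥ ρ / 2`, where `|G| ≤ 2C / ρ`. -/
theorem norm_deriv_deriv_green_le (hG : GreenKernel G δ C) {ρ : ℝ} (hρ : 0 < ρ) (x y : ℝ) {k : ℂ}
    (hk : 0 ≤ k.im) (hkρ : ρ ≤ ‖k‖) :
    ‖deriv (deriv fun k => G k x y) k‖ ≤ 16 * C / (ρ * min δ ρ ^ 2) * (1 + |x| + |y|) ^ 2 := by
  have hδ := hG.delta_pos
  have hC := hG.const_nonneg
  have hL : 0 < 1 + |x| + |y| := by positivity
  have hm : 0 < min δ ρ := lt_min hδ hρ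
  set r := min δ ρ / (2 * (1 + |x| + |y|)) with hr
  have hr0 : 0 < r := by positivity
  have hr1 : r < δ / (1 + |x| + |y|) := by
    rw [hr, div_lt_div_iff₀ (by positivity) hL]
    nlinarith [min_le_left δ ρ]
  have hr2 : r ≤ ρ / 2 := by
    rw [hr, div_le_div_iff₀ (by positivity) two_pos]
    nlinarith [min_le_right δ ρ, abs_nonneg x, abs_nonneg y]
  have hsub := closedBall_subset_upperStrip hr1 hk
  have := Complex.norm_iteratedDeriv_le_of_forall_mem_sphere_norm_le (C := 2 * C / ρ) 2 hr0
    (((hG.diff x y).mono hsub).diffContOnCl_ball subset_rfl)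
    fun z hz => by
      have h1 := hG.bound_mul x y z (hsub (Metric.sphere_subset_closedBall hz))
      have h2 : ρ / 2 ≤ ‖z‖ := by
        rw [mem_sphere_iff_norm] at hz
        have := norm_sub_norm_le k (k - z)
        rw [sub_sub_cancel, norm_sub_rev, hz] at this
        linarith
      rw [le_div_iff₀ hρ]
      nlinarith [norm_nonneg (G z x y)]
  rw [iteratedDeriv_succ, iteratedDeriv_one] at this
  refine this.trans (le_of_eq ?_)
  rw [hr]
  norm_num [Nat.factorial]
  field_simp
  ring

/-- The mean value inequality is applied to `G(z) - z G'(k₀)` on a half-plane section of a disc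
avoiding `0`. The difference `G'(z) - G'(k₀)` is `θ`-Hölder by interpolation between the bounds on
`G'` and `G''`, at a cost of only `1 + θ` powers of the weight. -/
theorem norm_green_taylor_le (hG : GreenKernel G δ C) {k₀ : ℂ} (hk₀ : 0 ≤ k₀.im) (hne : k₀ ≠ 0)
    {θ : ℝ} (hθ : 0 < θ) (hθ1 : θ ≤ 1) :
    ∃ D, 0 ≤ D ∧ ∀ x y (k : ℂ), 0 ≤ k.im → ‖k - k₀‖ ≤ ‖k₀‖ / 2 →
      ‖G k x y - G k₀ x y - (k - k₀) * deriv (fun k => G k x y) k₀‖ ≤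
        D * ((1 + |x| + |y|) * ((1 + |x| + |y|) * ‖k - k₀‖) ^ θ) * ‖k - k₀‖ := by
  have hδ := hG.delta_pos
  have hC := hG.const_nonneg
  have hn : 0 < ‖k₀‖ := norm_pos_iff.2 hne
  set ρ := ‖k₀‖ / 2 with hρ
  have hρ0 : 0 < ρ := by positivity
  have hm : 0 < min δ ρ := lt_min hδ hρ0
  set D₁ := (4 * C / δ + 2 * C) / ρ with hD₁
  set D₂ := 16 * C / (ρ * min δ ρ ^ 2) with hD₂
  have hD₁0 : 0 ≤ D₁ := by positivity
  have hD₂0 : 0 ≤ D₂ := by positivity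
  refine ⟨2 * D₁ + D₂, by positivity, fun x y k hk hkk => ?_⟩
  have hL : 0 < 1 + |x| + |y| := by positivity
  set S := Metric.closedBall k₀ ‖k - k₀‖ ∩ {k : ℂ | 0 ≤ k.im} with hS
  have hSc : Convex ℝ S := (convex_closedBall _ _).inter convex_closedHalfPlane
  have hk₀S : k₀ ∈ S := ⟨Metric.mem_closedBall_self (norm_nonneg _), hk₀⟩
  have hkS : k ∈ S := ⟨by rw [Metric.mem_closedBall, dist_eq_norm], hk⟩
  have hSρ : ∀ z ∈ S, ρ ≤ ‖z‖ := fun z hz => by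
    have h1 := hz.1
    rw [Metric.mem_closedBall, dist_eq_norm] at h1
    have := norm_sub_norm_le k₀ (k₀ - z)
    rw [sub_sub_cancel, norm_sub_rev k₀ z] at this
    linarith
  have hd2 : ∀ z ∈ S, DifferentiableAt ℂ (deriv fun k => G k x y) z := fun z hz =>
    ((hG.diff x y).deriv (isOpen_upperStrip _)).differentiableAt
      ((isOpen_upperStrip _).mem_nhds (mem_upperStrip_of_nonneg (by positivity) hz.2))
  have hd1 : ∀ z ∈ S, ‖deriv (fun k => G k x y) z‖ ≤ D₁ * (1 + |x| + |y|) := fun z hz => by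
    have h1 := norm_mul_norm_deriv_green_le hG x y hz.2
    have h2 := hSρ z hz
    rw [hD₁, div_mul_eq_mul_div, le_div_iff₀ hρ0]
    nlinarith [norm_nonneg (deriv (fun k => G k x y) z)]
  have hlip : ∀ z ∈ S, ‖deriv (fun k => G k x y) z - deriv (fun k => G k x y) k₀‖ ≤
      (2 * D₁ + D₂) * (1 + |x| + |y|) * ((1 + |x| + |y|) * ‖k - k₀‖) ^ θ := fun z hz => by
    refine le_mul_rpow_of_le (by positivity) hθ hθ1 (by positivity) ?_ ?_
    · have h1 := norm_sub_le (deriv (fun k => G k x y) z) (deriv (fun k => G k x y) k₀)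
      have h2 := hd1 z hz
      have h3 := hd1 k₀ hk₀S
      nlinarith
    · have h1 := hSc.norm_image_sub_le_of_norm_deriv_le hd2
        (fun w hw => norm_deriv_deriv_green_le hG hρ0 x y hw.2 (hSρ w hw)) hk₀S hz
      have h2 : ‖z - k₀‖ ≤ ‖k - k₀‖ := by
        have := hz.1
        rwa [Metric.mem_closedBall, dist_eq_norm] at this
      calc _ ≤ D₂ * (1 + |x| + |y|) ^ 2 * ‖z - k₀‖ := h1
        _ ≤ D₂ * (1 + |x| + |y|) ^ 2 * ‖k - k₀‖ := by gcongr
        _ = D₂ * (1 + |x| + |y|) * ((1 + |x| + |y|) * ‖k - k₀‖) := by ring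
        _ ≤ _ := by gcongr; linarith
  have hfin := hSc.norm_image_sub_le_of_norm_hasDerivWithin_le
    (f := fun z => G z x y - z * deriv (fun k => G k x y) k₀)
    (f' := fun z => deriv (fun k => G k x y) z - deriv (fun k => G k x y) k₀)
    (fun z hz => by
      have h1 := (differentiableAt_green hG x y hz.2).hasDerivAt
      have h2 := (hasDerivAt_id z).mul_const (deriv (fun k => G k x y) k₀)
      rw [one_mul] at h2
      exact (h1.sub h2).hasDerivWithinAt) hlip hk₀S hkS
  calc _ = ‖(G k x y - k * deriv (fun k => G k x y) k₀) -
        (G k₀ x y - k₀ * deriv (fun k => G k x y) k₀)‖ := by congr 1; ring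
    _ ≤ _ := hfin
    _ = _ := by ring

/-- Slopes with real increments stay in the closed half-plane, where `G` is jointly continuous in
`x` and `y`. -/
theorem stronglyMeasurable_deriv_green (hG : GreenKernel G δ C) {k : ℂ} (hk : 0 ≤ k.im) :
    StronglyMeasurable (Function.uncurry fun x y => deriv (fun k => G k x y) k) := by
  have hu : Tendsto (fun n : ℕ => k + ((1 / ((n : ℝ) + 1) : ℝ) : ℂ)) atTop (𝓝[≠] k) := by
    refine tendsto_nhdsWithin_iff.2 ⟨?_, Eventually.of_forall fun n => ?_⟩
    · have h2 := (Complex.continuous_ofReal.tendsto 0).comp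
        (tendsto_one_div_add_atTop_nhds_zero_nat (𝕜 := ℝ))
      simpa using h2.const_add k
    · have : (1 / ((n : ℝ) + 1) : ℝ) ≠ 0 := by positivity
      simpa only [Set.mem_compl_iff, Set.mem_singleton_iff, add_eq_left, Complex.ofReal_eq_zero]
        using this
  refine stronglyMeasurable_of_tendsto atTop
    (f := fun (n : ℕ) (q : ℝ × ℝ) =>
      slope (fun k => G k q.1 q.2) k (k + ((1 / ((n : ℝ) + 1) : ℝ) : ℂ))) (fun n => ?_) ?_
  · have h1 : Continuous fun q : ℝ × ℝ => G (k + ((1 / ((n : ℝ) + 1) : ℝ) : ℂ)) q.1 q.2 :=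
      hG.cont _ (by rw [Complex.add_im, Complex.ofReal_im, add_zero]; exact hk)
    have h2 : Continuous fun q : ℝ × ℝ => G k q.1 q.2 := hG.cont k hk
    have h3 : Continuous fun q : ℝ × ℝ => (k + ((1 / ((n : ℝ) + 1) : ℝ) : ℂ) - k)⁻¹ •
        (G (k + ((1 / ((n : ℝ) + 1) : ℝ) : ℂ)) q.1 q.2 - G k q.1 q.2) :=
      Continuous.const_smul (h1.sub h2) (k + ((1 / ((n : ℝ) + 1) : ℝ) : ℂ) - k)⁻¹
    simpa only [slope_def_module] using h3.stronglyMeasurable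
  · refine tendsto_pi_nhds.2 fun q => ?_
    exact (hasDerivAt_iff_tendsto_slope.1
      (differentiableAt_green hG q.1 q.2 hk).hasDerivAt).comp hu

/-! ### From kernel estimates to norm continuity and differentiability -/

theorem one_add_abs_add_abs_le (x y : ℝ) : 1 + |x| + |y| ≤ 4 * (bracket x * bracket y) := by
  have h1 := one_add_abs_le_bracket x
  have h2 := one_add_abs_le_bracket y
  calc 1 + |x| + |y| ≤ (1 + |x|) * (1 + |y|) := by nlinarith [mul_nonneg (abs_nonneg x) (abs_nonneg y)]
    _ ≤ (2 * bracket x) * (2 * bracket y) := by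
        have := one_le_bracket x
        gcongr
    _ = _ := by ring

theorem rpow_one_add_abs_add_abs_le {θ : ℝ} (hθ : 0 < θ) (hθ1 : θ ≤ 1) (x y : ℝ) {t : ℝ}
    (ht : 0 ≤ t) :
    ((1 + |x| + |y|) * t) ^ θ ≤ 4 * (bracket x ^ θ * bracket y ^ θ) * t ^ θ := by
  have hx := one_le_bracket x
  have hy := one_le_bracket y
  calc ((1 + |x| + |y|) * t) ^ θ ≤ (4 * (bracket x * bracket y) * t) ^ θ := by
        gcongr; exact one_add_abs_add_abs_le x y
    _ = 4 ^ θ * (bracket x ^ θ * bracket y ^ θ) * t ^ θ := by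
        rw [Real.mul_rpow (by positivity) ht, Real.mul_rpow (by positivity) (by positivity),
          Real.mul_rpow (by positivity) (by positivity)]
    _ ≤ _ := by
        have : (4 : ℝ) ^ θ ≤ 4 := by
          simpa using Real.rpow_le_rpow_of_exponent_le (by norm_num : (1 : ℝ) ≤ 4) hθ1
        gcongr

/-- The weighted Green operators exist, are uniformly bounded, and are norm-continuous up to the
real axis. -/
theorem exists_weighted_operator (hG : GreenKernel G δ C) {β : ℝ} (hβ : 1 < β) :
    ∃ (A : ℂ → Linfty →L[ℂ] Linfty) (B : ℝ),
      (∀ k : ℂ, 0 ≤ k.im → HasKernel (A k) (weightedKernel β (G k))) ∧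
      (∀ k : ℂ, 0 ≤ k.im → ‖A k‖ ≤ B) ∧
      ContinuousOn A {k | 0 ≤ k.im} := by
  have hδ := hG.delta_pos
  have hC := hG.const_nonneg
  have hmeas : ∀ k : ℂ, 0 ≤ k.im → StronglyMeasurable (Function.uncurry (weightedKernel β (G k))) :=
    fun k hk => stronglyMeasurable_weightedKernel β (hG.cont k hk).stronglyMeasurable
  have hb : ∀ k : ℂ, 0 ≤ k.im → ∀ x y, ‖weightedKernel β (G k) x y‖ ≤ (2 * C) * weight β y :=
    fun k hk x y => by
      have := norm_weightedKernel_le_of_le_mul (β := β) (a := 1) (b := 0) (D := 2 * C)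
        (G := G k) (by positivity) hβ.le (fun x y => ?_) x y
      · simpa using this
      · rw [Real.rpow_one, Real.rpow_zero, mul_one]
        refine (hG.bound x y k (mem_upperStrip_of_nonneg (by positivity) hk)).trans ?_
        have := one_add_abs_le_bracket x
        calc C * (1 + |x|) ≤ C * (2 * bracket x) := by gcongr
          _ = _ := by ring
  have hp := integrable_weight hβ
  have hex : ∀ k : ℂ, ∃ A, 0 ≤ k.im → HasKernel A (weightedKernel β (G k)) := fun k => by
    by_cases hk : 0 ≤ k.im
    · obtain ⟨A, hA⟩ := exists_hasKernel (hmeas k hk) (hb k hk) hp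
      exact ⟨A, fun _ => hA⟩
    · exact ⟨0, fun h => absurd h hk⟩
  choose A hA using hex
  refine ⟨A, _, hA, fun k hk => (hA k hk).norm_le (hb k hk) hp, fun k₀ hk₀ => ?_⟩
  -- Chosen so that `1 + θ ≤ β`, for the growth in `x`, and `β - θ > 1`, for integrability in `y`.
  set θ := min 1 ((β - 1) / 2) with hθdef
  have hθ : 0 < θ := lt_min one_pos (by linarith)
  have hθ1 : θ ≤ 1 := min_le_left _ _
  have hθ2 : θ ≤ (β - 1) / 2 := min_le_right _ _
  set D := (2 * C + 2 * C / δ) * 2 * 4 with hD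
  have hD0 : 0 ≤ D := by positivity
  have hest : ∀ k : ℂ, 0 ≤ k.im → ‖A k - A k₀‖ ≤ D * ‖k - k₀‖ ^ θ * ∫ y, weight (β - θ) y :=
    fun k hk => by
      refine ((hA k hk).sub (hA k₀ hk₀) (hmeas k hk) (hb k hk) hp (hmeas k₀ hk₀) (hb k₀ hk₀)
        hp).norm_le (fun x y => ?_) (integrable_weight (by linarith))
      have e : weightedKernel β (G k) x y - weightedKernel β (G k₀) x y =
          weightedKernel β (fun x y => G k x y - G k₀ x y) x y := by
        unfold weightedKernel; ring
      rw [e]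
      refine norm_weightedKernel_le_of_le_mul (a := 1 + θ) (by positivity) (by linarith)
        (fun x y => ?_) x y
      have hx := one_le_bracket x
      have hy := one_le_bracket y
      calc _ ≤ (2 * C + 2 * C / δ) * (1 + |x|) * ((1 + |x| + |y|) * ‖k - k₀‖) ^ θ :=
            norm_green_sub_le hG hθ hθ1 x y hk hk₀
        _ ≤ (2 * C + 2 * C / δ) * (2 * bracket x) *
            (4 * (bracket x ^ θ * bracket y ^ θ) * ‖k - k₀‖ ^ θ) := by
            have h1 := rpow_one_add_abs_add_abs_le hθ hθ1 x y (norm_nonneg (k - k₀))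
            have h2 := one_add_abs_le_bracket x
            gcongr
        _ = _ := by
            rw [Real.rpow_add (by linarith), Real.rpow_one, hD]; ring
  refine tendsto_iff_norm_sub_tendsto_zero.2 ?_
  refine squeeze_zero' (Eventually.of_forall fun _ => norm_nonneg _)
    (eventually_mem_nhdsWithin.mono fun k hk => hest k hk) ?_
  have hcont : Continuous fun k : ℂ => D * ‖k - k₀‖ ^ θ * ∫ y, weight (β - θ) y := by
    refine (continuous_const.mul ?_).mul continuous_const
    exact (continuous_norm.comp (continuous_id.sub continuous_const)).rpow_const
      fun _ => Or.inr hθ.le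
  have := (hcont.tendsto k₀).mono_left (nhdsWithin_le_nhds (s := {k : ℂ | 0 ≤ k.im}))
  simpa [Real.zero_rpow hθ.ne'] using this

/-- With one more power of the weight, the Green operators are differentiable in `k` away from the
threshold, with derivative `O(1/|k|)`. -/
theorem weighted_operator_hasDerivWithinAt (hG : GreenKernel G δ C) {α : ℝ} (hα : 1 < α)
    {A : ℂ → Linfty →L[ℂ] Linfty}
    (hA : ∀ k : ℂ, 0 ≤ k.im → HasKernel (A k) (weightedKernel (α + 1) (G k))) :
    ∃ B : ℝ, ∀ k₀ : ℂ, 0 ≤ k₀.im → k₀ ≠ 0 → ∃ A', HasDerivWithinAt A A' {k | 0 ≤ k.im} k₀ ∧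
      ‖k₀‖ * ‖A'‖ ≤ B := by
  have hδ := hG.delta_pos
  have hC := hG.const_nonneg
  set C₁ := 4 * C / δ + 2 * C with hC₁
  have hC₁0 : 0 ≤ C₁ := by positivity
  have hmeas : ∀ k : ℂ, 0 ≤ k.im →
      StronglyMeasurable (Function.uncurry (weightedKernel (α + 1) (G k))) :=
    fun k hk => stronglyMeasurable_weightedKernel _ (hG.cont k hk).stronglyMeasurable
  have hb : ∀ k : ℂ, 0 ≤ k.im → ∀ x y,
      ‖weightedKernel (α + 1) (G k) x y‖ ≤ (2 * C) * weight (α + 1) y :=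
    fun k hk x y => by
      have := norm_weightedKernel_le_of_le_mul (β := α + 1) (a := 1) (b := 0) (D := 2 * C)
        (G := G k) (by positivity) (by linarith) (fun x y => ?_) x y
      · simpa using this
      · rw [Real.rpow_one, Real.rpow_zero, mul_one]
        refine (hG.bound x y k (mem_upperStrip_of_nonneg (by positivity) hk)).trans ?_
        have := one_add_abs_le_bracket x
        calc C * (1 + |x|) ≤ C * (2 * bracket x) := by gcongr
          _ = _ := by ring
  have hp : Integrable (weight (α + 1)) := integrable_weight (by linarith)
  have hpα := integrable_weight hα
  refine ⟨4 * C₁ * ∫ y, weight α y, fun k₀ hk₀ hne => ?_⟩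
  have hn : 0 < ‖k₀‖ := norm_pos_iff.2 hne
  set G' : ℝ → ℝ → ℂ := fun x y => deriv (fun k => G k x y) k₀ with hG'
  have hmeas' : StronglyMeasurable (Function.uncurry (weightedKernel (α + 1) G')) :=
    stronglyMeasurable_weightedKernel _ (stronglyMeasurable_deriv_green hG hk₀)
  have hb' : ∀ x y, ‖weightedKernel (α + 1) G' x y‖ ≤ (4 * C₁ / ‖k₀‖) * weight α y := fun x y => by
    have := norm_weightedKernel_le_of_le_mul (β := α + 1) (a := 1) (b := 1) (D := 4 * C₁ / ‖k₀‖)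
      (G := G') (by positivity) (by linarith) (fun x y => ?_) x y
    · simpa using this
    · rw [Real.rpow_one, Real.rpow_one, div_mul_eq_mul_div, le_div_iff₀ hn, mul_comm]
      refine (norm_mul_norm_deriv_green_le hG x y hk₀).trans ?_
      calc C₁ * (1 + |x| + |y|) ≤ C₁ * (4 * (bracket x * bracket y)) := by
            gcongr; exact one_add_abs_add_abs_le x y
        _ = _ := by ring
  obtain ⟨A', hA'⟩ := exists_hasKernel hmeas' hb' hpα
  refine ⟨A', ?_, ?_⟩
  -- The Taylor remainder costs `1 + θ` powers in each variable; from `α + 1` this leaves the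
  -- integrable weight of exponent `α - θ > 1` in `y`.
  · set θ := min 1 ((α - 1) / 2) with hθdef
    have hθ : 0 < θ := lt_min one_pos (by linarith)
    have hθ1 : θ ≤ 1 := min_le_left _ _
    have hθ2 : θ ≤ (α - 1) / 2 := min_le_right _ _
    obtain ⟨D, hD0, hD⟩ := norm_green_taylor_le hG hk₀ hne hθ hθ1
    set J := ∫ y, weight (α - θ) y with hJ
    have hest : ∀ k : ℂ, 0 ≤ k.im → ‖k - k₀‖ ≤ ‖k₀‖ / 2 →
        ‖A k - A k₀ - (k - k₀) • A'‖ ≤ D * 16 * J * ‖k - k₀‖ ^ θ * ‖k - k₀‖ := fun k hk hkk => by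
      have hsub := (hA k hk).sub (hA k₀ hk₀) (hmeas k hk) (hb k hk) hp (hmeas k₀ hk₀) (hb k₀ hk₀) hp
      have hK := hsub.sub (hA'.smul (k - k₀)) ((hmeas k hk).sub (hmeas k₀ hk₀))
        (D := 2 * C + 2 * C) (p := weight (α + 1)) (fun x y => by
          rw [add_mul]
          exact (norm_sub_le _ _).trans (add_le_add (hb k hk x y) (hb k₀ hk₀ x y)))
        hp (hmeas'.const_mul (k - k₀)) (D' := ‖k - k₀‖ * (4 * C₁ / ‖k₀‖)) (p' := weight α)
        (fun x y => by rw [norm_mul, mul_assoc]; gcongr; exact hb' x y) hpα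
      have := hK.norm_le (D := D * 16 * ‖k - k₀‖ ^ θ * ‖k - k₀‖) (p := weight (α - θ))
        (fun x y => ?_) (integrable_weight (by linarith))
      · refine this.trans (le_of_eq ?_)
        rw [hJ]; ring
      have e : weightedKernel (α + 1) (G k) x y - weightedKernel (α + 1) (G k₀) x y -
          (k - k₀) * weightedKernel (α + 1) G' x y =
          weightedKernel (α + 1) (fun x y => G k x y - G k₀ x y - (k - k₀) * G' x y) x y := by
        unfold weightedKernel; ring
      rw [e, show α - θ = α + 1 - (1 + θ) by ring]
      refine norm_weightedKernel_le_of_le_mul (a := 1 + θ) (by positivity) (by linarith)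
        (fun x y => ?_) x y
      have hx := one_le_bracket x
      have hy := one_le_bracket y
      calc _ ≤ D * ((1 + |x| + |y|) * ((1 + |x| + |y|) * ‖k - k₀‖) ^ θ) * ‖k - k₀‖ :=
            hD x y k hk hkk
        _ ≤ D * ((4 * (bracket x * bracket y)) *
            (4 * (bracket x ^ θ * bracket y ^ θ) * ‖k - k₀‖ ^ θ)) * ‖k - k₀‖ := by
            have h1 := rpow_one_add_abs_add_abs_le hθ hθ1 x y (norm_nonneg (k - k₀))
            have h2 := one_add_abs_add_abs_le x y
            gcongr
        _ = _ := by
            rw [Real.rpow_add (by linarith), Real.rpow_add (by linarith), Real.rpow_one,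
              Real.rpow_one]; ring
    rw [hasDerivWithinAt_iff_isLittleO, Asymptotics.isLittleO_iff]
    intro c hc
    have hcont : Continuous fun k : ℂ => D * 16 * J * ‖k - k₀‖ ^ θ := by
      refine continuous_const.mul ?_
      exact (continuous_norm.comp (continuous_id.sub continuous_const)).rpow_const
        fun _ => Or.inr hθ.le
    have h1 : ∀ᶠ k in 𝓝 k₀, D * 16 * J * ‖k - k₀‖ ^ θ < c := by
      refine hcont.continuousAt.eventually_lt continuousAt_const ?_
      simpa [Real.zero_rpow hθ.ne'] using hc
    have h2 : ∀ᶠ k in 𝓝 k₀, ‖k - k₀‖ < ‖k₀‖ / 2 := by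
      have : Continuous fun k : ℂ => ‖k - k₀‖ := by fun_prop
      refine this.continuousAt.eventually_lt continuousAt_const ?_
      simpa using hn
    filter_upwards [nhdsWithin_le_nhds h1, nhdsWithin_le_nhds h2, self_mem_nhdsWithin] with k a1 a2 a3
    exact (hest k a3 a2.le).trans (by gcongr)
  · have := hA'.norm_le hb' hpα
    calc ‖k₀‖ * ‖A'‖ ≤ ‖k₀‖ * (4 * C₁ / ‖k₀‖ * ∫ y, weight α y) := by gcongr
      _ = _ := by field_simp

end

end Schrodinger

/-! ### The Green operator is the resolvent on `L²` -/

namespace Schrodinger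

/-! ### Schur's test for exponentially decaying kernels on `L²` -/

/-- The exponential kernel `e^{-κ|x-y|}` with values in `[0, ∞]`. -/
noncomputable def expKernel (κ x y : ℝ) : ℝ≥0∞ := ENNReal.ofReal (Real.exp (-(κ * |x - y|)))

theorem measurable_expKernel (κ : ℝ) : Measurable (Function.uncurry (expKernel κ)) := by
  have : Continuous fun q : ℝ × ℝ => Real.exp (-(κ * |q.1 - q.2|)) := by fun_prop
  exact ENNReal.measurable_ofReal.comp this.measurable

/-- The total mass of the exponential kernel. -/
noncomputable def expMass (κ : ℝ) : ℝ≥0∞ := ∫⁻ y, ENNReal.ofReal (Real.exp (-(κ * |y|)))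

theorem expMass_lt_top {κ : ℝ} (hκ : 0 < κ) : expMass κ < ⊤ := by
  have h := (integrable_exp_neg_mul_abs hκ).lintegral_lt_top
  exact h

theorem lintegral_expKernel_left (κ y : ℝ) : ∫⁻ x, expKernel κ x y = expMass κ :=
  lintegral_sub_right_eq_self (fun x => ENNReal.ofReal (Real.exp (-(κ * |x|)))) y

theorem lintegral_expKernel_right (κ x : ℝ) : ∫⁻ y, expKernel κ x y = expMass κ := by
  rw [← lintegral_expKernel_left κ x]
  simp only [expKernel, abs_sub_comm]

theorem expKernel_eq_sq (κ x y : ℝ) : expKernel κ x y = expKernel (κ / 2) x y * expKernel (κ / 2) x y := by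
  unfold expKernel
  rw [← ENNReal.ofReal_mul (Real.exp_pos _).le, ← Real.exp_add]
  congr 2; ring

/-- Cauchy–Schwarz with the kernel split into two factors `e^{-κ|x-y|/2}`, followed by Tonelli; all
rows and columns have the same mass. -/
theorem lintegral_expKernel_mul_sq_le (κ : ℝ) {h : ℝ → ℝ≥0∞} (hh : Measurable h) :
    ∫⁻ x, (∫⁻ y, expKernel κ x y * h y) ^ (2 : ℝ) ≤
      expMass κ ^ (2 : ℝ) * ∫⁻ y, h y ^ (2 : ℝ) := by
  have hm : ∀ κ x, Measurable (expKernel κ x) := fun κ x =>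
    (measurable_expKernel κ).comp measurable_prodMk_left
  have h1 : ∀ x, (∫⁻ y, expKernel κ x y * h y) ^ (2 : ℝ) ≤
      expMass κ * ∫⁻ y, expKernel κ x y * h y ^ (2 : ℝ) := fun x => by
    have hcs := ENNReal.lintegral_mul_le_Lp_mul_Lq volume Real.HolderConjugate.two_two
      (f := expKernel (κ / 2) x) (g := fun y => expKernel (κ / 2) x y * h y)
      (hm _ x).aemeasurable ((hm _ x).mul hh).aemeasurable
    have e0 : ∀ y, (expKernel (κ / 2) x * fun y => expKernel (κ / 2) x y * h y) y =
        expKernel κ x y * h y := fun y => by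
      rw [expKernel_eq_sq κ, Pi.mul_apply, mul_assoc]
    have e1 : ∀ y, expKernel (κ / 2) x y ^ (2 : ℝ) = expKernel κ x y := fun y => by
      rw [expKernel_eq_sq κ, ENNReal.rpow_two, sq]
    have e2 : ∀ y, (expKernel (κ / 2) x y * h y) ^ (2 : ℝ) = expKernel κ x y * h y ^ (2 : ℝ) :=
      fun y => by rw [ENNReal.mul_rpow_of_nonneg _ _ (by norm_num), e1]
    simp_rw [e0, e1, e2, lintegral_expKernel_right] at hcs
    calc _ ≤ (expMass κ ^ (1 / 2 : ℝ) *
          (∫⁻ y, expKernel κ x y * h y ^ (2 : ℝ)) ^ (1 / 2 : ℝ)) ^ (2 : ℝ) :=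
          ENNReal.rpow_le_rpow hcs (by norm_num)
      _ = _ := by
          rw [ENNReal.mul_rpow_of_nonneg _ _ (by norm_num), ← ENNReal.rpow_mul, ← ENNReal.rpow_mul]
          norm_num
  calc _ ≤ ∫⁻ x, expMass κ * ∫⁻ y, expKernel κ x y * h y ^ (2 : ℝ) := lintegral_mono h1
    _ = expMass κ * ∫⁻ x, ∫⁻ y, expKernel κ x y * h y ^ (2 : ℝ) := by
        refine lintegral_const_mul _ (Measurable.lintegral_prod_right ?_)
        exact (measurable_expKernel κ).mul ((hh.comp measurable_snd).pow_const _)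
    _ = expMass κ * ∫⁻ y, ∫⁻ x, expKernel κ x y * h y ^ (2 : ℝ) := by
        rw [lintegral_lintegral_swap]
        exact ((measurable_expKernel κ).mul ((hh.comp measurable_snd).pow_const _)).aemeasurable
    _ = expMass κ * ∫⁻ y, expMass κ * h y ^ (2 : ℝ) := by
        congr 1
        refine lintegral_congr fun y => ?_
        have hmy : Measurable fun x => expKernel κ x y :=
          (measurable_expKernel κ).comp measurable_prodMk_right
        rw [lintegral_mul_const _ hmy, lintegral_expKernel_left]
    _ = _ := by
        rw [lintegral_const_mul _ (hh.pow_const _), ENNReal.rpow_two, sq, mul_assoc]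

section

variable {K : ℝ → ℝ → ℂ} {κ D : ℝ}

theorem memLp_exp_kernel_row (hκ : 0 < κ) (hK : StronglyMeasurable (Function.uncurry K))
    (hb : ∀ x y, ‖K x y‖ ≤ D * Real.exp (-(κ * |x - y|))) (x : ℝ) : MemLp (K x) 2 volume := by
  have hc : StronglyMeasurable (K x) := hK.of_uncurry_left
  have hD : 0 ≤ D := by
    have := (norm_nonneg _).trans (hb 0 0)
    simpa using this
  refine memLp_two_of_norm_le_exp hκ (C := D * Real.exp (κ * |x|)) hc.aestronglyMeasurable
    fun y => (hb x y).trans ?_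
  rw [mul_assoc, ← Real.exp_add]
  refine mul_le_mul_of_nonneg_left (Real.exp_le_exp.2 ?_) hD
  have h1 : |y| ≤ |x| + |x - y| := by
    have := abs_sub x (x - y)
    rwa [sub_sub_cancel] at this
  nlinarith

theorem integrable_exp_kernel_mul (hκ : 0 < κ) (hK : StronglyMeasurable (Function.uncurry K))
    (hb : ∀ x y, ‖K x y‖ ≤ D * Real.exp (-(κ * |x - y|))) (g : L2) (x : ℝ) :
    Integrable fun y => K x y * g y :=
  (memLp_exp_kernel_row hκ hK hb x).integrable_mul (Lp.memLp g)

theorem eLpNorm_exp_kernel_le (hb : ∀ x y, ‖K x y‖ ≤ D * Real.exp (-(κ * |x - y|))) (g : L2) :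
    eLpNorm (fun x => ∫ y, K x y * g y) 2 volume ≤
      ENNReal.ofReal D * expMass κ * eLpNorm g 2 volume := by
  have hD : 0 ≤ D := by
    have := (norm_nonneg _).trans (hb 0 0)
    simpa using this
  rw [eLpNorm_eq_lintegral_rpow_enorm_toReal (by norm_num) (by norm_num),
    eLpNorm_eq_lintegral_rpow_enorm_toReal (by norm_num) (by norm_num)]
  simp only [ENNReal.toReal_ofNat]
  have h1 : ∀ x, ‖∫ y, K x y * g y‖ₑ ≤ ENNReal.ofReal D * ∫⁻ y, expKernel κ x y * ‖g y‖ₑ := fun x => by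
    refine (enorm_integral_le_lintegral_enorm _).trans ?_
    rw [← lintegral_const_mul' _ _ ENNReal.ofReal_ne_top]
    refine lintegral_mono fun y => ?_
    simp only
    rw [enorm_mul, ← mul_assoc, expKernel, ← ENNReal.ofReal_mul hD]
    gcongr
    rw [← ofReal_norm]
    exact ENNReal.ofReal_le_ofReal (hb x y)
  have hg : Measurable fun y => ‖g y‖ₑ := (Lp.stronglyMeasurable g).measurable.enorm
  calc _ ≤ (∫⁻ x, (ENNReal.ofReal D * ∫⁻ y, expKernel κ x y * ‖g y‖ₑ) ^ (2 : ℝ)) ^ (1 / 2 : ℝ) := by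
        refine ENNReal.rpow_le_rpow (lintegral_mono fun x => ?_) (by norm_num)
        exact ENNReal.rpow_le_rpow (h1 x) (by norm_num)
    _ = (ENNReal.ofReal D ^ (2 : ℝ) *
          ∫⁻ x, (∫⁻ y, expKernel κ x y * ‖g y‖ₑ) ^ (2 : ℝ)) ^ (1 / 2 : ℝ) := by
        congr 1
        rw [← lintegral_const_mul' _ _ (ENNReal.rpow_ne_top_of_nonneg (by norm_num) ENNReal.ofReal_ne_top)]
        refine lintegral_congr fun x => ?_
        rw [ENNReal.mul_rpow_of_nonneg _ _ (by norm_num)]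
    _ ≤ (ENNReal.ofReal D ^ (2 : ℝ) *
          (expMass κ ^ (2 : ℝ) * ∫⁻ y, ‖g y‖ₑ ^ (2 : ℝ))) ^ (1 / 2 : ℝ) := by
        refine ENNReal.rpow_le_rpow ?_ (by norm_num)
        gcongr
        exact lintegral_expKernel_mul_sq_le κ hg
    _ = _ := by
        rw [← mul_assoc, ← ENNReal.mul_rpow_of_nonneg _ _ (by norm_num : (0 : ℝ) ≤ 2),
          ENNReal.mul_rpow_of_nonneg _ _ (by norm_num : (0 : ℝ) ≤ 1 / 2), ← ENNReal.rpow_mul]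
        norm_num

theorem exists_l2_operator (hκ : 0 < κ) (hK : StronglyMeasurable (Function.uncurry K))
    (hb : ∀ x y, ‖K x y‖ ≤ D * Real.exp (-(κ * |x - y|))) :
    ∃ R : L2 →L[ℂ] L2, ∀ g : L2, R g =ᵐ[volume] fun x => ∫ y, K x y * g y := by
  have htop : ENNReal.ofReal D * expMass κ ≠ ⊤ :=
    ENNReal.mul_ne_top ENNReal.ofReal_ne_top (expMass_lt_top hκ).ne
  have hmem : ∀ g : L2, MemLp (fun x => ∫ y, K x y * g y) 2 volume := fun g => by
    refine ⟨?_, lt_of_le_of_lt (eLpNorm_exp_kernel_le hb g)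
      (ENNReal.mul_lt_top htop.lt_top (Lp.eLpNorm_lt_top g))⟩
    have h1 : StronglyMeasurable fun q : ℝ × ℝ => K q.1 q.2 * g q.2 :=
      hK.mul ((Lp.stronglyMeasurable g).comp_measurable measurable_snd)
    exact (h1.integral_prod_right (ν := volume)).aestronglyMeasurable
  let T : L2 →ₗ[ℂ] L2 :=
    { toFun := fun f => (hmem f).toLp _
      map_add' := fun f g => by
        rw [← MemLp.toLp_add]
        refine MemLp.toLp_congr _ _ (Eventually.of_forall fun x => ?_)
        simp only [Pi.add_apply]
        rw [← integral_add (integrable_exp_kernel_mul hκ hK hb f x)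
          (integrable_exp_kernel_mul hκ hK hb g x)]
        refine integral_congr_ae ?_
        filter_upwards [Lp.coeFn_add f g] with y hy
        rw [hy, Pi.add_apply, mul_add]
      map_smul' := fun c f => by
        rw [RingHom.id_apply, ← MemLp.toLp_const_smul]
        refine MemLp.toLp_congr _ _ (Eventually.of_forall fun x => ?_)
        simp only [Pi.smul_apply, smul_eq_mul]
        rw [← integral_const_mul]
        refine integral_congr_ae ?_
        filter_upwards [Lp.coeFn_smul c f] with y hy
        rw [hy, Pi.smul_apply, smul_eq_mul]; ring }
  refine ⟨T.mkContinuous (ENNReal.ofReal D * expMass κ).toReal fun f => ?_,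
    fun f => (hmem f).coeFn_toLp⟩
  change ‖(hmem f).toLp _‖ ≤ _
  rw [Lp.norm_toLp, Lp.norm_def, ← ENNReal.toReal_mul]
  exact ENNReal.toReal_mono (ENNReal.mul_ne_top htop (Lp.eLpNorm_ne_top f)) (eLpNorm_exp_kernel_le hb f)

end

/-! ### Variation of constants with an integrable right-hand side -/

theorem absolutelyContinuous_intervalIntegral {f : ℝ → ℂ}
    (hf : ∀ a b, IntervalIntegrable f volume a b) (x : ℝ) :
    AbsolutelyContinuousOnInterval (fun y => ∫ t in (0:ℝ)..y, f t) 0 x := by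
  have hre : ∀ a b, IntervalIntegrable (fun t => (f t).re) volume a b :=
    fun a b => ⟨(hf a b).1.re, (hf a b).2.re⟩
  have him : ∀ a b, IntervalIntegrable (fun t => (f t).im) volume a b :=
    fun a b => ⟨(hf a b).1.im, (hf a b).2.im⟩
  have hconst : ∀ c : ℂ, AbsolutelyContinuousOnInterval (fun _ : ℝ => c) 0 x := fun c =>
    ((LipschitzWith.const c).lipschitzOnWith).absolutelyContinuousOnInterval
  have h := (((hre 0 x).absolutelyContinuousOnInterval_intervalIntegral Set.left_mem_uIcc).smul
    (hconst 1)).add (((him 0 x).absolutelyContinuousOnInterval_intervalIntegral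
    Set.left_mem_uIcc).smul (hconst Complex.I))
  have e : (fun y => ∫ t in (0:ℝ)..y, f t) =
      (fun y => ∫ t in (0:ℝ)..y, (f t).re) • (fun _ => (1 : ℂ)) +
        (fun y => ∫ t in (0:ℝ)..y, (f t).im) • fun _ => Complex.I := by
    funext y
    have h1 := Complex.reCLM.intervalIntegral_comp_comm (hf 0 y)
    have h2 := Complex.imCLM.intervalIntegral_comp_comm (hf 0 y)
    simp only [Complex.reCLM_apply, Complex.imCLM_apply] at h1 h2
    simp only [Pi.add_apply, Pi.smul_apply', Complex.real_smul, mul_one]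
    rw [h1, h2, Complex.re_add_im]
  rw [e]
  exact h

/-- Integration by parts for a merely integrable `f`: the difference of the two sides is absolutely
continuous with derivative zero almost everywhere, hence constant. -/
theorem mul_primitive_eq {y y' f : ℝ → ℂ} (hy : ∀ x, HasDerivAt y (y' x) x) (hy' : Continuous y')
    (hf : ∀ a b, IntervalIntegrable f volume a b) (c : ℂ) (x : ℝ) :
    y x * (c + ∫ t in (0:ℝ)..x, f t) - y 0 * c =
      ∫ s in (0:ℝ)..x, (y' s * (c + ∫ t in (0:ℝ)..s, f t) + y s * f s) := by
  have hyc : Continuous y := continuous_iff_continuousAt.2 fun x => (hy x).continuousAt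
  have hFc : Continuous fun s => c + ∫ t in (0:ℝ)..s, f t :=
    continuous_const.add (intervalIntegral.continuous_primitive hf 0)
  have hint : ∀ a b, IntervalIntegrable
      (fun s => y' s * (c + ∫ t in (0:ℝ)..s, f t) + y s * f s) volume a b := fun a b =>
    ((hy'.mul hFc).intervalIntegrable a b).add ((hf a b).continuousOn_mul hyc.continuousOn)
  have hconst : AbsolutelyContinuousOnInterval (fun _ : ℝ => c) 0 x :=
    ((LipschitzWith.const c).lipschitzOnWith).absolutelyContinuousOnInterval
  have hyac : AbsolutelyContinuousOnInterval y 0 x := by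
    refine ContDiffOn.absolutelyContinuousOnInterval (ContDiff.contDiffOn ?_)
    refine contDiff_one_iff_deriv.2 ⟨fun x => (hy x).differentiableAt, ?_⟩
    rwa [funext fun x => (hy x).deriv]
  have hF := hconst.add (absolutelyContinuous_intervalIntegral hf x)
  have hac := (hyac.smul hF).sub (absolutelyContinuous_intervalIntegral hint x)
  obtain ⟨C, hC⟩ := hac.const_of_ae_hasDerivAt_zero (by
    filter_upwards [(hf 0 x).ae_hasDerivAt_integral, (hint 0 x).ae_hasDerivAt_integral]
      with s h1 h2 hs
    have d1 := h1 hs 0 Set.left_mem_uIcc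
    have d2 := h2 hs 0 Set.left_mem_uIcc
    refine (((hy s).mul (d1.const_add c)).sub d2).congr_deriv ?_
    ring)
  have e1 : y x * (c + ∫ t in (0:ℝ)..x, f t) -
      (∫ s in (0:ℝ)..x, (y' s * (c + ∫ t in (0:ℝ)..s, f t) + y s * f s)) = C :=
    hC x Set.right_mem_uIcc
  have e2 : y 0 * (c + ∫ t in (0:ℝ)..0, f t) -
      (∫ s in (0:ℝ)..0, (y' s * (c + ∫ t in (0:ℝ)..s, f t) + y s * f s)) = C :=
    hC 0 Set.left_mem_uIcc
  simp only [intervalIntegral.integral_same, add_zero, sub_zero] at e2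
  linear_combination e1 - e2

/-- Formally `A' = y₂ g` and `B' = -y₁ g`. Then `y₁ A' + y₂ B' = 0`, so the first derivative
contains no `g`, and `y₁' A' + y₂' B' = W g` produces the source term of `v'' = q v - g`. -/
theorem variation_of_constants {y₁ y₁' y₂ y₂' q g : ℝ → ℂ} (hq : Continuous q)
    (h1 : ∀ x, HasDerivAt y₁ (y₁' x) x) (h1' : ∀ x, HasDerivAt y₁' (q x * y₁ x) x)
    (h2 : ∀ x, HasDerivAt y₂ (y₂' x) x) (h2' : ∀ x, HasDerivAt y₂' (q x * y₂ x) x)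
    {W : ℂ} (hW : W ≠ 0) (hwr : ∀ x, y₁' x * y₂ x - y₁ x * y₂' x = W)
    (hg : ∀ a b, IntervalIntegrable g volume a b) {A B : ℝ → ℂ} {a b : ℂ}
    (hA : ∀ x, A x = a + ∫ t in (0:ℝ)..x, y₂ t * g t)
    (hB : ∀ x, B x = b + ∫ t in (0:ℝ)..x, -(y₁ t * g t)) :
    (∀ x, HasDerivAt (fun x => -(y₁ x * A x + y₂ x * B x) / W)
      (-(y₁' x * A x + y₂' x * B x) / W) x) ∧
    ∀ x, -(y₁' x * A x + y₂' x * B x) / W = -(y₁' 0 * A 0 + y₂' 0 * B 0) / W +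
      ∫ t in (0:ℝ)..x, (q t * (-(y₁ t * A t + y₂ t * B t) / W) - g t) := by
  have c1 : Continuous y₁ := continuous_iff_continuousAt.2 fun x => (h1 x).continuousAt
  have c2 : Continuous y₂ := continuous_iff_continuousAt.2 fun x => (h2 x).continuousAt
  have c1' : Continuous y₁' := continuous_iff_continuousAt.2 fun x => (h1' x).continuousAt
  have c2' : Continuous y₂' := continuous_iff_continuousAt.2 fun x => (h2' x).continuousAt
  have hf1 : ∀ u v, IntervalIntegrable (fun t => y₂ t * g t) volume u v := fun u v =>
    (hg u v).continuousOn_mul c2.continuousOn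
  have hf2 : ∀ u v, IntervalIntegrable (fun t => -(y₁ t * g t)) volume u v := fun u v =>
    ((hg u v).continuousOn_mul c1.continuousOn).neg
  have cA : Continuous A := by
    rw [funext hA]; exact continuous_const.add (intervalIntegral.continuous_primitive hf1 0)
  have cB : Continuous B := by
    rw [funext hB]; exact continuous_const.add (intervalIntegral.continuous_primitive hf2 0)
  have hA0 : A 0 = a := by simp [hA]
  have hB0 : B 0 = b := by simp [hB]
  -- Used twice: with `p, r = y₁, y₂` the coefficient of `g` vanishes, and with `p, r = y₁', y₂'` it
  -- is `W`.
  have prod : ∀ {p p' r r' : ℝ → ℂ}, (∀ x, HasDerivAt p (p' x) x) → (∀ x, HasDerivAt r (r' x) x) →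
      Continuous p' → Continuous r' → ∀ x, p x * A x + r x * B x = p 0 * A 0 + r 0 * B 0 +
        ∫ s in (0:ℝ)..x, (p' s * A s + r' s * B s + (p s * y₂ s - r s * y₁ s) * g s) :=
    fun {p p' r r'} hp hr cp' cr' x => by
      have e1 := mul_primitive_eq hp cp' hf1 a x
      have e2 := mul_primitive_eq hr cr' hf2 b x
      simp only [← hA, ← hB] at e1 e2
      have cp : Continuous p := continuous_iff_continuousAt.2 fun x => (hp x).continuousAt
      have cr : Continuous r := continuous_iff_continuousAt.2 fun x => (hr x).continuousAt
      have i1 : IntervalIntegrable (fun s => p' s * A s + p s * (y₂ s * g s)) volume 0 x :=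
        ((cp'.mul cA).intervalIntegrable _ _).add ((hf1 0 x).continuousOn_mul cp.continuousOn)
      have i2 : IntervalIntegrable (fun s => r' s * B s + r s * -(y₁ s * g s)) volume 0 x :=
        ((cr'.mul cB).intervalIntegrable _ _).add ((hf2 0 x).continuousOn_mul cr.continuousOn)
      have e3 : ∫ s in (0:ℝ)..x, (p' s * A s + r' s * B s + (p s * y₂ s - r s * y₁ s) * g s) =
          (∫ s in (0:ℝ)..x, (p' s * A s + p s * (y₂ s * g s))) +
            ∫ s in (0:ℝ)..x, (r' s * B s + r s * -(y₁ s * g s)) := by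
        rw [← intervalIntegral.integral_add i1 i2]
        refine intervalIntegral.integral_congr fun s _ => ?_
        ring
      rw [e3, ← e1, ← e2, hA0, hB0]; ring
  refine ⟨fun x => ?_, fun x => ?_⟩
  · have hv := prod h1 h2 c1' c2'
    have e : ∀ x, y₁ x * A x + y₂ x * B x = y₁ 0 * A 0 + y₂ 0 * B 0 +
        ∫ s in (0:ℝ)..x, (y₁' s * A s + y₂' s * B s) := fun x => by
      rw [hv x]
      congr 1
      refine intervalIntegral.integral_congr fun s _ => ?_
      ring
    have cw : Continuous fun s => y₁' s * A s + y₂' s * B s := by fun_prop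
    have hd : HasDerivAt (fun x => y₁ x * A x + y₂ x * B x) (y₁' x * A x + y₂' x * B x) x := by
      rw [funext e]
      exact (intervalIntegral.integral_hasDerivAt_right (cw.intervalIntegrable _ _)
        (cw.stronglyMeasurableAtFilter _ _) cw.continuousAt).const_add _
    exact hd.neg.div_const W
  · have hv := prod h1' h2' (hq.mul c1) (hq.mul c2) x
    have e : ∫ t in (0:ℝ)..x, (q t * (-(y₁ t * A t + y₂ t * B t) / W) - g t) =
        -(∫ s in (0:ℝ)..x, (q s * y₁ s * A s + q s * y₂ s * B s +
          (y₁' s * y₂ s - y₂' s * y₁ s) * g s)) / W := by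
      rw [← intervalIntegral.integral_neg, ← intervalIntegral.integral_div]
      refine intervalIntegral.integral_congr fun s _ => ?_
      have hs : y₁' s * y₂ s - y₂' s * y₁ s = W := by rw [← hwr s]; ring
      simp only [hs]
      field_simp
      ring
    rw [e]
    rw [hv]
    ring

/-! ### The resolvent -/

theorem intervalIntegrable_l2 (g : L2) (a b : ℝ) : IntervalIntegrable g volume a b := by
  have h : LocallyIntegrable g volume := (Lp.memLp g).locallyIntegrable (by norm_num)
  exact (h.integrableOn_isCompact isCompact_uIcc).intervalIntegrable

theorem IsImage.sub {V : ℝ → ℝ} (hV : Continuous V) {u u' h h' : L2} (h1 : IsImage V u h)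
    (h2 : IsImage V u' h') : IsImage V (u - u') (h - h') := by
  obtain ⟨v, w, hu, hv, hw⟩ := h1
  obtain ⟨v', w', hu', hv', hw'⟩ := h2
  refine ⟨fun x => v x - v' x, fun x => w x - w' x, ?_, fun x => (hv x).sub (hv' x), fun x => ?_⟩
  · filter_upwards [hu, hu', Lp.coeFn_sub u u'] with x a b c
    rw [c, Pi.sub_apply, a, b]
  · have int : ∀ {v w : ℝ → ℂ} (h : L2), (∀ x, HasDerivAt v (w x) x) →
        IntervalIntegrable (fun t => (V t : ℂ) * v t - h t) volume 0 x := fun {v w} h hv => by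
      have cv : Continuous v := continuous_iff_continuousAt.2 fun x => (hv x).continuousAt
      have : Continuous fun t => (V t : ℂ) * v t := by fun_prop
      exact (this.intervalIntegrable _ _).sub (intervalIntegrable_l2 h 0 x)
    simp only
    rw [hw x, hw' x, add_sub_add_comm, ← intervalIntegral.integral_sub (int h hv) (int h' hv')]
    congr 1
    refine intervalIntegral.integral_congr_ae ?_
    filter_upwards [Lp.coeFn_sub h h'] with t ht _
    rw [ht, Pi.sub_apply]; ring

/-- A right inverse of `H - z` is the resolvent as soon as `H - z` is injective: two solutions with
the same right side differ by an eigenvector or zero. -/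
theorem isResolvent_of_isImage {V : ℝ → ℝ} (hV : Continuous V) {z : ℂ} (hz : ¬ IsEigenvalue V z)
    {R : L2 →L[ℂ] L2} (hR : ∀ g, IsImage V (R g) (g + z • R g)) : IsResolvent V z R := by
  intro u g
  refine ⟨fun h => ?_, fun h => h ▸ hR g⟩
  by_contra hne
  refine hz ⟨u - R g, sub_ne_zero.2 hne, ?_⟩
  have := h.sub hV (hR g)
  rwa [add_sub_add_left_eq_sub, ← smul_sub] at this

section

variable {V : ℝ → ℝ} {η M : ℝ}

theorem integrableOn_psiPlus_mul (hV : DecayBound V η M) {k : ℂ} (hk : 0 < k.im) {g : ℝ → ℂ}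
    (hg : MemLp g 2 volume) : IntegrableOn (fun t => psiPlus V k t * g t) (Set.Ioi 0) := by
  have hks := mem_upperStrip_of_nonneg hV.eta_pos hk.le
  have hc : Continuous (psiPlus V k) :=
    continuous_iff_continuousAt.2 fun x => (hasDerivAt_psiPlus hV hks x).continuousAt
  have hC := jostConst_pos hV.nonneg
  have h1 : MemLp ((Set.Ioi (0 : ℝ)).indicator (psiPlus V k)) 2 volume := by
    refine memLp_two_of_norm_le_exp hk (C := jostConst M)
      (hc.aestronglyMeasurable.indicator measurableSet_Ioi) fun x => ?_
    by_cases hx : x ∈ Set.Ioi (0 : ℝ)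
    · rw [Set.indicator_of_mem hx, abs_of_pos hx]
      exact norm_psiPlus_le_of_nonneg hV hks (le_of_lt hx)
    · rw [Set.indicator_of_notMem hx, norm_zero]
      positivity
  rw [← integrable_indicator_iff measurableSet_Ioi]
  refine (h1.integrable_mul hg).congr (Eventually.of_forall fun x => ?_)
  by_cases hx : x ∈ Set.Ioi (0 : ℝ) <;> simp [hx]

theorem integrableOn_psiMinus_mul (hV : DecayBound (fun x => V (-x)) η M) {k : ℂ} (hk : 0 < k.im)
    {g : ℝ → ℂ} (hg : MemLp g 2 volume) :
    IntegrableOn (fun t => psiMinus V k t * g t) (Set.Iic 0) := by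
  have hg' : MemLp (fun x => g (-x)) 2 volume :=
    hg.comp_measurePreserving (Measure.measurePreserving_neg volume)
  have h := integrableOn_psiPlus_mul hV hk hg'
  rw [← neg_zero] at h
  have h2 := h.comp_neg_Iio
  rw [integrableOn_Iic_iff_integrableOn_Iio]
  simpa [psiMinus] using h2

/-- Splitting the `y`-integral at `x` puts it in the form of `variation_of_constants`, with `A =
∫_{-∞}^x ψ₋ g` and `B = ∫_x^∞ ψ₊ g`. These converge for `g ∈ L²` because `Im k > 0`. -/
theorem isImage_of_green (hV : DecayBound V η M) (hV' : DecayBound (fun x => V (-x)) η M)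
    {k : ℂ} (hk : 0 < k.im) (hW : wronskian V k ≠ 0) {u g : L2}
    (hu : u =ᵐ[volume] fun x => ∫ y, green V k x y * g y) : IsImage V u (g + k ^ 2 • u) := by
  have hks := mem_upperStrip_of_nonneg hV.eta_pos hk.le
  have cV := hV.cont
  have c1 : Continuous (psiPlus V k) :=
    continuous_iff_continuousAt.2 fun x => (hasDerivAt_psiPlus hV hks x).continuousAt
  have c2 : Continuous (psiMinus V k) :=
    continuous_iff_continuousAt.2 fun x => (hasDerivAt_psiMinus hV' hks x).continuousAt
  have hg := intervalIntegrable_l2 g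
  have hi1 : ∀ a b, IntervalIntegrable (fun t => psiPlus V k t * g t) volume a b := fun a b =>
    (hg a b).continuousOn_mul c1.continuousOn
  have hi2 : ∀ a b, IntervalIntegrable (fun t => psiMinus V k t * g t) volume a b := fun a b =>
    (hg a b).continuousOn_mul c2.continuousOn
  have hI1 : ∀ x, IntegrableOn (fun t => psiPlus V k t * g t) (Set.Ioi x) := fun x => by
    have h0 := integrableOn_psiPlus_mul hV hk (Lp.memLp g)
    refine ((hi1 x 0).1.union h0).mono_set fun t ht => ?_
    rcases le_or_gt t 0 with h | h
    · exact Or.inl ⟨ht, h⟩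
    · exact Or.inr h
  have hI2 : ∀ x, IntegrableOn (fun t => psiMinus V k t * g t) (Set.Iic x) := fun x => by
    have h0 := integrableOn_psiMinus_mul hV' hk (Lp.memLp g)
    refine ((hi2 0 x).1.union h0).mono_set fun t ht => ?_
    rcases le_or_gt t 0 with h | h
    · exact Or.inr h
    · exact Or.inl ⟨h, ht⟩
  set A : ℝ → ℂ := fun x => ∫ t in Set.Iic x, psiMinus V k t * g t with hA
  set B : ℝ → ℂ := fun x => ∫ t in Set.Ioi x, psiPlus V k t * g t with hB
  have hA' : ∀ x, A x = A 0 + ∫ t in (0:ℝ)..x, psiMinus V k t * g t := fun x => by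
    rw [← intervalIntegral.integral_Iic_sub_Iic (hI2 0) (hI2 x)]
    simp only [hA]; ring
  have hB' : ∀ x, B x = B 0 + ∫ t in (0:ℝ)..x, -(psiPlus V k t * g t) := fun x => by
    rw [intervalIntegral.integral_neg, ← intervalIntegral.integral_Ioi_sub_Ioi' (hI1 0) (hI1 x)]
    simp only [hB]; ring
  have hv := variation_of_constants (q := fun x => (V x : ℂ) - k ^ 2) (by fun_prop)
    (hasDerivAt_psiPlus hV hks) (hasDerivAt_psiPlus' hV hks) (hasDerivAt_psiMinus hV' hks)
    (hasDerivAt_psiMinus' hV' hks) hW (wronskian_eq hV hV' hks) hg hA' hB'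
  have hval : ∀ x, ∫ y, green V k x y * g y =
      -(psiPlus V k x * A x + psiMinus V k x * B x) / wronskian V k := fun x => by
    have e1 : ∀ y ∈ Set.Iic x, green V k x y * g y =
        -(psiPlus V k x / wronskian V k) * (psiMinus V k y * g y) := fun y hy => by
      rw [green, max_eq_left hy, min_eq_right hy]; ring
    have e2 : ∀ y ∈ Set.Ioi x, green V k x y * g y =
        -(psiMinus V k x / wronskian V k) * (psiPlus V k y * g y) := fun y hy => by
      rw [green, max_eq_right (le_of_lt hy), min_eq_left (le_of_lt hy)]; ring
    have j1 : IntegrableOn (fun y => green V k x y * g y) (Set.Iic x) := by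
      refine (integrableOn_congr_fun e1 measurableSet_Iic).2 ?_
      exact (hI2 x).const_mul (-(psiPlus V k x / wronskian V k))
    have j2 : IntegrableOn (fun y => green V k x y * g y) (Set.Ioi x) := by
      refine (integrableOn_congr_fun e2 measurableSet_Ioi).2 ?_
      exact (hI1 x).const_mul (-(psiMinus V k x / wronskian V k))
    rw [← intervalIntegral.integral_Iic_add_Ioi j1 j2, setIntegral_congr_fun measurableSet_Iic e1,
      setIntegral_congr_fun measurableSet_Ioi e2, integral_const_mul, integral_const_mul]
    simp only [hA, hB]
    ring
  refine ⟨_, _, hu.trans (Eventually.of_forall hval), hv.1, fun x => ?_⟩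
  rw [hv.2 x]
  congr 1
  refine intervalIntegral.integral_congr_ae ?_
  filter_upwards [Lp.coeFn_add g (k ^ 2 • u), Lp.coeFn_smul (k ^ 2) u, hu] with t h1 h2 h3 _
  rw [h1, Pi.add_apply, h2, Pi.smul_apply, h3, hval t, smul_eq_mul]
  ring

/-- Exponential decay of the kernel gives an `L²` operator with the same Green function, and `β > 1`
puts `⟨x⟩^{-β} f` in `L²`; the `L^∞` and `L²` operators then agree by comparing kernels. -/
theorem isWeightedResolvent_of_hasKernel (hV : DecayBound V η M)
    (hV' : DecayBound (fun x => V (-x)) η M) {k : ℂ} (hk : 0 < k.im)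
    (heig : ¬ IsEigenvalue V (k ^ 2)) (hW : wronskian V k ≠ 0)
    (hmeas : Continuous (Function.uncurry (green V k))) {D : ℝ}
    (hb : ∀ x y, ‖k‖ * ‖green V k x y‖ ≤ D * Real.exp (-(k.im * |x - y|))) {β : ℝ} (hβ : 1 < β)
    {A : Linfty →L[ℂ] Linfty} (hA : HasKernel A (weightedKernel β (green V k))) :
    IsWeightedResolvent V β (k ^ 2) A := by
  have hk0 : 0 < ‖k‖ := norm_pos_iff.2 fun h => by simp [h] at hk
  obtain ⟨R, hR⟩ := exists_l2_operator (K := green V k) (D := D / ‖k‖) hk hmeas.stronglyMeasurable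
    fun x y => by
      rw [div_mul_eq_mul_div, le_div_iff₀ hk0, mul_comm]
      exact hb x y
  refine ⟨R, isResolvent_of_isImage hV.cont heig fun g => isImage_of_green hV hV' hk hW (hR g),
    fun f => ?_⟩
  have hw : MemLp (fun x => ((weight β x : ℝ) : ℂ)) 2 volume := by
    have hc : Continuous fun x => ((weight β x : ℝ) : ℂ) :=
      Complex.continuous_ofReal.comp (continuous_weight β)
    rw [memLp_two_iff_integrable_sq_norm hc.aestronglyMeasurable]
    refine (integrable_weight (by linarith : 1 < β + β)).congr (Eventually.of_forall fun x => ?_)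
    beta_reduce
    rw [Complex.norm_real, Real.norm_of_nonneg (weight_pos β x).le, sq]
    unfold weight
    rw [← Real.rpow_add (by linarith [one_le_bracket x])]
    ring_nf
  have hmem : MemLp (fun x => ((weight β x : ℝ) : ℂ) * f x) 2 volume := by
    refine MemLp.of_le_mul (c := ‖f‖) hw
      (hw.1.mul (Lp.aestronglyMeasurable f)) ?_
    filter_upwards [ae_norm_le_norm_linfty f] with x hx
    rw [norm_mul, mul_comm]
    gcongr
  refine ⟨hmem.toLp _, hmem.coeFn_toLp, ?_⟩
  filter_upwards [hA f, hR (hmem.toLp _)] with x h1 h2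
  rw [h1, h2, ← integral_const_mul]
  refine integral_congr_ae ?_
  filter_upwards [hmem.coeFn_toLp] with y hy
  rw [hy]
  simp only [weightedKernel, weight]
  ring

end

end Schrodinger

/-! ### Passage from `k` to `τ = k²` -/

namespace Schrodinger

/-! ### The square root of the spectral parameter -/

/-- The square root of `τ + i s ε` in the closed upper half plane, for `s = 1` or `s = -1`
and `ε ≥ 0`. -/
noncomputable def spectralRoot (s τ ε : ℝ) : ℂ :=
  (s * √((√(τ ^ 2 + ε ^ 2) + τ) / 2) : ℝ) + (√((√(τ ^ 2 + ε ^ 2) - τ) / 2) : ℝ) * Complex.I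

theorem spectralRoot_im (s τ ε : ℝ) : (spectralRoot s τ ε).im = √((√(τ ^ 2 + ε ^ 2) - τ) / 2) := by
  simp [spectralRoot]

theorem spectralRoot_im_nonneg (s τ ε : ℝ) : 0 ≤ (spectralRoot s τ ε).im := by
  rw [spectralRoot_im]; positivity

theorem spectralRoot_im_pos (s : ℝ) {τ ε : ℝ} (h : ε ≠ 0 ∨ τ < 0) :
    0 < (spectralRoot s τ ε).im := by
  rw [spectralRoot_im]
  refine Real.sqrt_pos.2 (half_pos (sub_pos.2 ?_))
  rcases lt_or_ge τ 0 with hτ | hτ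
  · exact hτ.trans_le (Real.sqrt_nonneg _)
  · refine Real.lt_sqrt_of_sq_lt (lt_add_of_pos_right _ ?_)
    have : ε ≠ 0 := h.resolve_right hτ.not_gt
    positivity

theorem spectralRoot_sq {s : ℝ} (hs : s ^ 2 = 1) (τ : ℝ) {ε : ℝ} (hε : 0 ≤ ε) :
    spectralRoot s τ ε ^ 2 = (τ : ℂ) + (s : ℂ) * (ε : ℂ) * Complex.I := by
  have hr : |τ| ≤ √(τ ^ 2 + ε ^ 2) := Real.abs_le_sqrt (by nlinarith)
  have hr2 : √(τ ^ 2 + ε ^ 2) ^ 2 = τ ^ 2 + ε ^ 2 := Real.sq_sqrt (by positivity)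
  unfold spectralRoot
  set r := √(τ ^ 2 + ε ^ 2)
  have ha : 0 ≤ (r + τ) / 2 := by linarith [neg_abs_le τ]
  have hb : 0 ≤ (r - τ) / 2 := by linarith [le_abs_self τ]
  have hab : √((r + τ) / 2) * √((r - τ) / 2) = ε / 2 := by
    rw [← Real.sqrt_mul ha, Real.sqrt_eq_iff_mul_self_eq (mul_nonneg ha hb) (by positivity)]
    linear_combination hr2 / 4
  have ha2 := Real.sq_sqrt ha
  have hb2 := Real.sq_sqrt hb
  set a := √((r + τ) / 2)
  set b := √((r - τ) / 2)
  apply Complex.ext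
  · simp only [sq, Complex.mul_re, Complex.add_re, Complex.add_im, Complex.mul_im,
      Complex.ofReal_re, Complex.ofReal_im, Complex.I_re, Complex.I_im]
    linear_combination a ^ 2 * hs + ha2 - hb2
  · simp only [sq, Complex.mul_re, Complex.add_re, Complex.add_im, Complex.mul_im,
      Complex.ofReal_re, Complex.ofReal_im, Complex.I_re, Complex.I_im]
    linear_combination 2 * s * hab

theorem continuous_spectralRoot (s τ : ℝ) : Continuous (spectralRoot s τ) := by
  unfold spectralRoot
  fun_prop

theorem spectralRoot_zero_sq {s : ℝ} (hs : s ^ 2 = 1) (τ : ℝ) : spectralRoot s τ 0 ^ 2 = τ := by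
  simpa using spectralRoot_sq hs τ le_rfl

theorem norm_spectralRoot_sq {s : ℝ} (hs : s ^ 2 = 1) (τ : ℝ) : ‖spectralRoot s τ 0‖ ^ 2 = |τ| := by
  rw [← norm_pow, spectralRoot_zero_sq hs, Complex.norm_real, Real.norm_eq_abs]

theorem spectralRoot_ne_zero {s : ℝ} (hs : s ^ 2 = 1) {τ : ℝ} (hτ : τ ≠ 0) :
    spectralRoot s τ 0 ≠ 0 := fun h => hτ (by
  have := spectralRoot_zero_sq hs τ
  rw [h] at this
  exact_mod_cast this.symm.trans (zero_pow two_ne_zero))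

/-- Near `τ ≠ 0` one of the two real roots vanishes identically: the value is `i√(-τ)` or `s√τ`.
Only existence is needed, because differentiating `k² = τ` then determines the derivative. -/
theorem exists_hasDerivAt_spectralRoot {s : ℝ} {τ : ℝ} (hτ : τ ≠ 0) :
    ∃ d : ℂ, HasDerivAt (fun t => spectralRoot s t 0) d τ := by
  rcases hτ.lt_or_gt with h | h
  · have hd := ((((hasDerivAt_id τ).neg.sqrt (neg_ne_zero.2 hτ)).ofReal_comp).mul_const Complex.I)
    refine ⟨_, hd.congr_of_eventuallyEq ?_⟩
    filter_upwards [eventually_lt_nhds h] with t ht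
    have e1 : √(t ^ 2 + 0 ^ 2) = -t := by
      rw [zero_pow two_ne_zero, add_zero, Real.sqrt_sq_eq_abs, abs_of_neg ht]
    simp only [spectralRoot, e1]
    have e2 : (-t - t) / 2 = -t := by ring
    simp [e2]
  · have hd := (((hasDerivAt_id τ).sqrt hτ).const_mul s).ofReal_comp
    refine ⟨_, hd.congr_of_eventuallyEq ?_⟩
    filter_upwards [eventually_gt_nhds h] with t ht
    have e1 : √(t ^ 2 + 0 ^ 2) = t := by
      rw [zero_pow two_ne_zero, add_zero, Real.sqrt_sq_eq_abs, abs_of_pos ht]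
    simp only [spectralRoot, e1]
    simp

theorem hasDerivAt_spectralRoot {s : ℝ} (hs : s ^ 2 = 1) {τ : ℝ} (hτ : τ ≠ 0) :
    HasDerivAt (fun t => spectralRoot s t 0) (1 / (2 * spectralRoot s τ 0)) τ := by
  obtain ⟨d, hd⟩ := exists_hasDerivAt_spectralRoot (s := s) hτ
  have h1 : HasDerivAt (fun t : ℝ => (t : ℂ)) (2 * spectralRoot s τ 0 * d) τ := by
    have := hd.pow 2
    simpa [Pi.pow_def, spectralRoot_zero_sq hs] using this
  have h2 := h1.unique (hasDerivAt_id τ).ofReal_comp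
  have h0 := spectralRoot_ne_zero hs hτ
  have : d = 1 / (2 * spectralRoot s τ 0) := by
    rw [eq_div_iff (by simpa using h0), mul_comm, h2, Complex.ofReal_one]
  exact this ▸ hd

/-! ### Boundary values of the weighted resolvent -/

section

variable {V : ℝ → ℝ} {β : ℝ} {A : ℂ → Linfty →L[ℂ] Linfty}

/-- The path `ε ↦ k` is continuous up to `ε = 0` and stays in the closed half-plane, so norm
continuity in `k` gives the limit, at `τ = 0` as well. -/
theorem isWeightedBoundaryResolvent_of_continuousOn
    (hA : ∀ k : ℂ, 0 < k.im → IsWeightedResolvent V β (k ^ 2) (A k))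
    (hc : ContinuousOn A {k | 0 ≤ k.im}) {s : ℝ} (hs : s ^ 2 = 1) (τ : ℝ) :
    IsWeightedBoundaryResolvent V β s τ (A (spectralRoot s τ 0)) := by
  refine ⟨fun ε => A (spectralRoot s τ ε), fun ε hε => ?_, ?_⟩
  · rw [← spectralRoot_sq hs τ hε.le]
    exact hA _ (spectralRoot_im_pos s (Or.inl hε.ne'))
  · have h : Continuous fun ε => A (spectralRoot s τ ε) :=
      hc.comp_continuous (continuous_spectralRoot s τ) fun ε => spectralRoot_im_nonneg s τ ε
    exact (h.tendsto 0).mono_left nhdsWithin_le_nhds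

theorem isWeightedResolvent_of_neg
    (hA : ∀ k : ℂ, 0 < k.im → IsWeightedResolvent V β (k ^ 2) (A k)) {s : ℝ} (hs : s ^ 2 = 1)
    {τ : ℝ} (hτ : τ < 0) : IsWeightedResolvent V β (τ : ℂ) (A (spectralRoot s τ 0)) := by
  rw [← spectralRoot_zero_sq hs τ]
  exact hA _ (spectralRoot_im_pos s (Or.inr hτ))

/-- Since `dk/dτ = 1/(2k)` and `|τ| = |k|²`, the product `|τ| ‖∂_τ A‖` equals `‖k‖ ‖A'‖ / 2`. A
derivative within the half-plane suffices because the curve `τ ↦ k` never leaves it. -/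
theorem differentiableAt_comp_spectralRoot {B : ℝ}
    (hA : ∀ k₀ : ℂ, 0 ≤ k₀.im → k₀ ≠ 0 →
      ∃ A', HasDerivWithinAt A A' {k | 0 ≤ k.im} k₀ ∧ ‖k₀‖ * ‖A'‖ ≤ B)
    {s : ℝ} (hs : s ^ 2 = 1) {τ : ℝ} (hτ : τ ≠ 0) :
    DifferentiableAt ℝ (fun t => A (spectralRoot s t 0)) τ ∧
      |τ| * ‖deriv (fun t => A (spectralRoot s t 0)) τ‖ ≤ B / 2 := by
  have h0 := spectralRoot_ne_zero hs hτ
  obtain ⟨A', hA', hb⟩ := hA _ (spectralRoot_im_nonneg s τ 0) h0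
  have hd : HasDerivAt (fun t => A (spectralRoot s t 0)) ((1 / (2 * spectralRoot s τ 0)) • A') τ :=
    HasDerivWithinAt.scomp_hasDerivAt (g₁ := A) τ hA' (hasDerivAt_spectralRoot hs hτ) fun t => spectralRoot_im_nonneg s t 0
  refine ⟨hd.differentiableAt, ?_⟩
  rw [hd.deriv, norm_smul, ← norm_spectralRoot_sq hs, norm_div, norm_mul, norm_one,
    Complex.norm_ofNat]
  have hk : ‖spectralRoot s τ 0‖ ≠ 0 := norm_ne_zero_iff.2 h0
  calc _ = ‖spectralRoot s τ 0‖ * ‖A'‖ / 2 := by field_simp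
    _ ≤ B / 2 := by linarith

end

end Schrodinger

/-! ### Proof of the theorem -/

open Schrodinger

theorem lemma5p8 (V : ℝ → ℝ) (hV : ContDiff ℝ ∞ V)
    (hdecay : Schrodinger.DecaysExponentially V)
    (hres : Schrodinger.IsGeneric V)
    (heig : ∀ μ : ℂ, ¬ Schrodinger.IsEigenvalue V μ)
    (φ₁ φ₂ : ℝ → ℝ) (hφ : Schrodinger.IsCutoffPair φ₁ φ₂)
    (α : ℝ) (hα : 1 < α) :
    ∃ C : ℝ, ∀ s : ℝ, s = 1 ∨ s = -1 →
      (∃ A : ℝ → (Schrodinger.Linfty →L[ℂ] Schrodinger.Linfty),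
        (∀ τ : ℝ, Schrodinger.IsWeightedBoundaryResolvent V α s τ (A τ)) ∧
        (∀ τ : ℝ, τ < 0 → Schrodinger.IsWeightedResolvent V α (τ : ℂ) (A τ)) ∧
        ∀ τ : ℝ, ‖A τ‖ ≤ C) ∧
      (∃ B : ℝ → (Schrodinger.Linfty →L[ℂ] Schrodinger.Linfty),
        (∀ τ : ℝ, Schrodinger.IsWeightedBoundaryResolvent V (α + 1) s τ (B τ)) ∧
        (∀ τ : ℝ, τ < 0 → Schrodinger.IsWeightedResolvent V (α + 1) (τ : ℂ) (B τ)) ∧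
        ∀ τ : ℝ, τ ≠ 0 → DifferentiableAt ℝ B τ ∧
          ‖(φ₁ τ * τ) • deriv B τ‖ ≤ C ∧ ‖φ₂ τ • deriv B τ‖ ≤ C) := by
  obtain ⟨η, M, hD, hD'⟩ := exists_decayBound hV.continuous hdecay
  have hW : ∀ k : ℂ, 0 ≤ k.im → wronskian V k ≠ 0 := fun k hk =>
    wronskian_ne_zero hD hD' hres heig hk
  obtain ⟨δ, C₀, hG, hb⟩ := exists_greenKernel hD hD' hW
  have hR : ∀ {β : ℝ} {A : ℂ → Linfty →L[ℂ] Linfty}, 1 < β →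
      (∀ k, 0 ≤ k.im → HasKernel (A k) (weightedKernel β (green V k))) →
      ∀ k : ℂ, 0 < k.im → IsWeightedResolvent V β (k ^ 2) (A k) := fun hβ hA k hk =>
    isWeightedResolvent_of_hasKernel hD hD' hk (heig _) (hW k hk.le) (hG.cont k hk.le)
      (hb k hk.le) hβ (hA k hk.le)
  have hα' : 1 < α + 1 := by linarith
  obtain ⟨A, B₁, hA, hAb, hAc⟩ := exists_weighted_operator hG hα
  obtain ⟨B, -, hB, -, hBc⟩ := exists_weighted_operator hG hα'
  obtain ⟨B₂, hBd⟩ := weighted_operator_hasDerivWithinAt hG hα hB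
  obtain ⟨-, -, hφ1, hφ2, hφs, hφc, -⟩ := hφ
  refine ⟨max B₁ (B₂ / 2), fun s hs => ?_⟩
  have hs2 : s ^ 2 = 1 := by rcases hs with rfl | rfl <;> norm_num
  refine ⟨⟨fun τ => A (spectralRoot s τ 0),
    isWeightedBoundaryResolvent_of_continuousOn (hR hα hA) hAc hs2,
    fun τ hτ => isWeightedResolvent_of_neg (hR hα hA) hs2 hτ,
    fun τ => (hAb _ (spectralRoot_im_nonneg s τ 0)).trans (le_max_left _ _)⟩,
    ⟨fun τ => B (spectralRoot s τ 0),
    isWeightedBoundaryResolvent_of_continuousOn (hR hα' hB) hBc hs2,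
    fun τ hτ => isWeightedResolvent_of_neg (hR hα' hB) hs2 hτ, fun τ hτ => ?_⟩⟩
  obtain ⟨hdiff, hbound⟩ := differentiableAt_comp_spectralRoot hBd hs2 hτ
  have h1 : φ₁ τ ≤ 1 := by linarith [hφs τ, hφ2 τ]
  -- `φ₂` vanishes for `|τ| ≤ 1` and is at most `1` elsewhere. With `φ₁ ≤ 1`, both cutoff estimates
  -- reduce to the single bound on `|τ| ‖∂_τ B‖`.
  have h2 : φ₂ τ ≤ |τ| := by
    rcases le_or_gt |τ| 1 with h | h
    · have := hφs τ
      rw [hφc τ h] at this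
      linarith [abs_nonneg τ]
    · linarith [hφs τ, hφ1 τ]
  refine ⟨hdiff, le_trans ?_ (hbound.trans (le_max_right _ _)),
    le_trans ?_ (hbound.trans (le_max_right _ _))⟩
  · rw [norm_smul, Real.norm_eq_abs, abs_mul, abs_of_nonneg (hφ1 τ)]
    exact mul_le_mul_of_nonneg_right (mul_le_of_le_one_left (abs_nonneg _) h1) (norm_nonneg _)
  · rw [norm_smul, Real.norm_of_nonneg (hφ2 τ)]
    exact mul_le_mul_of_nonneg_right h2 (norm_nonneg _)
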